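/- **Setting.** Let $\mathcal H$ be a separable real reproducing kernel Hilbert space of functions on a measurable space $\mathcal X$, with kernel $K$ such that every $K(\cdot,x)$ is measurable and $K(x,y)\le\kappa^2$ for all $x,y$ $(\kappa\ge 0)$; put $\phi(x)=K(\cdot,x)$ and $(g\otimes f)h=\langle f,h\rangle_{\mathcal H}\,g$. Let $\mu_1,\dots,\mu_N$ be probability measures on $\mathcal X\times\mathbb R$ with $\mathbb E_{\mu_i}|Y|<\infty$ whose regression functions $\mathbb E_{\mu_i}[Y\mid X]$ are given by $f_i\in\mathcal H$, and let $\Sigma_i=\mathbb E_{\mu_i}[\phi(X)\otimes\phi(X)]$. The source condition with $r\in[0,1]$ and $R$ says $\|\Sigma_i^{-r}f_i\|_{\mathcal H}\le R$ for all $i$, i.e. $f_i=\Sigma_i^{r}h_i$ for some $h_i\in\mathcal H$ with $\|h_i\|_{\mathcal H}\le R$. For a sample $(x_j,y_j)_{j\le m}$, $\lambda>0$ and a complete subspace $W\subseteq\mathcal H$, the ridge estimator over $W$ is the minimizer over $f\in W$ of $\sum_{j=1}^m(y_j-f(x_j))^2+m\lambda\|f\|_{\mathcal H}^2$. For each $i$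 there are $2n$ independent observations of $\mu_i$, independent over $i$; $\hat f'_{i,\lambda}$ and $\hat f_{i,\lambda}$ are the ridge estimators over $\mathcal H$ from the first and the last $n$ of them. Put $$C_N=\frac1N\sum_{i=1}^N f_i\otimes f_i,\qquad \bar C_{N,n,\lambda}=\frac1N\sum_{i=1}^N\mathbb E[\hat f_{i,\lambda}]\otimes\mathbb E[\hat f_{i,\lambda}],\qquad \hat C_{N,n,\lambda}=\frac1N\sum_{i=1}^N\hat f'_{i,\lambda}\otimes\hat f_{i,\lambda}.$$ **(1) Bias bound.** There is $J_1$ depending only on $\kappa$ and $R$ such that, under the source condition with $r\in[0,1]$, for all $\lambda\in(0,1]$, $n\ge1$ and all $N$, the estimators $\hat f_{i,\lambda}$ are integrable and $$\|\bar C_{N,n,\lambda}-C_N\|_{HS}\le J_1\,\lambda^{r}\Bigl(1+\frac1{\lambda\sqrt n}\Bigr).$$ **(2) Excess risk when $N\gtrsim\exp(n)$.** Let moreover $\mu_T$ be a target probability measure on $\mathcal X\times\mathbb R$ with regression function $f_T\in\mathcal H$, let $\mathcal H_s=\operatorname{span}\{f_1,\dots,f_N\}$ have dimension $s\ge1$ and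 contain $f_T$, let $|Y|\le Y_\infty$ almost surely under every $\mu_i$ and under $\mu_T$, let $\gamma>0$ be a lower bound for the nonzero eigenvalues of $C_N$, and let $\|f_T\|_{\mathcal H}\le F$. For $\lambda=n^{-1/2}$ let $\hat{\mathcal H}_s$ be the span of $s$ orthonormal right singular vectors of $\hat C_{N,n,\lambda}$ for its $s$ largest singular values, and let $\hat f_{T,\lambda_*}$ be the ridge estimator over $\hat{\mathcal H}_s$ with parameter $\lambda_*=12\kappa^2(\log s\vee\tau)\,n_T^{-1}$ from $n_T$ independent observations of $\mu_T$, independent of the source data. Let $\mathcal E_{\mu_T}(f)=\bigl(\mathbb E_{\mu_T}(Y-f(X))^2-\mathbb E_{\mu_T}(Y-f_T(X))^2\bigr)^{1/2}$. For every $a>0$ there is a constant $C$ depending only on $\kappa,R,Y_\infty,\gamma,F$ and $a$ such that, whenever the source condition holds with $r\in[0,1]$, $n\ge1$, $N\ge a\,e^{n}$, $\tau\ge 2.6$ and $n_T\ge12\kappa^2(\log s\vee\tau)$, the following holds with probability at least $1-2e^{-\tau}$ over the source data: for every choice of the top $s$ right singular vectors, conditionally on the source data, with probability at least $1-3e^{-\tau}$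 over the target sample, $$\mathcal E_{\mu_T}(\hat f_{T,\lambda_*})\le C\,\tau\left(\sqrt{\frac{s}{n_T}}+n^{-r/2}\right).$$ -/

import Mathlib

open MeasureTheory ProbabilityTheory InnerProductSpace
open scoped ENNReal

noncomputable section

namespace MetaKRR

/-! ### Operators on a real Hilbert space -/

section Operators

variable {H : Type*} [NormedAddCommGroup H] [InnerProductSpace ℝ H] [CompleteSpace H]

/-- Hilbert-Schmidt norm `(∑ ‖A e‖²)^(1/2)` over an orthonormal basis, with value `∞` when `A` is
not Hilbert-Schmidt. It does not depend on the basis, see `hsNorm_eq`. -/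
def hsNorm (A : H →L[ℝ] H) : ℝ≥0∞ :=
  (∑' e : (exists_hilbertBasis ℝ H).choose, ‖A (e : H)‖ₑ ^ 2) ^ (1 / 2 : ℝ)

theorem enorm_sq_eq_tsum {ι H : Type*} [NormedAddCommGroup H] [InnerProductSpace ℝ H]
    (b : HilbertBasis ι ℝ H) (x : H) :
    ‖x‖ₑ ^ 2 = ∑' i, ‖inner ℝ (b i) x‖ₑ ^ 2 := by
  have h1 := b.hasSum_inner_mul_inner x x
  have h2 : HasSum (fun i => ‖inner ℝ (b i) x‖ ^ 2) (‖x‖ ^ 2) := by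
    rw [← real_inner_self_eq_norm_sq]
    refine h1.congr_fun ?_ |> fun h => h
    intro i
    rw [Real.norm_eq_abs, sq_abs, real_inner_comm x (b i)]
    ring
  have h3 := ENNReal.ofReal_tsum_of_nonneg (fun i => sq_nonneg ‖inner ℝ (b i) x‖) h2.summable
  rw [h2.tsum_eq] at h3
  simp_rw [ENNReal.ofReal_pow (norm_nonneg _), ofReal_norm] at h3
  exact h3

theorem tsum_enorm_sq_adjoint {ι ι' : Type*} (b : HilbertBasis ι ℝ H) (b' : HilbertBasis ι' ℝ H)
    (A : H →L[ℝ] H) : ∑' i, ‖A (b i)‖ₑ ^ 2 = ∑' j, ‖A.adjoint (b' j)‖ₑ ^ 2 := by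
  simp_rw [enorm_sq_eq_tsum b' (A _), enorm_sq_eq_tsum b (A.adjoint _)]
  rw [ENNReal.tsum_comm]
  refine tsum_congr fun j => tsum_congr fun i => ?_
  rw [ContinuousLinearMap.adjoint_inner_right, real_inner_comm]

/-- The Hilbert-Schmidt norm can be computed in any orthonormal basis. -/
theorem hsNorm_eq {ι : Type*} (b : HilbertBasis ι ℝ H) (A : H →L[ℝ] H) :
    hsNorm A = (∑' i, ‖A (b i)‖ₑ ^ 2) ^ (1 / 2 : ℝ) := by
  obtain ⟨b', hb'⟩ := (exists_hilbertBasis ℝ H).choose_spec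
  rw [tsum_enorm_sq_adjoint b b' A, ← tsum_enorm_sq_adjoint b' b' A, hb', hsNorm]

/-- The power `S ^ r` (`r ≥ 0`) of a compact positive self-adjoint operator through its spectral
decomposition: the sum over all eigenvalues `t` of `t ^ r` times the orthogonal projection onto the
eigenspace `ker (S - t)` (a real `t` that is not an eigenvalue contributes `0`). For `r = 0` this is
the identity, since `0 ^ 0 = 1`. -/
def opPow (S : H →L[ℝ] H) (r : ℝ) (h : H) : H :=
  ∑' t : ℝ, t ^ r •
    (S - t • ContinuousLinearMap.id ℝ H).ker.starProjection h

/-- `v 1, …, v s` are right singular vectors of `A` for its `s` largest singular values, counted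
with multiplicity: orthonormal eigenvectors `A* A v j = σ j ² v j` such that on the
orthogonal complement of their span `A` is bounded by every `σ j`. -/
def IsTopRightSingular {s : ℕ} (A : H →L[ℝ] H) (v : Fin s → H) : Prop :=
  Orthonormal ℝ v ∧ ∃ σ : Fin s → ℝ,
    (∀ j, 0 ≤ σ j ∧ A.adjoint (A (v j)) = σ j ^ 2 • v j) ∧
    ∀ w : H, (∀ j, inner ℝ (v j) w = 0) → ∀ j, ‖A w‖ ≤ σ j * ‖w‖

/-- The task operator `(1 / N) ∑ f i ⊗ f i`, where `(g ⊗ f) h = ⟨f, h⟩ g`. -/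
def taskCov {N : ℕ} (f : Fin N → H) : H →L[ℝ] H :=
  (1 / (N : ℝ)) • ∑ i, rankOne ℝ (f i) (f i)

end Operators

/-! ### Kernel ridge regression -/

section Regression

variable {X H : Type*} [NormedAddCommGroup H] [InnerProductSpace ℝ H] [RKHS ℝ H X ℝ]

/-- The objective `∑ (y j - f (x j))² + m l ‖f‖²` of ridge regression with regularization `l` on a
sample of size `m`. -/
def ridgeObjective {m : ℕ} (l : ℝ) (D : Fin m → X × ℝ) (f : H) : ℝ :=
  ∑ j, ((D j).2 - f (D j).1) ^ 2 + m * l * ‖f‖ ^ 2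

/-- `f` minimizes the ridge objective over the subspace `W`. -/
def IsRidge {m : ℕ} (W : Submodule ℝ H) (l : ℝ) (D : Fin m → X × ℝ) (f : H) : Prop :=
  f ∈ W ∧ ∀ g ∈ W, ridgeObjective l D f ≤ ridgeObjective l D g

/-- The ridge regression estimator over the subspace `W`, the minimizer of the ridge objective. -/
def ridge {m : ℕ} (W : Submodule ℝ H) (l : ℝ) (D : Fin m → X × ℝ) : H :=
  Classical.epsilon (IsRidge W l D)

/-- The squared expected risk. -/
def risk [MeasurableSpace X] (μ : Measure (X × ℝ)) (f : H) : ℝ :=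
  ∫ p, (p.2 - f p.1) ^ 2 ∂μ

/-- The excess risk of `f` relative to the regression function `fstar`. -/
def excessRisk [MeasurableSpace X] (μ : Measure (X × ℝ)) (f fstar : H) : ℝ :=
  √(risk μ f - risk μ fstar)

/-- `f` is the regression function `E[Y | X]` of `μ`. -/
def IsRegressionFunction [MeasurableSpace X] (μ : Measure (X × ℝ)) (f : H) : Prop :=
  Integrable Prod.snd μ ∧
    μ[Prod.snd | MeasurableSpace.comap Prod.fst inferInstance] =ᵐ[μ] fun p => f p.1

/-- The expected ridge estimator over the whole space from `n` independent observations of `μ`. -/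
def meanRidge [MeasurableSpace X] (H : Type*) [NormedAddCommGroup H] [InnerProductSpace ℝ H]
    [RKHS ℝ H X ℝ] (n : ℕ) (l : ℝ) (μ : Measure (X × ℝ)) : H :=
  ∫ D, ridge (⊤ : Submodule ℝ H) l D ∂(Measure.pi fun _ : Fin n => μ)

/-- The law of the source data: `2 n` independent observations of each of the `N` tasks. -/
def sourceLaw [MeasurableSpace X] {N : ℕ} (n : ℕ) (μ : Fin N → Measure (X × ℝ)) :
    Measure (Fin N → Fin (n + n) → X × ℝ) :=
  Measure.pi fun i => Measure.pi fun _ => μ i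

variable [CompleteSpace H]

/-- The estimator `(1 / N) ∑ f̂' i ⊗ f̂ i` of the task operator, where `f̂' i` and `f̂ i` are the ridge
estimators from the first and the last `n` observations of task `i`. -/
def empTaskCov (H : Type*) [NormedAddCommGroup H] [InnerProductSpace ℝ H] [RKHS ℝ H X ℝ]
    {N n : ℕ} (l : ℝ) (D : Fin N → Fin (n + n) → X × ℝ) : H →L[ℝ] H :=
  (1 / (N : ℝ)) • ∑ i, rankOne ℝ
    (ridge (⊤ : Submodule ℝ H) l fun j : Fin n => D i (Fin.castAdd n j))
    (ridge (⊤ : Submodule ℝ H) l fun j : Fin n => D i (Fin.natAdd n j))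

/-- The canonical feature map `φ x = K(·, x)`. -/
def featureMap (H : Type*) [NormedAddCommGroup H] [InnerProductSpace ℝ H] [RKHS ℝ H X ℝ]
    [CompleteSpace H] (x : X) : H :=
  RKHS.kerFun H x (1 : ℝ)

theorem inner_featureMap (x : X) (f : H) : inner ℝ (featureMap H x) f = f x := by
  simp [featureMap]

/-- Every feature `K(·, x)` is measurable and the kernel is bounded by `κ²`. -/
structure KernelAssumptions [MeasurableSpace X] (H : Type*) [NormedAddCommGroup H]
    [InnerProductSpace ℝ H] [RKHS ℝ H X ℝ] [CompleteSpace H] (κ : ℝ) : Prop where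
  measurable_feature : ∀ x : X, Measurable fun y : X => featureMap H x y
  kernel_le : ∀ x y : X, featureMap H x y ≤ κ ^ 2

/-- The covariance operator `E[φ(X) ⊗ φ(X)]`. -/
def covariance [MeasurableSpace X] (H : Type*) [NormedAddCommGroup H]
    [InnerProductSpace ℝ H] [RKHS ℝ H X ℝ] [CompleteSpace H] (μ : Measure (X × ℝ)) :
    H →L[ℝ] H :=
  ∫ p, rankOne ℝ (featureMap H p.1) (featureMap H p.1) ∂μ

/-- The source condition `‖Σ^(-r) f‖ ≤ R`: since `Σ^(-r) f` is the preimage of `f` under `Σ^r` of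
least norm, it says that `f = Σ^r h` for some `h` of norm at most `R`. -/
def SourceCondition [MeasurableSpace X] (μ : Measure (X × ℝ)) (r R : ℝ) (f : H) : Prop :=
  ∃ h : H, ‖h‖ ≤ R ∧ opPow (covariance H μ) r h = f

/-- The ridge estimator exists and is unique. -/
theorem existsUnique_isRidge {m : ℕ} (hm : 0 < m) (W : Submodule ℝ H) [CompleteSpace W] {l : ℝ}
    (hl : 0 < l) (D : Fin m → X × ℝ) : ∃! f : H, IsRidge W l D f := by
  have hml : 0 < (m : ℝ) * l := by positivity
  let u : Fin m → W := fun j => W.orthogonalProjectionOnto (featureMap H (D j).1)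
  have hu : ∀ j (g : W), inner ℝ (u j) g = (g : H) (D j).1 := by
    intro j g
    rw [← inner_featureMap, Submodule.coe_inner]
    exact Submodule.inner_orthogonalProjectionOnto_eq_of_mem_right g _
  let B : W →L[ℝ] W →L[ℝ] ℝ :=
    ((m : ℝ) * l) • LinearMap.mkContinuous₂ (innerₗ W) 1
        (fun x y => by simpa using norm_inner_le_norm (𝕜 := ℝ) x y) +
      ∑ j, (innerSL ℝ (u j)).smulRight (innerSL ℝ (u j))
  have hB : ∀ f g : W, B f g =
      (m : ℝ) * l * inner ℝ f g + ∑ j, inner ℝ (u j) f * inner ℝ (u j) g := by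
    intro f g
    simp [B, sum_apply]
  have hco : IsCoercive B := by
    refine ⟨(m : ℝ) * l, hml, fun f => ?_⟩
    rw [hB, real_inner_self_eq_norm_mul_norm]
    have : 0 ≤ ∑ j, inner ℝ (u j) f * inner ℝ (u j) f :=
      Finset.sum_nonneg fun j _ => mul_self_nonneg _
    linarith
  let f : W := hco.continuousLinearEquivOfBilin.symm (∑ j, (D j).2 • u j)
  have hf : ∀ g : W, B f g = ∑ j, (D j).2 * inner ℝ (u j) g := by
    intro g
    rw [← hco.continuousLinearEquivOfBilin_apply f g]
    simp [f, sum_inner, inner_smul_left]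
  have key : ∀ g : W, ridgeObjective l D (g : H) =
      ridgeObjective l D (f : H) + B (g - f) (g - f) := by
    intro g
    obtain ⟨d, rfl⟩ : ∃ d, g = f + d := ⟨g - f, by abel⟩
    have h1 := hf d
    rw [hB] at h1
    rw [add_sub_cancel_left, hB]
    unfold ridgeObjective
    have hn : ‖((f + d : W) : H)‖ ^ 2 = ‖(f : H)‖ ^ 2 + 2 * inner ℝ f d + inner ℝ d d := by
      rw [Submodule.coe_add, norm_add_sq_real, real_inner_self_eq_norm_sq, Submodule.coe_inner]
      rfl
    have hs : ∑ j, ((D j).2 - ((f + d : W) : H) (D j).1) ^ 2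
        = ∑ j, ((D j).2 - (f : H) (D j).1) ^ 2 - 2 * ∑ j, (D j).2 * inner ℝ (u j) d
          + 2 * ∑ j, inner ℝ (u j) f * inner ℝ (u j) d
          + ∑ j, inner ℝ (u j) d * inner ℝ (u j) d := by
      simp only [Finset.mul_sum, ← Finset.sum_sub_distrib, ← Finset.sum_add_distrib]
      refine Finset.sum_congr rfl fun j _ => ?_
      rw [← hu j (f + d), ← hu j f, inner_add_right]
      ring
    rw [hn, hs, ← h1]
    ring
  have hpos : ∀ d : W, (m : ℝ) * l * ‖d‖ ^ 2 ≤ B d d := by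
    intro d
    rw [hB, real_inner_self_eq_norm_sq]
    have : 0 ≤ ∑ j, inner ℝ (u j) d * inner ℝ (u j) d :=
      Finset.sum_nonneg fun j _ => mul_self_nonneg _
    linarith
  refine ⟨f, ⟨f.2, fun g hg => ?_⟩, ?_⟩
  · have h1 := key ⟨g, hg⟩
    have h2 := hpos (⟨g, hg⟩ - f)
    have h3 : 0 ≤ (m : ℝ) * l * ‖(⟨g, hg⟩ : W) - f‖ ^ 2 := by positivity
    simp only at h1
    linarith
  · rintro g ⟨hg, hmin⟩
    have h1 := key ⟨g, hg⟩
    have h2 := hpos (⟨g, hg⟩ - f)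
    have h4 := hmin f f.2
    simp only at h1
    have h5 : (m : ℝ) * l * ‖(⟨g, hg⟩ : W) - f‖ ^ 2 ≤ 0 := by linarith
    have h6 : ‖(⟨g, hg⟩ : W) - f‖ ^ 2 ≤ 0 := by
      by_contra h
      push Not at h
      have := mul_pos hml h
      linarith
    have h7 : (⟨g, hg⟩ : W) - f = 0 := by
      have h8 : ‖(⟨g, hg⟩ : W) - f‖ = 0 := by nlinarith [norm_nonneg ((⟨g, hg⟩ : W) - f)]
      exact norm_eq_zero.mp h8
    exact congrArg Subtype.val (sub_eq_zero.mp h7)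

theorem isRidge_ridge {m : ℕ} (hm : 0 < m) (W : Submodule ℝ H) [CompleteSpace W] {l : ℝ}
    (hl : 0 < l) (D : Fin m → X × ℝ) : IsRidge W l D (ridge W l D) :=
  Classical.epsilon_spec (existsUnique_isRidge hm W hl D).exists

end Regression

end MetaKRR

end

/-!
Let `Σ` and `Σ̂` be the population and the empirical covariance operator of one source task. The
noise has conditional mean zero, so the ridge estimator has the mean of `(Σ̂ + l)⁻¹ Σ̂ f`, which
differs from `(Σ + l)⁻¹ Σ f` by `l (Σ̂ + l)⁻¹ (Σ - Σ̂) (Σ + l)⁻¹ f`. At a fixed vector `Σ̂ - Σ`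
is of size `1 / √n` in mean square, and the source condition gives `‖l (Σ + l)⁻¹ f‖ ≤ R l ^ r`:
this is the bias bound.

The average `Ĉ` of `N` independent operators with mean `C̄`, each at most `B² / l` in
Hilbert-Schmidt norm, has variance at most `B⁴ n / N` for `l = 1 / √n`. When `a eⁿ ≤ N` and
`2 τ ≤ n`, Chebyshev's inequality already gives a deviation of order `1 / √n` with failure
probability `exp (-τ)`; for `n ≤ 2 τ` the almost sure bound of order `√n` is at most of order
`τ / √n`. By the eigengap `γ`, a deviation `Δ` moves `f_T` to distance at most `2 Δ F / γ` from
the span of the top right singular vectors.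

On the learned subspace `W`, the normal equation reduces the risk to two facts: the regularized
population norm is dominated on `W` by its empirical counterpart, and the noise is a small linear
functional in the population norm. In coordinates that whiten the population norm, the first is a
lower tail of the smallest eigenvalue of a Gram matrix, obtained from the expectation of `tr A⁻ᵖ`
by adding one observation at a time with the Sherman-Morrison formula; the second follows from
the exponential moments of the coordinates.
-/

noncomputable section

namespace MetaKRR

/-! ### Hilbert-Schmidt norm -/

section HilbertSchmidt

variable {H : Type*} [NormedAddCommGroup H] [InnerProductSpace ℝ H] [CompleteSpace H]

theorem hsNorm_sq {ι : Type*} (b : HilbertBasis ι ℝ H) (A : H →L[ℝ] H) :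
    hsNorm A ^ 2 = ∑' i, ‖A (b i)‖ₑ ^ 2 := by
  rw [hsNorm_eq b, ← ENNReal.rpow_natCast, ← ENNReal.rpow_mul]
  norm_num

theorem sqrt_sum_enorm_sq_le_hsNorm {ι : Type*} (b : HilbertBasis ι ℝ H) (A : H →L[ℝ] H)
    (s : Finset ι) : (∑ i ∈ s, ‖A (b i)‖ₑ ^ (2 : ℝ)) ^ (1 / 2 : ℝ) ≤ hsNorm A := by
  simp only [hsNorm_eq b, ENNReal.rpow_ofNat]
  gcongr
  exact ENNReal.sum_le_tsum s

theorem hsNorm_add_le (A B : H →L[ℝ] H) : hsNorm (A + B) ≤ hsNorm A + hsNorm B := by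
  obtain ⟨b, -⟩ := (exists_hilbertBasis ℝ H).choose_spec
  rw [← ENNReal.pow_le_pow_left_iff two_ne_zero, hsNorm_sq b, ENNReal.tsum_eq_iSup_sum]
  refine iSup_le fun s => ?_
  calc ∑ i ∈ s, ‖(A + B) (b i)‖ₑ ^ 2
      ≤ ∑ i ∈ s, (‖A (b i)‖ₑ + ‖B (b i)‖ₑ) ^ (2 : ℝ) := by
        refine Finset.sum_le_sum fun i _ => ?_
        rw [ENNReal.rpow_ofNat]
        gcongr
        exact enorm_add_le _ _
    _ = ((∑ i ∈ s, (‖A (b i)‖ₑ + ‖B (b i)‖ₑ) ^ (2 : ℝ)) ^ (1 / 2 : ℝ)) ^ 2 := by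
        rw [← ENNReal.rpow_natCast, ← ENNReal.rpow_mul]
        norm_num
    _ ≤ (hsNorm A + hsNorm B) ^ 2 := by
        gcongr
        exact (ENNReal.Lp_add_le s _ _ one_le_two).trans
          (add_le_add (sqrt_sum_enorm_sq_le_hsNorm b A s) (sqrt_sum_enorm_sq_le_hsNorm b B s))

theorem hsNorm_smul (c : ℝ) (A : H →L[ℝ] H) : hsNorm (c • A) = ‖c‖ₑ * hsNorm A := by
  obtain ⟨b, -⟩ := (exists_hilbertBasis ℝ H).choose_spec
  apply (ENNReal.pow_right_strictMono two_ne_zero).injective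
  simp only [mul_pow, hsNorm_sq b, ← ENNReal.tsum_mul_left, smul_apply,
    enorm_smul]

theorem hsNorm_sub_le (A C : H →L[ℝ] H) : hsNorm (A - C) ≤ hsNorm A + hsNorm C := by
  have hneg : hsNorm (-C) = hsNorm C := by simp [hsNorm]
  exact sub_eq_add_neg A C ▸ hneg ▸ hsNorm_add_le A (-C)

theorem hsNorm_rankOne (x y : H) : hsNorm (rankOne ℝ x y) = ‖x‖ₑ * ‖y‖ₑ := by
  obtain ⟨b, -⟩ := (exists_hilbertBasis ℝ H).choose_spec
  apply (ENNReal.pow_right_strictMono two_ne_zero).injective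
  simp only [mul_pow, hsNorm_sq b, enorm_sq_eq_tsum b y, ← ENNReal.tsum_mul_left]
  refine tsum_congr fun i => ?_
  rw [rankOne_apply, enorm_smul, mul_pow, mul_comm, real_inner_comm]

theorem hsNorm_zero : hsNorm (0 : H →L[ℝ] H) = 0 := by
  simpa using hsNorm_smul 0 (0 : H →L[ℝ] H)

theorem hsNorm_sum_le {ι : Type*} (s : Finset ι) (A : ι → H →L[ℝ] H) :
    hsNorm (∑ i ∈ s, A i) ≤ ∑ i ∈ s, hsNorm (A i) := by
  classical
  induction s using Finset.induction_on with
  | empty => simp [hsNorm_zero]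
  | insert i s hi ih =>
    rw [Finset.sum_insert hi, Finset.sum_insert hi]
    exact (hsNorm_add_le _ _).trans (by gcongr)

theorem hsNorm_average_le {N : ℕ} {A : Fin N → H →L[ℝ] H} {c : ℝ≥0∞} (hA : ∀ i, hsNorm (A i) ≤ c) :
    hsNorm ((1 / (N : ℝ)) • ∑ i, A i) ≤ c := by
  rcases N.eq_zero_or_pos with rfl | hN
  · simp [hsNorm_zero]
  have hN' : (0 : ℝ) < N := by exact_mod_cast hN
  rw [hsNorm_smul, Real.enorm_eq_ofReal (by positivity)]
  calc ENNReal.ofReal (1 / (N : ℝ)) * hsNorm (∑ i, A i)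
      ≤ ENNReal.ofReal (1 / (N : ℝ)) * (N * c) := by
        gcongr
        refine (hsNorm_sum_le _ _).trans ((Finset.sum_le_card_nsmul _ _ c fun i _ => hA i).trans ?_)
        simp
    _ = c := by
        rw [← mul_assoc, ← ENNReal.ofReal_natCast, ← ENNReal.ofReal_mul (by positivity),
          one_div_mul_cancel hN'.ne', ENNReal.ofReal_one, one_mul]

theorem hsNorm_rankOne_sub_le (x y : H) :
    hsNorm (rankOne ℝ x x - rankOne ℝ y y) ≤ ENNReal.ofReal (‖x - y‖ * (‖x‖ + ‖y‖)) := by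
  have h : rankOne ℝ x x - rankOne ℝ y y = rankOne ℝ (x - y) x + rankOne ℝ y (x - y) := by
    simp [sub_eq_add_neg, add_assoc]
  rw [h]
  refine (hsNorm_add_le _ _).trans_eq ?_
  rw [hsNorm_rankOne, hsNorm_rankOne, mul_comm ‖y‖ₑ, ← mul_add,
    ENNReal.ofReal_mul (norm_nonneg _), ENNReal.ofReal_add (norm_nonneg _) (norm_nonneg _),
    ofReal_norm, ofReal_norm, ofReal_norm]

theorem enorm_apply_le_hsNorm (A : H →L[ℝ] H) (x : H) : ‖A x‖ₑ ≤ hsNorm A * ‖x‖ₑ := by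
  obtain ⟨b, -⟩ := (exists_hilbertBasis ℝ H).choose_spec
  rw [← ENNReal.pow_le_pow_left_iff two_ne_zero, enorm_sq_eq_tsum b, mul_pow, hsNorm_sq b,
    tsum_enorm_sq_adjoint b b, ← ENNReal.tsum_mul_right]
  refine ENNReal.tsum_le_tsum fun i => ?_
  rw [← mul_pow, ← ContinuousLinearMap.adjoint_inner_left]
  gcongr
  simpa [enorm_eq_nnnorm, ← ENNReal.coe_mul] using
    nnnorm_inner_le_nnnorm (𝕜 := ℝ) (A.adjoint (b i)) x

theorem norm_apply_le_of_hsNorm_le {A : H →L[ℝ] H} {c : ℝ} (hc : 0 ≤ c)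
    (h : hsNorm A ≤ ENNReal.ofReal c) (x : H) : ‖A x‖ ≤ c * ‖x‖ := by
  rw [← ENNReal.ofReal_le_ofReal_iff (by positivity), ofReal_norm, ENNReal.ofReal_mul hc,
    ofReal_norm]
  exact (enorm_apply_le_hsNorm A x).trans (by gcongr)

end HilbertSchmidt

/-! ### Resolvents and fractional powers of positive operators -/

section Resolvent

variable {H : Type*} [NormedAddCommGroup H] [InnerProductSpace ℝ H] {S : H →L[ℝ] H} {l : ℝ}

theorem norm_sq_add_norm_sq_le_norm_add_smul_sq (hS : S.IsPositive) (hl : 0 ≤ l) (x : H) :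
    ‖S x‖ ^ 2 + l ^ 2 * ‖x‖ ^ 2 ≤ ‖S x + l • x‖ ^ 2 := by
  rw [norm_add_sq_real, inner_smul_right, norm_smul, Real.norm_of_nonneg hl]
  nlinarith [mul_nonneg hl (hS.inner_nonneg_left x)]

/-- The regularized inverse `(S + l)⁻¹` of ridge regression. It is `0` by convention when `S + l` is
not invertible, which does not happen for positive `S` and `0 < l`. -/
def regInv (S : H →L[ℝ] H) (l : ℝ) : H →L[ℝ] H :=
  Ring.inverse (S + l • ContinuousLinearMap.id ℝ H)

variable [CompleteSpace H]

theorem isUnit_add_smul_id (hS : S.IsPositive) (hl : 0 < l) :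
    IsUnit (S + l • ContinuousLinearMap.id ℝ H) := by
  refine ContinuousLinearMap.isUnit_of_forall_le_norm_inner_map _ (c := ⟨l, hl.le⟩) hl fun x => ?_
  have hSx : 0 ≤ inner ℝ (S x) x := hS.inner_nonneg_left x
  have hinner : inner ℝ ((S + l • ContinuousLinearMap.id ℝ H) x) x
      = inner ℝ (S x) x + l * ‖x‖ ^ 2 := by
    simp [inner_add_left, inner_smul_left]
  rw [hinner, Real.norm_of_nonneg (by positivity)]
  change ‖x‖ ^ 2 * l ≤ _
  linarith

theorem regInv_apply_add (hS : S.IsPositive) (hl : 0 < l) (x : H) :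
    regInv S l (S x + l • x) = x := by
  simpa [regInv] using DFunLike.congr_fun (Ring.inverse_mul_cancel _ (isUnit_add_smul_id hS hl)) x

theorem apply_regInv_add (hS : S.IsPositive) (hl : 0 < l) (x : H) :
    S (regInv S l x) + l • regInv S l x = x := by
  simpa [regInv] using DFunLike.congr_fun (Ring.mul_inverse_cancel _ (isUnit_add_smul_id hS hl)) x

theorem regInv_apply_apply (hS : S.IsPositive) (hl : 0 < l) (x : H) :
    regInv S l (S x) = x - l • regInv S l x := by
  rw [eq_sub_iff_add_eq, ← map_smul, ← map_add, regInv_apply_add hS hl]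

theorem norm_regInv_apply_le (hS : S.IsPositive) (hl : 0 < l) (x : H) :
    ‖regInv S l x‖ ≤ l⁻¹ * ‖x‖ := by
  have h := norm_sq_add_norm_sq_le_norm_add_smul_sq hS hl.le (regInv S l x)
  rw [apply_regInv_add hS hl] at h
  rw [inv_mul_eq_div, le_div_iff₀ hl]
  refine le_of_sq_le_sq ?_ (norm_nonneg _)
  nlinarith [sq_nonneg ‖S (regInv S l x)‖]

theorem norm_regInv_apply_apply_le (hS : S.IsPositive) (hl : 0 < l) (x : H) :
    ‖regInv S l (S x)‖ ≤ ‖x‖ := by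
  have h := norm_sq_add_norm_sq_le_norm_add_smul_sq hS hl.le (regInv S l x)
  have hx := apply_regInv_add hS hl x
  rw [regInv_apply_apply hS hl, ← eq_sub_of_add_eq hx]
  rw [hx] at h
  refine le_of_sq_le_sq ?_ (norm_nonneg _)
  linarith [mul_nonneg (sq_nonneg l) (sq_nonneg ‖regInv S l x‖)]

end Resolvent

section Power

variable {H : Type*} [NormedAddCommGroup H] [InnerProductSpace ℝ H] [CompleteSpace H]
  {S : H →L[ℝ] H}

/-- The orthogonal projection onto the eigenspace `ker (S - t)`, which is `0` unless `t` is an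
eigenvalue. These are the summands of `opPow`. -/
def eigProj (S : H →L[ℝ] H) (t : ℝ) : H →L[ℝ] H :=
  (S - t • ContinuousLinearMap.id ℝ H).ker.starProjection

theorem opPow_eq_tsum_eigProj (S : H →L[ℝ] H) (r : ℝ) (h : H) :
    opPow S r h = ∑' t : ℝ, t ^ r • eigProj S t h := rfl

theorem apply_eigProj (S : H →L[ℝ] H) (t : ℝ) (h : H) : S (eigProj S t h) = t • eigProj S t h := by
  have hmem : eigProj S t h ∈ (S - t • ContinuousLinearMap.id ℝ H).ker :=
    Submodule.starProjection_apply_mem _ _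
  simpa [sub_eq_zero] using LinearMap.mem_ker.1 hmem

theorem inner_eigProj_self (S : H →L[ℝ] H) (t : ℝ) (h : H) :
    inner ℝ (eigProj S t h) h = ‖eigProj S t h‖ ^ 2 := by
  rw [eigProj, ← real_inner_self_eq_norm_sq, Submodule.inner_starProjection_left_eq_right,
    Submodule.inner_starProjection_left_eq_right,
    Submodule.starProjection_eq_self_iff.2 (Submodule.starProjection_apply_mem _ _)]

theorem inner_eigProj_of_ne (hS : (S : H →ₗ[ℝ] H).IsSymmetric) {t u : ℝ} (htu : t ≠ u) (h : H) :
    inner ℝ (eigProj S t h) (eigProj S u h) = 0 := by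
  have hsymm : inner ℝ (S (eigProj S t h)) (eigProj S u h)
      = inner ℝ (eigProj S t h) (S (eigProj S u h)) := hS _ _
  rw [apply_eigProj, apply_eigProj, real_inner_smul_left, real_inner_smul_right] at hsymm
  exact (mul_eq_mul_right_iff.1 hsymm).resolve_left htu

theorem norm_sum_smul_eigProj_sq (hS : (S : H →ₗ[ℝ] H).IsSymmetric) (s : Finset ℝ) (c : ℝ → ℝ)
    (h : H) : ‖∑ t ∈ s, c t • eigProj S t h‖ ^ 2 = ∑ t ∈ s, c t ^ 2 * ‖eigProj S t h‖ ^ 2 := by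
  rw [← real_inner_self_eq_norm_sq, sum_inner]
  refine Finset.sum_congr rfl fun t ht => ?_
  rw [inner_sum, Finset.sum_eq_single_of_mem t ht fun u _ hut => ?_]
  · rw [real_inner_self_eq_norm_sq, norm_smul, mul_pow, Real.norm_eq_abs, sq_abs]
  · rw [real_inner_smul_left, real_inner_smul_right, inner_eigProj_of_ne hS hut.symm, mul_zero,
      mul_zero]

theorem sum_norm_eigProj_sq_le (hS : (S : H →ₗ[ℝ] H).IsSymmetric) (s : Finset ℝ) (h : H) :
    ∑ t ∈ s, ‖eigProj S t h‖ ^ 2 ≤ ‖h‖ ^ 2 := by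
  have hnorm : ‖∑ t ∈ s, eigProj S t h‖ ^ 2 = ∑ t ∈ s, ‖eigProj S t h‖ ^ 2 := by
    simpa using norm_sum_smul_eigProj_sq hS s (fun _ => 1) h
  have hinner : inner ℝ (∑ t ∈ s, eigProj S t h) h = ∑ t ∈ s, ‖eigProj S t h‖ ^ 2 := by
    simp only [sum_inner, inner_eigProj_self]
  have hCS := real_inner_le_norm (∑ t ∈ s, eigProj S t h) h
  rw [hinner, ← hnorm] at hCS
  rw [← hnorm]
  nlinarith [sq_nonneg (‖∑ t ∈ s, eigProj S t h‖ - ‖h‖)]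

theorem norm_sum_smul_eigProj_le (hS : (S : H →ₗ[ℝ] H).IsSymmetric) (s : Finset ℝ) {c : ℝ → ℝ}
    {C : ℝ} (hC : 0 ≤ C) (h : H) (hc : ∀ t, eigProj S t h ≠ 0 → |c t| ≤ C) :
    ‖∑ t ∈ s, c t • eigProj S t h‖ ≤ C * ‖h‖ := by
  refine le_of_sq_le_sq ?_ (by positivity)
  rw [norm_sum_smul_eigProj_sq hS, mul_pow]
  calc ∑ t ∈ s, c t ^ 2 * ‖eigProj S t h‖ ^ 2 ≤ ∑ t ∈ s, C ^ 2 * ‖eigProj S t h‖ ^ 2 := by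
        refine Finset.sum_le_sum fun t _ => ?_
        by_cases ht : eigProj S t h = 0
        · simp [ht]
        · rw [← sq_abs (c t)]
          have := hc t ht
          gcongr
    _ = C ^ 2 * ∑ t ∈ s, ‖eigProj S t h‖ ^ 2 := by rw [Finset.mul_sum]
    _ ≤ C ^ 2 * ‖h‖ ^ 2 := by gcongr; exact sum_norm_eigProj_sq_le hS s h

theorem mem_Icc_of_eigProj_ne_zero (hS : S.IsPositive) {t : ℝ} {h : H}
    (ht : eigProj S t h ≠ 0) : t ∈ Set.Icc 0 ‖S‖ := by
  have hpos : 0 < ‖eigProj S t h‖ := norm_pos_iff.2 ht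
  have hinner : 0 ≤ inner ℝ (S (eigProj S t h)) (eigProj S t h) := hS.inner_nonneg_left _
  have hnorm := S.le_opNorm (eigProj S t h)
  rw [apply_eigProj] at hinner hnorm
  rw [real_inner_smul_left, real_inner_self_eq_norm_sq] at hinner
  have ht0 : 0 ≤ t := nonneg_of_mul_nonneg_left hinner (by positivity)
  rw [norm_smul, Real.norm_of_nonneg ht0] at hnorm
  exact ⟨ht0, le_of_mul_le_mul_right hnorm hpos⟩

theorem norm_apply_opPow_le (hS : S.IsPositive) (T : H →L[ℝ] H) {r C : ℝ} {c : ℝ → ℝ} (h : H)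
    (hT : ∀ t, T (eigProj S t h) = c t • eigProj S t h)
    (hc : ∀ t ∈ Set.Icc 0 ‖S‖, |t ^ r * c t| ≤ C) : ‖T (opPow S r h)‖ ≤ C * ‖h‖ := by
  have hC : 0 ≤ C := (abs_nonneg _).trans (hc 0 ⟨le_rfl, norm_nonneg S⟩)
  rw [opPow_eq_tsum_eigProj]
  by_cases hs : Summable fun t : ℝ => t ^ r • eigProj S t h
  · refine le_of_tendsto (hs.hasSum.mapL T).norm (Filter.Eventually.of_forall fun s => ?_)
    simp only [map_smul, hT, smul_smul]
    exact norm_sum_smul_eigProj_le hS.isSymmetric s hC h fun t ht =>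
      hc t (mem_Icc_of_eigProj_ne_zero hS ht)
  · rw [tsum_eq_zero_of_not_summable hs, map_zero, norm_zero]
    positivity

theorem norm_opPow_le (hS : S.IsPositive) {r : ℝ} (hr0 : 0 ≤ r) (hr1 : r ≤ 1) (h : H) :
    ‖opPow S r h‖ ≤ max 1 ‖S‖ * ‖h‖ := by
  refine norm_apply_opPow_le hS (ContinuousLinearMap.id ℝ H) (c := 1) h (by simp)
    fun t ⟨ht0, ht⟩ => ?_
  rw [Pi.one_apply, mul_one, abs_of_nonneg (Real.rpow_nonneg ht0 r)]
  rcases le_total t 1 with ht1 | ht1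
  · exact (Real.rpow_le_one ht0 ht1 hr0).trans (le_max_left _ _)
  · calc t ^ r ≤ t ^ (1 : ℝ) := Real.rpow_le_rpow_of_exponent_le ht1 hr1
      _ = t := Real.rpow_one t
      _ ≤ max 1 ‖S‖ := ht.trans (le_max_right _ _)

theorem rpow_mul_inv_add_le {t l r : ℝ} (ht : 0 ≤ t) (hl : 0 < l) (hr0 : 0 ≤ r) (hr1 : r ≤ 1) :
    t ^ r * (t + l)⁻¹ ≤ l ^ (r - 1) := by
  have hamgm := Real.geom_mean_le_arith_mean2_weighted hr0 (sub_nonneg.2 hr1) ht hl.le (by ring)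
  have hsum : t ^ r * l ^ (1 - r) ≤ t + l := by nlinarith
  have hpow : l ^ (r - 1) = (l ^ (1 - r))⁻¹ := by rw [← Real.rpow_neg hl.le, neg_sub]
  rw [hpow, ← div_eq_mul_inv, div_le_iff₀ (by positivity), inv_mul_eq_div,
    le_div_iff₀ (by positivity)]
  exact hsum

theorem regInv_eigProj (hS : S.IsPositive) {l : ℝ} (hl : 0 < l) (t : ℝ) (h : H) :
    regInv S l (eigProj S t h) = (t + l)⁻¹ • eigProj S t h := by
  by_cases hz : eigProj S t h = 0
  · simp [hz]
  have ht := (mem_Icc_of_eigProj_ne_zero hS hz).1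
  rw [eq_inv_smul_iff₀ (by positivity), ← map_smul, add_smul, ← apply_eigProj,
    regInv_apply_add hS hl]

theorem norm_regInv_opPow_le (hS : S.IsPositive) {r l : ℝ} (hr0 : 0 ≤ r) (hr1 : r ≤ 1)
    (hl : 0 < l) (h : H) : ‖regInv S l (opPow S r h)‖ ≤ l ^ (r - 1) * ‖h‖ := by
  refine norm_apply_opPow_le hS _ (c := fun t => (t + l)⁻¹) h (regInv_eigProj hS hl · h)
    fun t ⟨ht, _⟩ => ?_
  rw [abs_of_nonneg (by positivity)]
  exact rpow_mul_inv_add_le ht hl hr0 hr1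

end Power

/-! ### Separable reproducing kernel Hilbert spaces -/

theorem countable_of_hilbertBasis {ι H : Type*} [NormedAddCommGroup H] [InnerProductSpace ℝ H]
    [TopologicalSpace.SeparableSpace H] (b : HilbertBasis ι ℝ H) : Countable ι := by
  refine Pairwise.countable_of_isOpen_disjoint (s := fun i => Metric.ball (b i) (1 / 2)) ?_
    (fun i => Metric.isOpen_ball) fun i => ⟨b i, by simp⟩
  intro i j hij
  refine Metric.ball_disjoint_ball ?_
  have hnorm : ‖b i - b j‖ ^ 2 = 2 := by
    rw [norm_sub_sq_real, b.orthonormal.1, b.orthonormal.1, b.orthonormal.2 hij]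
    norm_num
  rw [dist_eq_norm]
  nlinarith [norm_nonneg (b i - b j)]

theorem stronglyMeasurable_clm_apply {Ω E F : Type*} [MeasurableSpace Ω] [NormedAddCommGroup E]
    [NormedSpace ℝ E] [NormedAddCommGroup F] [NormedSpace ℝ F] {A : Ω → E →L[ℝ] F} {u : Ω → E}
    (hA : StronglyMeasurable A) (hu : StronglyMeasurable u) :
    StronglyMeasurable fun ω => A ω (u ω) :=
  (isBoundedBilinearMap_apply (𝕜 := ℝ)).continuous.comp_stronglyMeasurable (hA.prodMk hu)

section Features

variable {X H : Type*} [NormedAddCommGroup H] [InnerProductSpace ℝ H] [CompleteSpace H]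
  [RKHS ℝ H X ℝ]

theorem kerFun_eq_smul_featureMap (x : X) (v : ℝ) : RKHS.kerFun H x v = v • featureMap H x := by
  rw [featureMap, ← map_smul, smul_eq_mul, mul_one]

variable [MeasurableSpace X] {κ : ℝ}

theorem norm_featureMap_le (hκ : 0 ≤ κ) (hK : KernelAssumptions H κ) (x : X) :
    ‖featureMap H x‖ ≤ κ := by
  refine le_of_sq_le_sq ?_ hκ
  rw [← real_inner_self_eq_norm_sq, inner_featureMap]
  exact hK.kernel_le x x

theorem abs_apply_le (hκ : 0 ≤ κ) (hK : KernelAssumptions H κ) (f : H) (x : X) :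
    |f x| ≤ κ * ‖f‖ := by
  rw [← inner_featureMap]
  exact (abs_real_inner_le_norm _ _).trans (by gcongr; exact norm_featureMap_le hκ hK x)

theorem measurable_coe (hK : KernelAssumptions H κ) (f : H) : Measurable fun x : X => f x := by
  have hmem : f ∈ (Submodule.span ℝ {RKHS.kerFun H x v | (x : X) (v : ℝ)}).topologicalClosure := by
    rw [RKHS.kerFun_dense]; trivial
  obtain ⟨u, hu, hlim⟩ := mem_closure_iff_seq_limit.1 hmem
  refine measurable_of_tendsto_metrizable (f := fun n x => u n x) (fun n => ?_)
    (tendsto_pi_nhds.2 fun x => ((RKHS.continuous_eval x).tendsto f).comp hlim)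
  refine Submodule.span_induction (p := fun g _ => Measurable fun x : X => g x) ?_ ?_ ?_ ?_ (hu n)
  · rintro _ ⟨y, v, rfl⟩
    simp only [kerFun_eq_smul_featureMap, RKHS.coe_smul, Pi.smul_apply, smul_eq_mul]
    exact (hK.measurable_feature y).const_mul v
  · simp only [RKHS.coe_zero, Pi.zero_apply]
    exact measurable_const
  · intro g h _ _ hg hh
    simp only [RKHS.coe_add, Pi.add_apply]
    exact hg.add hh
  · intro c g _ hg
    simp only [RKHS.coe_smul, Pi.smul_apply, smul_eq_mul]
    exact hg.const_mul c

theorem stronglyMeasurable_featureMap [TopologicalSpace.SeparableSpace H]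
    (hK : KernelAssumptions H κ) : StronglyMeasurable fun x : X => featureMap H x := by
  obtain ⟨w, b, -⟩ := exists_hilbertBasis ℝ H
  have : Countable w := countable_of_hilbertBasis b
  refine stronglyMeasurable_of_tendsto (u := Filter.atTop)
    (f := fun (s : Finset w) x => ∑ i ∈ s, (b i) x • b i) (fun s => ?_)
    (tendsto_pi_nhds.2 fun x => ?_)
  · exact Finset.stronglyMeasurable_fun_sum s fun i _ =>
      (measurable_coe hK (b i)).stronglyMeasurable.smul_const (b i)
  · have hcoord : ∀ i, b.repr (featureMap H x) i = (b i) x := fun i => by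
      rw [b.repr_apply_apply, real_inner_comm, inner_featureMap]
    have hsum := b.hasSum_repr (featureMap H x)
    simp only [hcoord] at hsum
    exact hsum

end Features

/-! ### The ridge estimator -/

section Ridge

variable {X H : Type*} [NormedAddCommGroup H] [InnerProductSpace ℝ H]

section Minimizer

variable [RKHS ℝ H X ℝ]

theorem ridgeObjective_add_smul {m : ℕ} (l : ℝ) (D : Fin m → X × ℝ) (f g : H) (t : ℝ) :
    ridgeObjective l D (f + t • g) = ridgeObjective l D f
      + ((∑ j, g (D j).1 ^ 2 + m * l * ‖g‖ ^ 2) * (t * t)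
        + -(2 * (∑ j, ((D j).2 - f (D j).1) * g (D j).1 - m * l * inner ℝ f g)) * t) := by
  have hnorm : ‖f + t • g‖ ^ 2 = ‖f‖ ^ 2 + 2 * t * inner ℝ f g + t ^ 2 * ‖g‖ ^ 2 := by
    rw [norm_add_sq_real, inner_smul_right, norm_smul, mul_pow, Real.norm_eq_abs, sq_abs]
    ring
  have hloss : ∑ j, ((D j).2 - (f + t • g) (D j).1) ^ 2 = ∑ j, ((D j).2 - f (D j).1) ^ 2
      + t ^ 2 * ∑ j, g (D j).1 ^ 2 - 2 * t * ∑ j, ((D j).2 - f (D j).1) * g (D j).1 := by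
    simp only [Finset.mul_sum, ← Finset.sum_sub_distrib, ← Finset.sum_add_distrib]
    refine Finset.sum_congr rfl fun j _ => ?_
    simp only [RKHS.coe_add, RKHS.coe_smul, Pi.add_apply, Pi.smul_apply, smul_eq_mul]
    ring
  rw [ridgeObjective, ridgeObjective, hnorm, hloss]
  ring

theorem IsRidge.normal_equation {m : ℕ} {W : Submodule ℝ H} {l : ℝ} {D : Fin m → X × ℝ} {f : H}
    (hf : IsRidge W l D f) {g : H} (hg : g ∈ W) :
    ∑ j, ((D j).2 - f (D j).1) * g (D j).1 = m * l * inner ℝ f g := by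
  have hquad : ∀ t : ℝ, 0 ≤ (∑ j, g (D j).1 ^ 2 + m * l * ‖g‖ ^ 2) * (t * t)
      + -(2 * (∑ j, ((D j).2 - f (D j).1) * g (D j).1 - m * l * inner ℝ f g)) * t + 0 := by
    intro t
    have hmin := hf.2 (f + t • g) (W.add_mem hf.1 (W.smul_mem t hg))
    rw [ridgeObjective_add_smul] at hmin
    linarith
  have hdiscrim := discrim_le_zero hquad
  rw [discrim, mul_zero, sub_zero, neg_sq] at hdiscrim
  linarith [sq_eq_zero_iff.1 (hdiscrim.antisymm (sq_nonneg _))]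

theorem IsRidge.norm_sq_le {m : ℕ} (hm : 0 < m) {W : Submodule ℝ H} {l : ℝ} (hl : 0 < l)
    {D : Fin m → X × ℝ} {f : H} (hf : IsRidge W l D f) {B : ℝ} (hB : ∀ j, |(D j).2| ≤ B) :
    ‖f‖ ^ 2 ≤ B ^ 2 / l := by
  have hmin := hf.2 0 W.zero_mem
  simp only [ridgeObjective, RKHS.coe_zero, Pi.zero_apply, sub_zero, norm_zero] at hmin
  have hlabels : ∑ j, (D j).2 ^ 2 ≤ m * B ^ 2 := by
    refine (Finset.sum_le_card_nsmul _ _ (B ^ 2) fun j _ => ?_).trans (by simp)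
    rw [← sq_abs]
    exact pow_le_pow_left₀ (abs_nonneg _) (hB j) 2
  have hloss : 0 ≤ ∑ j, ((D j).2 - f (D j).1) ^ 2 := by positivity
  have hm' : (0 : ℝ) < m := by exact_mod_cast hm
  rw [le_div_iff₀ hl]
  refine le_of_mul_le_mul_left ?_ hm'
  nlinarith

end Minimizer

section PointCov

/-- The empirical covariance operator of points `z j` of `H`. -/
def pointCov {m : ℕ} (z : Fin m → H) : H →L[ℝ] H := (1 / (m : ℝ)) • ∑ j, rankOne ℝ (z j) (z j)

theorem isPositive_pointCov {m : ℕ} (z : Fin m → H) : (pointCov z).IsPositive := by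
  have hsum : (∑ j, rankOne ℝ (z j) (z j)).IsPositive :=
    Finset.sum_induction _ (fun A : H →L[ℝ] H => A.IsPositive) (fun _ _ => .add)
      ContinuousLinearMap.isPositive_zero fun j _ => isPositive_rankOne_self (z j)
  exact hsum.smul_of_nonneg (by positivity)

theorem pointCov_apply {m : ℕ} (z : Fin m → H) (g : H) :
    pointCov z g = (1 / (m : ℝ)) • ∑ j, inner ℝ (z j) g • z j := by
  simp [pointCov]

theorem continuous_pointCov {m : ℕ} : Continuous fun z : Fin m → H => pointCov z := by
  have hsum : Continuous fun z : Fin m → H => ∑ j, rankOne ℝ (z j) (z j) := by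
    refine continuous_finsetSum _ fun j _ => ?_
    have hj : Continuous fun z : Fin m → H => z j := continuous_apply j
    exact ((rankOne ℝ).continuous.comp hj).clm_apply hj
  exact hsum.const_smul (1 / (m : ℝ))

theorem continuous_regInv_pointCov [CompleteSpace H] {m : ℕ} {l : ℝ} (hl : 0 < l) :
    Continuous fun z : Fin m → H => regInv (pointCov z) l := by
  refine continuous_iff_continuousAt.2 fun z => ?_
  obtain ⟨u, hu⟩ := isUnit_add_smul_id (isPositive_pointCov z) hl
  have hinv : ContinuousAt Ring.inverse (pointCov z + l • ContinuousLinearMap.id ℝ H) := by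
    rw [← hu]
    exact NormedRing.inverse_continuousAt u
  have hadd : Continuous fun z : Fin m → H => pointCov z + l • ContinuousLinearMap.id ℝ H :=
    continuous_pointCov.add continuous_const
  exact ContinuousAt.comp (f := fun z : Fin m → H => pointCov z + l • ContinuousLinearMap.id ℝ H)
    hinv hadd.continuousAt

end PointCov

variable [CompleteSpace H] [RKHS ℝ H X ℝ]

/-- The empirical covariance operator of inputs `x j`, which is `covariance` with the average over
the inputs in place of the expectation. -/
def empCov (H : Type*) [NormedAddCommGroup H] [InnerProductSpace ℝ H] [RKHS ℝ H X ℝ]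
    [CompleteSpace H] {m : ℕ} (x : Fin m → X) : H →L[ℝ] H :=
  pointCov fun j => featureMap H (x j)

theorem isPositive_empCov {m : ℕ} (x : Fin m → X) : (empCov H x).IsPositive :=
  isPositive_pointCov _

theorem empCov_apply {m : ℕ} (x : Fin m → X) (g : H) :
    empCov H x g = (1 / (m : ℝ)) • ∑ j, g (x j) • featureMap H (x j) := by
  simp only [empCov, pointCov_apply, inner_featureMap]

theorem IsRidge.sum_smul_featureMap {m : ℕ} {l : ℝ} {D : Fin m → X × ℝ} {f : H}
    (hf : IsRidge ⊤ l D f) :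
    ∑ j, (D j).2 • featureMap H (D j).1
      = ∑ j, f (D j).1 • featureMap H (D j).1 + (m * l) • f := by
  refine ext_inner_right ℝ fun g => ?_
  have hnormal := hf.normal_equation (g := g) trivial
  simp only [sub_mul, Finset.sum_sub_distrib] at hnormal
  simp only [inner_add_left, sum_inner, inner_smul_left, inner_featureMap, conj_trivial]
  linarith

theorem isRidge_ridge_top {m : ℕ} (hm : 0 < m) {l : ℝ} (hl : 0 < l) (D : Fin m → X × ℝ) :
    IsRidge ⊤ l D (ridge (⊤ : Submodule ℝ H) l D) :=
  have : CompleteSpace (⊤ : Submodule ℝ H) := isClosed_univ.isComplete.completeSpace_coe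
  isRidge_ridge hm ⊤ hl D

theorem ridge_top_eq {m : ℕ} (hm : 0 < m) {l : ℝ} (hl : 0 < l) (D : Fin m → X × ℝ) :
    ridge (⊤ : Submodule ℝ H) l D = regInv (empCov H fun j => (D j).1) l
      ((1 / (m : ℝ)) • ∑ j, (D j).2 • featureMap H (D j).1) := by
  have hscale : 1 / (m : ℝ) * (m * l) = l := by field_simp
  rw [(isRidge_ridge_top hm hl D).sum_smul_featureMap, smul_add, smul_smul, hscale, ← empCov_apply,
    regInv_apply_add (isPositive_empCov _) hl]

theorem norm_ridge_top_sq_le {m : ℕ} (hm : 0 < m) {l : ℝ} (hl : 0 < l) {D : Fin m → X × ℝ} {B : ℝ}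
    (hB : ∀ j, |(D j).2| ≤ B) : ‖ridge (⊤ : Submodule ℝ H) l D‖ ^ 2 ≤ B ^ 2 / l :=
  (isRidge_ridge_top hm hl D).norm_sq_le hm hl hB

section Measurability

variable [MeasurableSpace X] [TopologicalSpace.SeparableSpace H] {κ : ℝ}

theorem stronglyMeasurable_regInv_empCov (hK : KernelAssumptions H κ) {m : ℕ} {l : ℝ}
    (hl : 0 < l) : StronglyMeasurable fun x : Fin m → X => regInv (empCov H x) l := by
  have : SecondCountableTopology H := UniformSpace.secondCountable_of_separable H
  borelize H
  have hφ : Measurable fun x : X => featureMap H x := (stronglyMeasurable_featureMap hK).measurable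
  have hpi : Measurable fun (x : Fin m → X) (j : Fin m) => featureMap H (x j) :=
    measurable_pi_lambda _ fun j => hφ.comp (measurable_pi_apply j)
  exact (continuous_regInv_pointCov hl).comp_stronglyMeasurable hpi.stronglyMeasurable

theorem measurable_inputs {m : ℕ} :
    Measurable fun (D : Fin m → X × ℝ) (j : Fin m) => (D j).1 :=
  measurable_pi_lambda _ fun j => measurable_fst.comp (measurable_pi_apply j)

theorem stronglyMeasurable_ridge (hK : KernelAssumptions H κ) {m : ℕ} (hm : 0 < m) {l : ℝ}
    (hl : 0 < l) :
    StronglyMeasurable fun D : Fin m → X × ℝ => ridge (⊤ : Submodule ℝ H) l D := by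
  have hvec : StronglyMeasurable fun D : Fin m → X × ℝ =>
      (1 / (m : ℝ)) • ∑ j, (D j).2 • featureMap H (D j).1 := by
    refine StronglyMeasurable.const_smul (Finset.stronglyMeasurable_fun_sum _ fun j _ => ?_) _
    exact (measurable_snd.comp (measurable_pi_apply j)).stronglyMeasurable.smul
      ((stronglyMeasurable_featureMap hK).comp_measurable
        (measurable_fst.comp (measurable_pi_apply j)))
  simp only [ridge_top_eq hm hl]
  exact stronglyMeasurable_clm_apply
    ((stronglyMeasurable_regInv_empCov hK hl).comp_measurable measurable_inputs) hvec

end Measurability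

end Ridge

/-! ### Second moments of averages of independent vectors -/

section SecondMoment

theorem lintegral_sum_sub_integral_sq_le {ι : Type*} [Fintype ι] {Ω : ι → Type*}
    {mΩ : ∀ i, MeasurableSpace (Ω i)} (ν : ∀ i, Measure (Ω i)) [∀ i, IsProbabilityMeasure (ν i)]
    {ξ : ∀ i, Ω i → ℝ} (hξ : ∀ i, MemLp (ξ i) 2 (ν i)) :
    ∫⁻ ω, ‖∑ i, (ξ i (ω i) - ∫ a, ξ i a ∂ν i)‖ₑ ^ 2 ∂Measure.pi ν
      ≤ ∑ i, ∫⁻ a, ‖ξ i a‖ₑ ^ 2 ∂ν i := by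
  have hmem : ∀ i, MemLp (fun ω : ∀ i, Ω i => ξ i (ω i)) 2 (Measure.pi ν) := fun i =>
    (hξ i).comp_measurePreserving (measurePreserving_eval ν i)
  have hmean : ∫ ω, (∑ i, fun ω : ∀ i, Ω i => ξ i (ω i)) ω ∂Measure.pi ν
      = ∑ i, ∫ a, ξ i a ∂ν i := by
    simp only [Finset.sum_apply]
    rw [integral_finsetSum _ fun i _ => (hmem i).integrable one_le_two]
    exact Finset.sum_congr rfl fun i _ => integral_comp_eval (hξ i).1
  have hvar : ∫⁻ ω, ‖∑ i, (ξ i (ω i) - ∫ a, ξ i a ∂ν i)‖ₑ ^ 2 ∂Measure.pi ν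
      = evariance (∑ i, fun ω : ∀ i, Ω i => ξ i (ω i)) (Measure.pi ν) := by
    rw [evariance, hmean]
    simp [Finset.sum_sub_distrib]
  rw [hvar, ← ofReal_variance (memLp_finsetSum' _ fun i _ => hmem i), variance_sum_pi hξ,
    ENNReal.ofReal_sum_of_nonneg fun i _ => variance_nonneg _ _]
  refine Finset.sum_le_sum fun i _ => ?_
  calc ENNReal.ofReal Var[ξ i; ν i] ≤ ENNReal.ofReal (∫ a, ξ i a ^ 2 ∂ν i) :=
        ENNReal.ofReal_le_ofReal (variance_le_expectation_sq (hξ i).1)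
    _ = ∫⁻ a, ‖ξ i a‖ₑ ^ 2 ∂ν i := by
        rw [ofReal_integral_eq_lintegral_ofReal (hξ i).integrable_sq
          (Filter.Eventually.of_forall fun a => sq_nonneg _)]
        refine lintegral_congr fun a => ?_
        rw [← sq_abs, ENNReal.ofReal_pow (abs_nonneg _), ← Real.norm_eq_abs, ofReal_norm]

section Hilbert

variable {H : Type*} [NormedAddCommGroup H] [InnerProductSpace ℝ H]

theorem lintegral_enorm_sq_eq_tsum {Ω ι : Type*} [MeasurableSpace Ω] [Countable ι]
    (b : HilbertBasis ι ℝ H) {ν : Measure Ω} {u : Ω → H} (hu : AEStronglyMeasurable u ν) :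
    ∫⁻ ω, ‖u ω‖ₑ ^ 2 ∂ν = ∑' e, ∫⁻ ω, ‖inner ℝ (b e) (u ω)‖ₑ ^ 2 ∂ν := by
  rw [← lintegral_tsum fun e => (hu.const_inner (c := b e)).enorm.pow_const 2]
  exact lintegral_congr fun ω => enorm_sq_eq_tsum b _

variable [CompleteSpace H] [TopologicalSpace.SeparableSpace H]

theorem lintegral_enorm_sum_sub_integral_sq_le {ι : Type*} [Fintype ι] {Ω : ι → Type*}
    {mΩ : ∀ i, MeasurableSpace (Ω i)} (ν : ∀ i, Measure (Ω i)) [∀ i, IsProbabilityMeasure (ν i)]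
    {ξ : ∀ i, Ω i → H} (hξ : ∀ i, MemLp (ξ i) 2 (ν i)) :
    ∫⁻ ω, ‖∑ i, (ξ i (ω i) - ∫ a, ξ i a ∂ν i)‖ₑ ^ 2 ∂Measure.pi ν
      ≤ ∑ i, ∫⁻ a, ‖ξ i a‖ₑ ^ 2 ∂ν i := by
  obtain ⟨w, b, -⟩ := exists_hilbertBasis ℝ H
  have : Countable w := countable_of_hilbertBasis b
  have hcoord : ∀ (e : w) (ω : ∀ i, Ω i), inner ℝ (b e) (∑ i, (ξ i (ω i) - ∫ a, ξ i a ∂ν i))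
      = ∑ i, (inner ℝ (b e) (ξ i (ω i)) - ∫ a, inner ℝ (b e) (ξ i a) ∂ν i) := by
    intro e ω
    rw [inner_sum]
    refine Finset.sum_congr rfl fun i _ => ?_
    rw [inner_sub_right, integral_inner ((hξ i).integrable one_le_two)]
  have hmeas : AEStronglyMeasurable (fun ω : ∀ i, Ω i => ∑ i, (ξ i (ω i) - ∫ a, ξ i a ∂ν i))
      (Measure.pi ν) :=
    Finset.aestronglyMeasurable_fun_sum _ fun i _ =>
      ((hξ i).1.comp_measurePreserving (measurePreserving_eval ν i)).sub
        aestronglyMeasurable_const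
  calc ∫⁻ ω, ‖∑ i, (ξ i (ω i) - ∫ a, ξ i a ∂ν i)‖ₑ ^ 2 ∂Measure.pi ν
      = ∑' e, ∫⁻ ω, ‖∑ i, (inner ℝ (b e) (ξ i (ω i)) - ∫ a, inner ℝ (b e) (ξ i a) ∂ν i)‖ₑ ^ 2
          ∂Measure.pi ν := by
        simp only [lintegral_enorm_sq_eq_tsum b hmeas, hcoord]
    _ ≤ ∑' e, ∑ i, ∫⁻ a, ‖inner ℝ (b e) (ξ i a)‖ₑ ^ 2 ∂ν i :=
        ENNReal.tsum_le_tsum fun e =>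
          lintegral_sum_sub_integral_sq_le ν fun i => (hξ i).const_inner (b e)
    _ = ∑ i, ∫⁻ a, ‖ξ i a‖ₑ ^ 2 ∂ν i := by
        rw [Summable.tsum_finsetSum fun i _ => ENNReal.summable]
        exact Finset.sum_congr rfl fun i _ => (lintegral_enorm_sq_eq_tsum b (hξ i).1).symm

theorem lintegral_enorm_average_sub_integral_sq_le {N : ℕ} {Ω : Fin N → Type*}
    {mΩ : ∀ i, MeasurableSpace (Ω i)} (ν : ∀ i, Measure (Ω i)) [∀ i, IsProbabilityMeasure (ν i)]
    {ξ : ∀ i, Ω i → H} (hξ : ∀ i, MemLp (ξ i) 2 (ν i)) :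
    ∫⁻ ω, ‖(1 / (N : ℝ)) • ∑ i, (ξ i (ω i) - ∫ a, ξ i a ∂ν i)‖ₑ ^ 2 ∂Measure.pi ν
      ≤ ENNReal.ofReal (1 / N) ^ 2 * ∑ i, ∫⁻ a, ‖ξ i a‖ₑ ^ 2 ∂ν i := by
  simp only [enorm_smul, mul_pow]
  rw [Real.enorm_eq_ofReal (by positivity), lintegral_const_mul' _ _ (by simp)]
  gcongr
  exact lintegral_enorm_sum_sub_integral_sq_le ν hξ

end Hilbert

theorem ofReal_one_div_sq_mul_sum_le {N : ℕ} {t : Fin N → ℝ≥0∞} {c : ℝ}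
    (ht : ∀ i, t i ≤ ENNReal.ofReal c) :
    ENNReal.ofReal (1 / N) ^ 2 * ∑ i, t i ≤ ENNReal.ofReal (c / N) := by
  calc ENNReal.ofReal (1 / N) ^ 2 * ∑ i, t i
      ≤ ENNReal.ofReal (1 / N) ^ 2 * (N * ENNReal.ofReal c) := by
        gcongr
        exact (Finset.sum_le_card_nsmul _ _ _ fun i _ => ht i).trans (by simp)
    _ = ENNReal.ofReal (c / N) := by
        rw [← ENNReal.ofReal_natCast, ← ENNReal.ofReal_pow (by positivity),
          ← ENNReal.ofReal_mul (by positivity), ← ENNReal.ofReal_mul (by positivity)]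
        congr 1
        field_simp

theorem enorm_integral_le_of_lintegral_sq_le {Ω E : Type*} [MeasurableSpace Ω]
    [NormedAddCommGroup E] [NormedSpace ℝ E] {ν : Measure Ω} [IsProbabilityMeasure ν] {u : Ω → E}
    (hu : AEStronglyMeasurable u ν) {c : ℝ≥0∞} (h : ∫⁻ ω, ‖u ω‖ₑ ^ 2 ∂ν ≤ c ^ 2) :
    ‖∫ ω, u ω ∂ν‖ₑ ≤ c := by
  have hL1L2 := eLpNorm_le_eLpNorm_of_exponent_le (μ := ν) (p := 1) (q := 2) one_le_two hu
  rw [eLpNorm_one_eq_lintegral_enorm,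
    eLpNorm_eq_lintegral_rpow_enorm_toReal two_ne_zero ENNReal.ofNat_ne_top] at hL1L2
  simp only [ENNReal.toReal_ofNat, ENNReal.rpow_ofNat] at hL1L2
  calc ‖∫ ω, u ω ∂ν‖ₑ ≤ (∫⁻ ω, ‖u ω‖ₑ ^ 2 ∂ν) ^ (1 / 2 : ℝ) :=
        (enorm_integral_le_lintegral_enorm u).trans hL1L2
    _ ≤ (c ^ 2) ^ (1 / 2 : ℝ) := by gcongr
    _ = c := by rw [← ENNReal.rpow_natCast, ← ENNReal.rpow_mul]; norm_num

end SecondMoment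

/-! ### Bias of the ridge estimators -/

section Residual

theorem integral_pi_insertNth {Ω E : Type*} [MeasurableSpace Ω] [NormedAddCommGroup E]
    [NormedSpace ℝ E] (μ : Measure Ω) [SigmaFinite μ] {k : ℕ} (j : Fin (k + 1))
    {F : (Fin (k + 1) → Ω) → E} (hF : Integrable F (Measure.pi fun _ => μ)) :
    ∫ D, F D ∂(Measure.pi fun _ => μ)
      = ∫ D', ∫ p, F (j.insertNth p D') ∂μ ∂(Measure.pi fun _ => μ) := by
  have hmp := (measurePreserving_piFinSuccAbove (fun _ : Fin (k + 1) => μ) j).symm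
  rw [← hmp.integrable_comp_emb (MeasurableEquiv.measurableEmbedding _)] at hF
  rw [← hmp.integral_comp']
  exact integral_prod_symm _ hF

variable {X H E : Type*} [MeasurableSpace X] [NormedAddCommGroup H] [InnerProductSpace ℝ H]
  [RKHS ℝ H X ℝ] [NormedAddCommGroup E] [NormedSpace ℝ E] {μ : Measure (X × ℝ)} {f : H}

theorem IsRegressionFunction.integrable_coe (hf : IsRegressionFunction μ f) :
    Integrable (fun p : X × ℝ => f p.1) μ :=
  integrable_condExp.congr hf.2

variable [IsProbabilityMeasure μ]

theorem IsRegressionFunction.integrable_pi_residual_smul (hf : IsRegressionFunction μ f) {m : ℕ}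
    {ψ : (Fin m → X) → E} (hψ : StronglyMeasurable ψ) {c : ℝ} (hc : ∀ x, ‖ψ x‖ ≤ c) (j : Fin m) :
    Integrable (fun D : Fin m → X × ℝ => ((D j).2 - f (D j).1) • ψ fun k => (D k).1)
      (Measure.pi fun _ => μ) := by
  have hres : Integrable (fun D : Fin m → X × ℝ => (D j).2 - f (D j).1)
      (Measure.pi fun _ => μ) :=
    (measurePreserving_eval (fun _ : Fin m => μ) j).integrable_comp_of_integrable
      (hf.1.sub hf.integrable_coe)
  exact hres.smul_bdd c (hψ.comp_measurable measurable_inputs).aestronglyMeasurable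
    (Filter.Eventually.of_forall fun D => hc _)

variable [CompleteSpace E]

theorem IsRegressionFunction.integral_residual_smul (hf : IsRegressionFunction μ f) {h : X → E}
    (hh : StronglyMeasurable h) {c : ℝ} (hc : ∀ x, ‖h x‖ ≤ c) :
    ∫ p, (p.2 - f p.1) • h p.1 ∂μ = 0 := by
  have hbdd : ∀ᵐ p : X × ℝ ∂μ, ‖h p.1‖ ≤ c := Filter.Eventually.of_forall fun p => hc p.1
  have hmeas : AEStronglyMeasurable (fun p : X × ℝ => h p.1) μ :=
    (hh.comp_measurable measurable_fst).aestronglyMeasurable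
  have hlabel : Integrable (fun p : X × ℝ => p.2 • h p.1) μ := hf.1.smul_bdd c hmeas hbdd
  have hvalue : Integrable (fun p : X × ℝ => f p.1 • h p.1) μ :=
    hf.integrable_coe.smul_bdd c hmeas hbdd
  have hpull : μ[(Prod.snd : X × ℝ → ℝ) • (fun p : X × ℝ => h p.1) |
      MeasurableSpace.comap Prod.fst inferInstance]
      =ᵐ[μ] μ[(Prod.snd : X × ℝ → ℝ) | MeasurableSpace.comap Prod.fst inferInstance]
        • fun p : X × ℝ => h p.1 :=
    condExp_smul_of_aestronglyMeasurable_right hf.1 hlabel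
      (hh.comp_measurable (comap_measurable Prod.fst)).aestronglyMeasurable
  have hequal : ∫ p, p.2 • h p.1 ∂μ = ∫ p, f p.1 • h p.1 ∂μ := by
    calc ∫ p, p.2 • h p.1 ∂μ
        = ∫ p, (μ[(Prod.snd : X × ℝ → ℝ) • (fun p : X × ℝ => h p.1) |
            MeasurableSpace.comap Prod.fst inferInstance]) p ∂μ :=
          (integral_condExp measurable_fst.comap_le).symm
      _ = ∫ p, f p.1 • h p.1 ∂μ := by
          refine integral_congr_ae ?_
          filter_upwards [hpull, hf.2] with p hpull_p hf_p
          rw [hpull_p, Pi.smul_apply', hf_p]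
  simp_rw [sub_smul]
  rw [integral_sub hlabel hvalue, hequal, sub_self]

theorem IsRegressionFunction.integral_pi_residual_smul (hf : IsRegressionFunction μ f) {m : ℕ}
    {ψ : (Fin m → X) → E} (hψ : StronglyMeasurable ψ) {c : ℝ} (hc : ∀ x, ‖ψ x‖ ≤ c) (j : Fin m) :
    ∫ D : Fin m → X × ℝ, ((D j).2 - f (D j).1) • ψ (fun k => (D k).1)
      ∂(Measure.pi fun _ => μ) = 0 := by
  obtain ⟨k, rfl⟩ : ∃ k, m = k + 1 := Nat.exists_eq_add_one.2 j.pos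
  rw [integral_pi_insertNth μ j (hf.integrable_pi_residual_smul hψ hc j)]
  refine integral_eq_zero_of_ae (Filter.Eventually.of_forall fun D' => ?_)
  have hinputs : ∀ p : X × ℝ, (fun i => (j.insertNth (α := fun _ => X × ℝ) p D' i).1)
      = j.insertNth p.1 fun i => (D' i).1 := fun p =>
    funext fun i => by refine Fin.succAboveCases j ?_ (fun i => ?_) i <;> simp
  simp only [hinputs, Fin.insertNth_apply_same, Pi.zero_apply]
  refine hf.integral_residual_smul (h := fun x => ψ (j.insertNth x fun i => (D' i).1)) ?_
    (fun x => hc _)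
  refine hψ.comp_measurable (measurable_pi_lambda _ fun i => ?_)
  refine Fin.succAboveCases j ?_ (fun i => ?_) i
  · simpa using measurable_id'
  · simp

end Residual

section Covariance

variable {X H : Type*} [MeasurableSpace X] [NormedAddCommGroup H] [InnerProductSpace ℝ H]
  [CompleteSpace H] [RKHS ℝ H X ℝ] {κ : ℝ} {μ : Measure (X × ℝ)} [IsProbabilityMeasure μ]

theorem norm_rankOne_featureMap_le (hκ : 0 ≤ κ) (hK : KernelAssumptions H κ) (x : X) :
    ‖rankOne ℝ (featureMap H x) (featureMap H x)‖ ≤ κ ^ 2 := by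
  rw [norm_rankOne, sq]
  gcongr <;> exact norm_featureMap_le hκ hK x

theorem norm_smul_featureMap_le (hκ : 0 ≤ κ) (hK : KernelAssumptions H κ) (g : H) (x : X) :
    ‖g x • featureMap H x‖ ≤ κ ^ 2 * ‖g‖ := by
  rw [← inner_featureMap, ← rankOne_apply]
  exact (ContinuousLinearMap.le_opNorm _ _).trans
    (by gcongr; exact norm_rankOne_featureMap_le hκ hK x)

theorem norm_covariance_le (hκ : 0 ≤ κ) (hK : KernelAssumptions H κ) :
    ‖covariance H μ‖ ≤ κ ^ 2 := by
  have h := norm_integral_le_of_norm_le_const (μ := μ) (C := κ ^ 2)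
    (f := fun p : X × ℝ => rankOne ℝ (featureMap H p.1) (featureMap H p.1))
    (Filter.Eventually.of_forall fun p => norm_rankOne_featureMap_le hκ hK p.1)
  simpa [covariance] using h

variable [TopologicalSpace.SeparableSpace H]

theorem integrable_rankOne_featureMap (hκ : 0 ≤ κ) (hK : KernelAssumptions H κ) :
    Integrable (fun p : X × ℝ => rankOne ℝ (featureMap H p.1) (featureMap H p.1)) μ := by
  have hφ : StronglyMeasurable fun p : X × ℝ => featureMap H p.1 :=
    (stronglyMeasurable_featureMap hK).comp_measurable measurable_fst
  have hcont : Continuous fun z : H => rankOne ℝ z z :=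
    (rankOne ℝ).continuous.clm_apply continuous_id
  exact Integrable.of_bound (hcont.comp_stronglyMeasurable hφ).aestronglyMeasurable (κ ^ 2)
    (Filter.Eventually.of_forall fun p => norm_rankOne_featureMap_le hκ hK p.1)

theorem covariance_apply (hκ : 0 ≤ κ) (hK : KernelAssumptions H κ) (g : H) :
    covariance H μ g = ∫ p, g p.1 • featureMap H p.1 ∂μ := by
  rw [covariance, ContinuousLinearMap.integral_apply (integrable_rankOne_featureMap hκ hK)]
  simp only [rankOne_apply, inner_featureMap]

theorem integrable_smul_featureMap (hκ : 0 ≤ κ) (hK : KernelAssumptions H κ) (g : H) :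
    Integrable (fun p : X × ℝ => g p.1 • featureMap H p.1) μ := by
  have h := (integrable_rankOne_featureMap (μ := μ) hκ hK).apply_continuousLinearMap g
  simpa only [rankOne_apply, inner_featureMap] using h

theorem inner_covariance (hκ : 0 ≤ κ) (hK : KernelAssumptions H κ) (g h : H) :
    inner ℝ (covariance H μ g) h = ∫ p, g p.1 * h p.1 ∂μ := by
  rw [covariance_apply hκ hK, real_inner_comm,
    ← integral_inner (integrable_smul_featureMap hκ hK g)]
  refine integral_congr_ae (Filter.Eventually.of_forall fun p => ?_)
  simp only [inner_smul_right]
  rw [real_inner_comm, inner_featureMap]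

theorem isPositive_covariance (hκ : 0 ≤ κ) (hK : KernelAssumptions H κ) :
    (covariance H μ).IsPositive := by
  refine ⟨fun g h => ?_, fun g => ?_⟩
  · change inner ℝ (covariance H μ g) h = inner ℝ g (covariance H μ h)
    rw [inner_covariance hκ hK, real_inner_comm, inner_covariance hκ hK]
    simp_rw [mul_comm]
  · change 0 ≤ inner ℝ (covariance H μ g) g
    rw [inner_covariance hκ hK]
    exact integral_nonneg fun p => mul_self_nonneg _

theorem SourceCondition.norm_le (hκ : 0 ≤ κ) (hK : KernelAssumptions H κ) {r R : ℝ} (hr0 : 0 ≤ r)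
    (hr1 : r ≤ 1) {f : H} (hf : SourceCondition μ r R f) : ‖f‖ ≤ max 1 (κ ^ 2) * R := by
  obtain ⟨h, hh, rfl⟩ := hf
  refine (norm_opPow_le (isPositive_covariance hκ hK) hr0 hr1 h).trans ?_
  gcongr
  exact norm_covariance_le hκ hK

theorem lintegral_empCov_sub_covariance_sq_le (hκ : 0 ≤ κ) (hK : KernelAssumptions H κ) {n : ℕ}
    (hn : 0 < n) (g : H) :
    ∫⁻ D, ‖empCov H (fun j => (D j).1) g - covariance H μ g‖ₑ ^ 2
      ∂(Measure.pi fun _ : Fin n => μ) ≤ ENNReal.ofReal (κ ^ 2 * ‖g‖ / √n) ^ 2 := by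
  have hn' : (n : ℝ) ≠ 0 := by positivity
  have hbound := norm_smul_featureMap_le hκ hK g
  have hmem : MemLp (fun p : X × ℝ => g p.1 • featureMap H p.1) 2 μ :=
    MemLp.of_bound (integrable_smul_featureMap hκ hK g).1 _
      (Filter.Eventually.of_forall fun p => hbound p.1)
  have hcentered : ∀ D : Fin n → X × ℝ, empCov H (fun j => (D j).1) g - covariance H μ g
      = (1 / (n : ℝ)) • ∑ i, (g (D i).1 • featureMap H (D i).1
        - ∫ p, g p.1 • featureMap H p.1 ∂μ) := by
    intro D
    rw [empCov_apply, covariance_apply hκ hK, Finset.sum_sub_distrib, smul_sub, Finset.sum_const,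
      Finset.card_univ, Fintype.card_fin, ← Nat.cast_smul_eq_nsmul ℝ, smul_smul,
      one_div_mul_cancel hn', one_smul]
  have hmoment : ∫⁻ p : X × ℝ, ‖g p.1 • featureMap H p.1‖ₑ ^ 2 ∂μ
      ≤ ENNReal.ofReal ((κ ^ 2 * ‖g‖) ^ 2) := by
    calc ∫⁻ p : X × ℝ, ‖g p.1 • featureMap H p.1‖ₑ ^ 2 ∂μ
        ≤ ∫⁻ _, ENNReal.ofReal ((κ ^ 2 * ‖g‖) ^ 2) ∂μ := by
          refine lintegral_mono fun p => ?_
          rw [← ofReal_norm, ENNReal.ofReal_pow (by positivity)]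
          gcongr
          exact hbound p.1
      _ = _ := by simp
  simp only [hcentered]
  refine (lintegral_enorm_average_sub_integral_sq_le (fun _ : Fin n => μ) fun _ => hmem).trans
    ((ofReal_one_div_sq_mul_sum_le fun _ => hmoment).trans_eq ?_)
  rw [← ENNReal.ofReal_pow (by positivity), div_pow _ (√(n : ℝ)), Real.sq_sqrt n.cast_nonneg]

end Covariance

section MeanRidge

variable {X H : Type*} [NormedAddCommGroup H] [InnerProductSpace ℝ H] [CompleteSpace H]
  [RKHS ℝ H X ℝ] {κ l : ℝ} {n : ℕ}

theorem regInv_empCov_empCov_apply (hn : 0 < n) (hl : 0 < l) (f : H) (D : Fin n → X × ℝ) :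
    regInv (empCov H fun j => (D j).1) l (empCov H (fun j => (D j).1) f)
      = ridge (⊤ : Submodule ℝ H) l D - (1 / (n : ℝ)) • ∑ j, ((D j).2 - f (D j).1) •
        regInv (empCov H fun k => (D k).1) l (featureMap H (D j).1) := by
  rw [ridge_top_eq hn hl, empCov_apply]
  simp only [map_smul, map_sum, ← smul_sub, ← Finset.sum_sub_distrib, ← sub_smul, sub_sub_cancel]

theorem sub_smul_regInv_sub_regInv_apply {S T : H →L[ℝ] H} (hS : S.IsPositive)
    (hT : T.IsPositive) (hl : 0 < l) (f : H) :
    f - l • regInv S l f - regInv T l (T f)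
      = l • regInv T l (S (regInv S l f) - T (regInv S l f)) := by
  have hf : f = S (regInv S l f) + l • regInv S l f := (apply_regInv_add hS hl f).symm
  have hdiff : S (regInv S l f) - T (regInv S l f)
      = f - (T (regInv S l f) + l • regInv S l f) := by
    rw [eq_sub_of_add_eq hf.symm]
    abel
  rw [hdiff, map_sub, regInv_apply_add hT hl, regInv_apply_apply hT hl, smul_sub]
  abel

variable [MeasurableSpace X]

theorem norm_regInv_empCov_featureMap_le (hκ : 0 ≤ κ) (hK : KernelAssumptions H κ) (hl : 0 < l)
    (x : Fin n → X) (j : Fin n) :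
    ‖regInv (empCov H x) l (featureMap H (x j))‖ ≤ l⁻¹ * κ := by
  refine (norm_regInv_apply_le (isPositive_empCov _) hl _).trans ?_
  gcongr
  exact norm_featureMap_le hκ hK _

variable [TopologicalSpace.SeparableSpace H]

theorem stronglyMeasurable_regInv_empCov_featureMap (hK : KernelAssumptions H κ) (hl : 0 < l)
    (j : Fin n) :
    StronglyMeasurable fun x : Fin n → X => regInv (empCov H x) l (featureMap H (x j)) :=
  stronglyMeasurable_clm_apply (stronglyMeasurable_regInv_empCov hK hl)
    ((stronglyMeasurable_featureMap hK).comp_measurable (measurable_pi_apply j))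

section SingleTask

variable {μ : Measure (X × ℝ)} [IsProbabilityMeasure μ] {f : H}

theorem integrable_ridge (hκ : 0 ≤ κ) (hK : KernelAssumptions H κ) (hn : 0 < n) (hl : 0 < l)
    (hμ : Integrable Prod.snd μ) :
    Integrable (fun D => ridge (⊤ : Submodule ℝ H) l D) (Measure.pi fun _ : Fin n => μ) := by
  have hlabels : Integrable (fun D : Fin n → X × ℝ => ∑ j, |(D j).2|)
      (Measure.pi fun _ : Fin n => μ) :=
    integrable_finsetSum _ fun j _ =>
      (measurePreserving_eval (fun _ : Fin n => μ) j).integrable_comp_of_integrable hμ.abs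
  refine (hlabels.const_mul (l⁻¹ * (1 / (n : ℝ) * κ))).mono'
    (stronglyMeasurable_ridge hK hn hl).aestronglyMeasurable
    (Filter.Eventually.of_forall fun D => ?_)
  rw [ridge_top_eq hn hl]
  refine (norm_regInv_apply_le (isPositive_empCov _) hl _).trans ?_
  rw [norm_smul, Real.norm_of_nonneg (by positivity), mul_assoc, mul_assoc, Finset.mul_sum]
  gcongr
  refine (norm_sum_le _ _).trans (Finset.sum_le_sum fun j _ => ?_)
  rw [norm_smul, mul_comm, Real.norm_eq_abs]
  gcongr
  exact norm_featureMap_le hκ hK _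

theorem IsRegressionFunction.integrable_average_residual_smul (hf : IsRegressionFunction μ f)
    (hκ : 0 ≤ κ) (hK : KernelAssumptions H κ) (hl : 0 < l) :
    Integrable (fun D : Fin n → X × ℝ => (1 / (n : ℝ)) • ∑ j, ((D j).2 - f (D j).1) •
      regInv (empCov H fun k => (D k).1) l (featureMap H (D j).1))
      (Measure.pi fun _ : Fin n => μ) :=
  (integrable_finsetSum _ fun j _ => hf.integrable_pi_residual_smul
    (stronglyMeasurable_regInv_empCov_featureMap hK hl j)
    (norm_regInv_empCov_featureMap_le hκ hK hl · j) j).smul _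

theorem IsRegressionFunction.integrable_regInv_empCov (hf : IsRegressionFunction μ f)
    (hκ : 0 ≤ κ) (hK : KernelAssumptions H κ) (hn : 0 < n) (hl : 0 < l) :
    Integrable (fun D : Fin n → X × ℝ => regInv (empCov H fun j => (D j).1) l
      (empCov H (fun j => (D j).1) f)) (Measure.pi fun _ : Fin n => μ) := by
  simp only [regInv_empCov_empCov_apply hn hl]
  exact (integrable_ridge hκ hK hn hl hf.1).sub (hf.integrable_average_residual_smul hκ hK hl)

theorem IsRegressionFunction.meanRidge_eq (hf : IsRegressionFunction μ f) (hκ : 0 ≤ κ)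
    (hK : KernelAssumptions H κ) (hn : 0 < n) (hl : 0 < l) :
    meanRidge H n l μ = ∫ D, regInv (empCov H fun j => (D j).1) l
      (empCov H (fun j => (D j).1) f) ∂(Measure.pi fun _ : Fin n => μ) := by
  have hmeas := stronglyMeasurable_regInv_empCov_featureMap (n := n) hK hl
  have hbound := fun j : Fin n => (norm_regInv_empCov_featureMap_le hκ hK hl · j)
  simp only [regInv_empCov_empCov_apply hn hl]
  rw [integral_sub (integrable_ridge hκ hK hn hl hf.1)
      (hf.integrable_average_residual_smul hκ hK hl), integral_smul,
    integral_finsetSum _ fun j _ => hf.integrable_pi_residual_smul (hmeas j) (hbound j) j,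
    Finset.sum_eq_zero fun j _ => hf.integral_pi_residual_smul (hmeas j) (hbound j) j,
    smul_zero, sub_zero, meanRidge]

theorem norm_meanRidge_le (hκ : 0 ≤ κ) (hK : KernelAssumptions H κ) (hn : 0 < n) (hl : 0 < l)
    (hf : IsRegressionFunction μ f) : ‖meanRidge H n l μ‖ ≤ ‖f‖ := by
  rw [hf.meanRidge_eq hκ hK hn hl]
  refine (norm_integral_le_of_norm_le_const (Filter.Eventually.of_forall fun D =>
    norm_regInv_apply_apply_le (isPositive_empCov _) hl f)).trans ?_
  simp

theorem norm_sub_smul_regInv_sub_meanRidge_le (hκ : 0 ≤ κ) (hK : KernelAssumptions H κ)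
    (hn : 0 < n) (hl : 0 < l) (hf : IsRegressionFunction μ f) :
    ‖f - l • regInv (covariance H μ) l f - meanRidge H n l μ‖
      ≤ κ ^ 2 * ‖regInv (covariance H μ) l f‖ / √n := by
  have hint := hf.integrable_regInv_empCov hκ hK hn hl
  have hle : ‖∫ D, (f - l • regInv (covariance H μ) l f
      - regInv (empCov H fun j => (D j).1) l (empCov H (fun j => (D j).1) f))
        ∂(Measure.pi fun _ : Fin n => μ)‖ₑ
      ≤ ENNReal.ofReal (κ ^ 2 * ‖regInv (covariance H μ) l f‖ / √n) := by
    refine enorm_integral_le_of_lintegral_sq_le ((integrable_const _).sub hint).1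
      (le_trans (lintegral_mono fun D => ?_)
        (lintegral_empCov_sub_covariance_sq_le hκ hK hn (regInv (covariance H μ) l f)))
    rw [Pi.sub_apply, sub_smul_regInv_sub_regInv_apply (isPositive_covariance hκ hK)
      (isPositive_empCov _) hl]
    gcongr
    rw [enorm_le_iff_norm_le, norm_smul, Real.norm_of_nonneg hl.le, ← le_inv_mul_iff₀ hl,
      norm_sub_rev (empCov H _ _)]
    exact norm_regInv_apply_le (isPositive_empCov _) hl _
  rw [integral_sub (integrable_const _) hint, ← hf.meanRidge_eq hκ hK hn hl, integral_const,
    probReal_univ, one_smul, ← ofReal_norm] at hle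
  exact (ENNReal.ofReal_le_ofReal_iff (by positivity)).1 hle

theorem norm_meanRidge_sub_le (hκ : 0 ≤ κ) (hK : KernelAssumptions H κ) (hn : 0 < n)
    {r R : ℝ} (hl : 0 < l) (hr0 : 0 ≤ r) (hr1 : r ≤ 1) (hf : IsRegressionFunction μ f)
    (hs : SourceCondition μ r R f) :
    ‖meanRidge H n l μ - f‖ ≤ R * l ^ r * (1 + κ ^ 2 / (l * √n)) := by
  set g := regInv (covariance H μ) l f with hg
  have hg_le : ‖g‖ ≤ l ^ (r - 1) * R := by
    obtain ⟨h, hh, rfl⟩ := hs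
    refine (norm_regInv_opPow_le (isPositive_covariance hκ hK) hr0 hr1 hl h).trans ?_
    gcongr
  have hpow : l * l ^ (r - 1) = l ^ r := by
    rw [mul_comm, ← Real.rpow_add_one hl.ne', sub_add_cancel]
  calc ‖meanRidge H n l μ - f‖ = ‖(f - l • g - meanRidge H n l μ) + l • g‖ := by
        rw [← norm_neg]
        congr 1
        abel
    _ ≤ κ ^ 2 * ‖g‖ / √n + l * ‖g‖ := by
        refine (norm_add_le _ _).trans ?_
        rw [norm_smul, Real.norm_of_nonneg hl.le]
        gcongr
        exact norm_sub_smul_regInv_sub_meanRidge_le hκ hK hn hl hf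
    _ ≤ κ ^ 2 * (l ^ (r - 1) * R) / √n + l * (l ^ (r - 1) * R) := by gcongr
    _ = R * l ^ r * (1 + κ ^ 2 / (l * √n)) := by
        rw [← hpow]
        field_simp
        ring

theorem hsNorm_rankOne_meanRidge_sub_le (hκ : 0 ≤ κ) (hK : KernelAssumptions H κ) (hn : 0 < n)
    {r R : ℝ} (hl : 0 < l) (hr0 : 0 ≤ r) (hr1 : r ≤ 1) (hf : IsRegressionFunction μ f)
    (hs : SourceCondition μ r R f) :
    hsNorm (rankOne ℝ (meanRidge H n l μ) (meanRidge H n l μ) - rankOne ℝ f f)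
      ≤ ENNReal.ofReal (2 * R ^ 2 * max 1 (κ ^ 2) ^ 2 * l ^ r * (1 + 1 / (l * √n))) := by
  refine (hsNorm_rankOne_sub_le _ _).trans (ENNReal.ofReal_le_ofReal ?_)
  have hR : 0 ≤ R := by
    obtain ⟨h, hh, -⟩ := hs
    exact (norm_nonneg h).trans hh
  have hf_le := hs.norm_le hκ hK hr0 hr1
  set M := max 1 (κ ^ 2)
  have hM : 1 + κ ^ 2 / (l * √n) ≤ M * (1 + 1 / (l * √n)) := by
    rw [mul_add, mul_one, mul_one_div]
    gcongr
    exacts [le_max_left _ _, le_max_right _ _]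
  calc ‖meanRidge H n l μ - f‖ * (‖meanRidge H n l μ‖ + ‖f‖)
      ≤ (R * l ^ r * (M * (1 + 1 / (l * √n)))) * (M * R + M * R) := by
        gcongr
        · exact (norm_meanRidge_sub_le hκ hK hn hl hr0 hr1 hf hs).trans (by gcongr)
        · exact (norm_meanRidge_le hκ hK hn hl hf).trans hf_le
    _ = 2 * R ^ 2 * M ^ 2 * l ^ r * (1 + 1 / (l * √n)) := by ring

end SingleTask

theorem hsNorm_taskCov_meanRidge_sub_le (hκ : 0 ≤ κ) (hK : KernelAssumptions H κ) {N : ℕ}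
    (hn : 0 < n) {r R : ℝ} (hl : 0 < l) (hr0 : 0 ≤ r) (hr1 : r ≤ 1)
    (μ : Fin N → Measure (X × ℝ)) [∀ i, IsProbabilityMeasure (μ i)] (f : Fin N → H)
    (hf : ∀ i, IsRegressionFunction (μ i) (f i)) (hs : ∀ i, SourceCondition (μ i) r R (f i)) :
    hsNorm (taskCov (fun i => meanRidge H n l (μ i)) - taskCov f)
      ≤ ENNReal.ofReal (2 * R ^ 2 * max 1 (κ ^ 2) ^ 2 * l ^ r * (1 + 1 / (l * √n))) := by
  rw [taskCov, taskCov, ← smul_sub, ← Finset.sum_sub_distrib]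
  exact hsNorm_average_le fun i =>
    hsNorm_rankOne_meanRidge_sub_le hκ hK hn hl hr0 hr1 (hf i) (hs i)

end MeanRidge

/-! ### Perturbation of the span of the top right singular vectors -/

section Perturbation

variable {H : Type*} [NormedAddCommGroup H] [InnerProductSpace ℝ H]

theorem exists_mem_ne_zero_apply_eq_zero {E F : Type*} [AddCommGroup E] [Module ℝ E]
    [AddCommGroup F] [Module ℝ F] (C : E →ₗ[ℝ] F) {M : Submodule ℝ E} {V : Submodule ℝ F}
    [FiniteDimensional ℝ M] [FiniteDimensional ℝ V] (hC : ∀ x, C x ∈ V)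
    (hVM : Module.finrank ℝ V < Module.finrank ℝ M) : ∃ u ∈ M, u ≠ 0 ∧ C u = 0 := by
  obtain ⟨u, hu, hu0⟩ := Submodule.exists_mem_ne_zero_of_ne_bot
    (LinearMap.ker_ne_bot_of_finrank_lt (f := (C.comp M.subtype).codRestrict V fun x => hC x) hVM)
  exact ⟨u, u.2, by simpa using hu0, congrArg Subtype.val (LinearMap.mem_ker.1 hu)⟩

theorem finrank_span_insert_range_orthonormal {s : ℕ} {v : Fin s → H} (hv : Orthonormal ℝ v)
    {w : H} (hw0 : w ≠ 0) (hw : w ∈ (Submodule.span ℝ (Set.range v))ᗮ) :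
    Module.finrank ℝ (Submodule.span ℝ (insert w (Set.range v))) = s + 1 := by
  have hw_notMem : w ∉ Submodule.span ℝ (Set.range v) := fun hmem =>
    hw0 (inner_self_eq_zero.1 (Submodule.inner_right_of_mem_orthogonal hmem hw))
  rw [← Fin.range_cons, finrank_span_eq_card
    (linearIndependent_finCons.2 ⟨hv.linearIndependent, hw_notMem⟩), Fintype.card_fin]

theorem mem_orthogonal_span_range {ι : Type*} {v : ι → H} {w : H}
    (hw : ∀ i, inner ℝ (v i) w = 0) : w ∈ (Submodule.span ℝ (Set.range v))ᗮ := by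
  rw [← Submodule.span_singleton_le_iff_mem, ← Submodule.isOrtho_iff_le, Submodule.isOrtho_comm,
    Submodule.isOrtho_span]
  rintro _ ⟨i, rfl⟩ _ rfl
  exact hw i

section SingularVectors

variable [CompleteSpace H] {s : ℕ} {A : H →L[ℝ] H} {v : Fin s → H} {y w : H}

theorem IsTopRightSingular.inner_apply_apply_eq_zero (hv : IsTopRightSingular A v)
    (hy : y ∈ Submodule.span ℝ (Set.range v)) (hw : w ∈ (Submodule.span ℝ (Set.range v))ᗮ) :
    inner ℝ (A y) (A w) = 0 := by
  obtain ⟨-, σ, hσ, -⟩ := hv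
  rw [← ContinuousLinearMap.adjoint_inner_left]
  refine Submodule.inner_right_of_mem_orthogonal ?_ hw
  obtain ⟨c, rfl⟩ := (Submodule.mem_span_range_iff_exists_fun ℝ).1 hy
  simp only [map_sum, map_smul, hσ]
  exact Submodule.sum_mem _ fun j _ => Submodule.smul_mem _ _ <| Submodule.smul_mem _ _ <|
    Submodule.subset_span ⟨j, rfl⟩

theorem IsTopRightSingular.norm_apply_mul_norm_le (hv : IsTopRightSingular A v)
    (hy : y ∈ Submodule.span ℝ (Set.range v)) (hw : w ∈ (Submodule.span ℝ (Set.range v))ᗮ) :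
    ‖A w‖ * ‖y‖ ≤ ‖A y‖ * ‖w‖ := by
  obtain ⟨hon, σ, hσ, htop⟩ := hv
  obtain ⟨c, rfl⟩ := (Submodule.mem_span_range_iff_exists_fun ℝ).1 hy
  have hnorm_y : ‖∑ j, c j • v j‖ ^ 2 = ∑ j, c j ^ 2 := by
    rw [← real_inner_self_eq_norm_sq, hon.inner_sum]
    simp [sq]
  have hnorm_Ay : ‖A (∑ j, c j • v j)‖ ^ 2 = ∑ j, σ j ^ 2 * c j ^ 2 := by
    rw [← real_inner_self_eq_norm_sq, ← ContinuousLinearMap.adjoint_inner_left]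
    simp only [map_sum, map_smul, hσ, smul_smul]
    rw [hon.inner_sum]
    exact Finset.sum_congr rfl fun j _ => by simp only [conj_trivial]; ring
  have hbound : ∀ j, ‖A w‖ ≤ σ j * ‖w‖ :=
    htop w fun j =>
      Submodule.inner_right_of_mem_orthogonal (Submodule.subset_span (Set.mem_range_self j)) hw
  refine le_of_sq_le_sq ?_ (by positivity)
  rw [mul_pow, mul_pow, hnorm_y, hnorm_Ay, Finset.mul_sum, Finset.sum_mul]
  refine Finset.sum_le_sum fun j _ => ?_
  calc ‖A w‖ ^ 2 * c j ^ 2 ≤ (σ j * ‖w‖) ^ 2 * c j ^ 2 := by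
        gcongr
        exact hbound j
    _ = σ j ^ 2 * c j ^ 2 * ‖w‖ ^ 2 := by ring

theorem IsTopRightSingular.norm_apply_mul_norm_add_smul_le (hv : IsTopRightSingular A v)
    (hy : y ∈ Submodule.span ℝ (Set.range v)) (hw : w ∈ (Submodule.span ℝ (Set.range v))ᗮ)
    (b : ℝ) : ‖A w‖ * ‖b • w + y‖ ≤ ‖A (b • w + y)‖ * ‖w‖ := by
  have hnorm : ‖b • w + y‖ ^ 2 = b ^ 2 * ‖w‖ ^ 2 + ‖y‖ ^ 2 := by
    rw [norm_add_sq_real, real_inner_comm, inner_smul_right,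
      Submodule.inner_right_of_mem_orthogonal hy hw, norm_smul, mul_pow, Real.norm_eq_abs, sq_abs]
    ring
  have hnorm_A : ‖A (b • w + y)‖ ^ 2 = b ^ 2 * ‖A w‖ ^ 2 + ‖A y‖ ^ 2 := by
    rw [map_add, map_smul, norm_add_sq_real, real_inner_comm, inner_smul_right,
      hv.inner_apply_apply_eq_zero hy hw, norm_smul, mul_pow, Real.norm_eq_abs, sq_abs]
    ring
  have hle := pow_le_pow_left₀ (by positivity) (hv.norm_apply_mul_norm_le hy hw) 2
  refine le_of_sq_le_sq ?_ (by positivity)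
  rw [mul_pow, mul_pow, hnorm, hnorm_A]
  linarith

/-- Some nonzero vector of `span v ⊕ ℝ w` is killed by `C`, and there `A` is at most `Δ`; on this
space `A` is smallest in the direction of `w`. -/
theorem IsTopRightSingular.norm_apply_le {C : H →ₗ[ℝ] H}
    (hv : IsTopRightSingular A v) {V : Submodule ℝ H} [FiniteDimensional ℝ V]
    (hV : Module.finrank ℝ V ≤ s) (hC : ∀ x, C x ∈ V) {Δ : ℝ}
    (hAC : ∀ x, ‖A x - C x‖ ≤ Δ * ‖x‖) (hw : w ∈ (Submodule.span ℝ (Set.range v))ᗮ) :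
    ‖A w‖ ≤ Δ * ‖w‖ := by
  rcases eq_or_ne w 0 with rfl | hw0
  · simp
  have hrank := finrank_span_insert_range_orthonormal hv.1 hw0 hw
  have : FiniteDimensional ℝ (Submodule.span ℝ (insert w (Set.range v))) :=
    Module.finite_of_finrank_pos (by omega)
  obtain ⟨u, hu, hu0, hCu⟩ := exists_mem_ne_zero_apply_eq_zero
    (M := Submodule.span ℝ (insert w (Set.range v))) C hC (by omega)
  obtain ⟨b, y, hy, rfl⟩ := Submodule.mem_span_insert.1 hu
  have hAu := hAC (b • w + y)
  rw [hCu, sub_zero] at hAu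
  refine le_of_mul_le_mul_right ?_ (norm_pos_iff.2 hu0)
  calc ‖A w‖ * ‖b • w + y‖ ≤ ‖A (b • w + y)‖ * ‖w‖ :=
        hv.norm_apply_mul_norm_add_smul_le hy hw b
    _ ≤ Δ * ‖b • w + y‖ * ‖w‖ := by gcongr
    _ = Δ * ‖w‖ * ‖b • w + y‖ := by ring

end SingularVectors

section TaskCov

variable {N : ℕ} (f : Fin N → H)

theorem taskCov_apply (g : H) : taskCov f g = (1 / (N : ℝ)) • ∑ i, inner ℝ (f i) g • f i := by
  simp [taskCov]

theorem isSymmetric_taskCov : (taskCov f : H →ₗ[ℝ] H).IsSymmetric := by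
  intro x y
  simp only [ContinuousLinearMap.coe_coe, taskCov_apply, inner_smul_left, inner_smul_right,
    sum_inner, inner_sum, conj_trivial]
  congr 1
  refine Finset.sum_congr rfl fun i _ => ?_
  rw [real_inner_comm x (f i)]
  ring

theorem taskCov_mem_span (g : H) : taskCov f g ∈ Submodule.span ℝ (Set.range f) := by
  rw [taskCov_apply]
  exact Submodule.smul_mem _ _ (Submodule.sum_mem _ fun i _ =>
    Submodule.smul_mem _ _ (Submodule.subset_span ⟨i, rfl⟩))

variable {f}

theorem eq_zero_of_taskCov_eq_zero {g : H} (hg : g ∈ Submodule.span ℝ (Set.range f))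
    (h : taskCov f g = 0) : g = 0 := by
  rcases Nat.eq_zero_or_pos N with rfl | hN
  · simpa using hg
  have hsum : 1 / (N : ℝ) * ∑ i, inner ℝ (f i) g ^ 2 = 0 := by
    have hform : inner ℝ (taskCov f g) g = 0 := by rw [h, inner_zero_left]
    simpa only [taskCov_apply, inner_smul_left, sum_inner, conj_trivial, ← sq] using hform
  have hzero := (mul_eq_zero.1 hsum).resolve_left (by positivity)
  rw [Finset.sum_eq_zero_iff_of_nonneg fun i _ => sq_nonneg _] at hzero
  refine inner_self_eq_zero.1 (Submodule.inner_right_of_mem_orthogonal hg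
    (mem_orthogonal_span_range fun i => ?_))
  simpa using hzero i (Finset.mem_univ i)

theorem mul_norm_le_norm_apply_of_le_eigenvalue {V : Type*} [NormedAddCommGroup V]
    [InnerProductSpace ℝ V] [FiniteDimensional ℝ V] {T : V →ₗ[ℝ] V} (hT : T.IsSymmetric) {γ : ℝ}
    (hγ : 0 ≤ γ) (hgap : ∀ t, Module.End.HasEigenvalue T t → γ ≤ t) (g : V) : γ * ‖g‖ ≤ ‖T g‖ := by
  have hle : ∀ i, γ ≤ hT.eigenvalues rfl i := fun i => hgap _ (hT.hasEigenvalue_eigenvalues rfl i)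
  refine le_of_sq_le_sq ?_ (norm_nonneg _)
  rw [mul_pow, ← (hT.eigenvectorBasis rfl).sum_sq_norm_inner_right,
    ← (hT.eigenvectorBasis rfl).sum_sq_norm_inner_right, Finset.mul_sum]
  refine Finset.sum_le_sum fun i _ => ?_
  rw [← hT, hT.apply_eigenvectorBasis, inner_smul_left, norm_mul, mul_pow]
  gcongr
  simpa [abs_of_nonneg (hγ.trans (hle i))] using hle i

theorem exists_taskCov_eq {γ : ℝ} (hγ : 0 ≤ γ)
    (hgap : ∀ t : ℝ, t ≠ 0 → Module.End.HasEigenvalue (taskCov f : H →ₗ[ℝ] H) t → γ ≤ t) {x : H}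
    (hx : x ∈ Submodule.span ℝ (Set.range f)) : ∃ g, taskCov f g = x ∧ γ * ‖g‖ ≤ ‖x‖ := by
  have : FiniteDimensional ℝ (Submodule.span ℝ (Set.range f)) :=
    FiniteDimensional.span_of_finite ℝ (Set.finite_range f)
  have hmaps : ∀ g ∈ Submodule.span ℝ (Set.range f),
      (taskCov f : H →ₗ[ℝ] H) g ∈ Submodule.span ℝ (Set.range f) := fun g _ => taskCov_mem_span f g
  set T := (taskCov f : H →ₗ[ℝ] H).restrict hmaps
  have hinj : Function.Injective T := (injective_iff_map_eq_zero T).2 fun g hg =>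
    Subtype.ext (eq_zero_of_taskCov_eq_zero g.2 (congrArg Subtype.val hg))
  have hgapT : ∀ t, Module.End.HasEigenvalue T t → γ ≤ t := by
    intro t ht
    obtain ⟨e, he, he0⟩ := ht.exists_hasEigenvector
    rw [Module.End.mem_eigenspace_iff] at he
    refine hgap t (fun ht0 => he0 (hinj ?_)) (Module.End.hasEigenvalue_of_hasEigenvector
      (x := (e : H))
      ⟨Module.End.mem_eigenspace_iff.2 (congrArg Subtype.val he), by simpa using he0⟩)
    rw [he, ht0, zero_smul, map_zero]
  obtain ⟨g, hg⟩ := LinearMap.surjective_of_injective hinj ⟨x, hx⟩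
  refine ⟨g, congrArg Subtype.val hg, ?_⟩
  have hle := mul_norm_le_norm_apply_of_le_eigenvalue
    ((isSymmetric_taskCov f).restrict_invariant hmaps) hγ hgapT g
  rwa [hg] at hle

theorem IsTopRightSingular.norm_sub_starProjection_le [CompleteSpace H] {s : ℕ} {γ : ℝ}
    (hγ : 0 < γ)
    (hgap : ∀ t : ℝ, t ≠ 0 → Module.End.HasEigenvalue (taskCov f : H →ₗ[ℝ] H) t → γ ≤ t) {x : H}
    (hx : x ∈ Submodule.span ℝ (Set.range f))
    (hs : Module.finrank ℝ (Submodule.span ℝ (Set.range f)) = s) {A : H →L[ℝ] H} {v : Fin s → H}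
    (hv : IsTopRightSingular A v) {Δ : ℝ} (hΔ : 0 ≤ Δ)
    (hA : ∀ x, ‖A x - taskCov f x‖ ≤ Δ * ‖x‖)
    [(Submodule.span ℝ (Set.range v)).HasOrthogonalProjection] :
    ‖x - (Submodule.span ℝ (Set.range v)).starProjection x‖ ≤ 2 * Δ * ‖x‖ / γ := by
  have : FiniteDimensional ℝ (Submodule.span ℝ (Set.range f)) :=
    FiniteDimensional.span_of_finite ℝ (Set.finite_range f)
  obtain ⟨g, hg, hg_le⟩ := exists_taskCov_eq hγ.le hgap hx
  set W := Submodule.span ℝ (Set.range v)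
  set q := x - W.starProjection x with hq_def
  have hq : q ∈ Wᗮ := W.sub_starProjection_mem_orthogonal x
  have hCq : ‖taskCov f q‖ ≤ 2 * Δ * ‖q‖ := by
    have hAq : ‖A q‖ ≤ Δ * ‖q‖ :=
      hv.norm_apply_le (C := (taskCov f : H →ₗ[ℝ] H)) hs.le (taskCov_mem_span f) hA hq
    have htriangle := norm_sub_le (A q) (A q - taskCov f q)
    rw [sub_sub_cancel] at htriangle
    linarith [hA q]
  have hq_sq : ‖q‖ ^ 2 = inner ℝ (taskCov f q) g := by
    have hsymm : inner ℝ (taskCov f q) g = inner ℝ q (taskCov f g) := isSymmetric_taskCov f q g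
    rw [hsymm, hg, ← real_inner_self_eq_norm_sq]
    nth_rewrite 2 [hq_def]
    rw [inner_sub_right, Submodule.inner_left_of_mem_orthogonal (W.starProjection_apply_mem x) hq,
      sub_zero]
  have hq_le : ‖q‖ ≤ 2 * Δ * ‖g‖ := by
    rcases (norm_nonneg q).eq_or_lt with hq0 | hq0
    · rw [← hq0]
      positivity
    refine le_of_mul_le_mul_right ?_ hq0
    calc ‖q‖ * ‖q‖ = inner ℝ (taskCov f q) g := by rw [← sq, hq_sq]
      _ ≤ 2 * Δ * ‖q‖ * ‖g‖ := (real_inner_le_norm _ _).trans (by gcongr)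
      _ = 2 * Δ * ‖g‖ * ‖q‖ := by ring
  rw [le_div_iff₀ hγ]
  calc ‖q‖ * γ ≤ 2 * Δ * ‖g‖ * γ := by gcongr
    _ = 2 * Δ * (γ * ‖g‖) := by ring
    _ ≤ 2 * Δ * ‖x‖ := by gcongr

end TaskCov

end Perturbation

/-! ### Concentration of the empirical task operator -/

section HilbertSchmidtMoment

variable {H : Type*} [NormedAddCommGroup H] [InnerProductSpace ℝ H] [CompleteSpace H]
  [TopologicalSpace.SeparableSpace H]

theorem aemeasurable_hsNorm_sq {Ω : Type*} [MeasurableSpace Ω] {ν : Measure Ω}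
    {A : Ω → H →L[ℝ] H} (hA : ∀ x, AEStronglyMeasurable (fun ω => A ω x) ν) :
    AEMeasurable (fun ω => hsNorm (A ω) ^ 2) ν := by
  obtain ⟨w, b, -⟩ := exists_hilbertBasis ℝ H
  have : Countable w := countable_of_hilbertBasis b
  simp only [hsNorm_sq b]
  exact AEMeasurable.tsum fun e => (hA (b e)).enorm.pow_const 2

theorem lintegral_hsNorm_average_sub_sq_le {N : ℕ} {Ω : Fin N → Type*}
    {mΩ : ∀ i, MeasurableSpace (Ω i)} (ν : ∀ i, Measure (Ω i)) [∀ i, IsProbabilityMeasure (ν i)]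
    {A : ∀ i, Ω i → H →L[ℝ] H} {M : Fin N → H →L[ℝ] H}
    (hA : ∀ i x, MemLp (fun ω => A i ω x) 2 (ν i)) (hM : ∀ i x, ∫ ω, A i ω x ∂ν i = M i x) :
    ∫⁻ ω, hsNorm ((1 / (N : ℝ)) • ∑ i, (A i (ω i) - M i)) ^ 2 ∂Measure.pi ν
      ≤ ENNReal.ofReal (1 / N) ^ 2 * ∑ i, ∫⁻ ω, hsNorm (A i ω) ^ 2 ∂ν i := by
  obtain ⟨w, b, -⟩ := exists_hilbertBasis ℝ H
  have : Countable w := countable_of_hilbertBasis b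
  have happly : ∀ (e : w) (ω : ∀ i, Ω i), ((1 / (N : ℝ)) • ∑ i, (A i (ω i) - M i)) (b e)
      = (1 / (N : ℝ)) • ∑ i, (A i (ω i) (b e) - ∫ a, A i a (b e) ∂ν i) := fun e ω => by
    simp only [hM, smul_apply, sum_apply, sub_apply]
  have hmeas : ∀ e : w, AEStronglyMeasurable (fun ω : ∀ i, Ω i =>
      (1 / (N : ℝ)) • ∑ i, (A i (ω i) (b e) - ∫ a, A i a (b e) ∂ν i)) (Measure.pi ν) := fun e =>
    (Finset.aestronglyMeasurable_fun_sum _ fun i _ =>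
      ((hA i (b e)).1.comp_measurePreserving (measurePreserving_eval ν i)).sub
        aestronglyMeasurable_const).const_smul _
  calc ∫⁻ ω, hsNorm ((1 / (N : ℝ)) • ∑ i, (A i (ω i) - M i)) ^ 2 ∂Measure.pi ν
      = ∑' e, ∫⁻ ω, ‖(1 / (N : ℝ)) • ∑ i, (A i (ω i) (b e) - ∫ a, A i a (b e) ∂ν i)‖ₑ ^ 2
          ∂Measure.pi ν := by
        rw [← lintegral_tsum fun e => (hmeas e).enorm.pow_const 2]
        simp only [hsNorm_sq b, happly]
    _ ≤ ∑' e, ENNReal.ofReal (1 / N) ^ 2 * ∑ i, ∫⁻ ω, ‖A i ω (b e)‖ₑ ^ 2 ∂ν i :=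
        ENNReal.tsum_le_tsum fun e =>
          lintegral_enorm_average_sub_integral_sq_le ν fun i => hA i (b e)
    _ = ENNReal.ofReal (1 / N) ^ 2 * ∑ i, ∫⁻ ω, hsNorm (A i ω) ^ 2 ∂ν i := by
        rw [ENNReal.tsum_mul_left, Summable.tsum_finsetSum fun i _ => ENNReal.summable]
        congr! 2 with i
        simp only [hsNorm_sq b]
        exact (lintegral_tsum fun e => (hA i (b e)).1.enorm.pow_const 2).symm

end HilbertSchmidtMoment

section Source

theorem measurePreserving_finAppend {Ω : Type*} [MeasurableSpace Ω] (μ : Measure Ω)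
    [IsProbabilityMeasure μ] (m n : ℕ) :
    MeasurePreserving (fun p : (Fin m → Ω) × (Fin n → Ω) => Fin.append p.1 p.2)
      ((Measure.pi fun _ => μ).prod (Measure.pi fun _ => μ)) (Measure.pi fun _ => μ) := by
  have hmeas : Measurable fun p : (Fin m → Ω) × (Fin n → Ω) => Fin.append p.1 p.2 := by
    refine measurable_pi_lambda _ fun i => Fin.addCases (fun i => ?_) (fun i => ?_) i
    · simpa only [Fin.append_left, Function.comp_def] using
        (measurable_pi_apply i).comp measurable_fst
    · simpa only [Fin.append_right, Function.comp_def] using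
        (measurable_pi_apply i).comp measurable_snd
  refine ⟨hmeas, (Measure.pi_eq fun s hs => ?_).symm⟩
  have hpre : (fun p : (Fin m → Ω) × (Fin n → Ω) => Fin.append p.1 p.2) ⁻¹' Set.univ.pi s
      = (Set.univ.pi fun i => s (Fin.castAdd n i)) ×ˢ
        (Set.univ.pi fun i => s (Fin.natAdd m i)) := by
    ext p
    simp only [Set.mem_preimage, Set.mem_pi, Set.mem_univ, true_implies, Set.mem_prod,
      Fin.forall_fin_add, Fin.append_left, Fin.append_right]
  rw [Measure.map_apply hmeas (MeasurableSet.univ_pi hs), hpre, Measure.prod_prod,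
    Measure.pi_pi, Measure.pi_pi, Fin.prod_univ_add]

section SplitSample

variable {Ω H : Type*} [MeasurableSpace Ω] [NormedAddCommGroup H] [InnerProductSpace ℝ H]
  {n : ℕ} {g : (Fin n → Ω) → H}

theorem stronglyMeasurable_rankOne_split_apply (hg : StronglyMeasurable g) (x : H) :
    StronglyMeasurable fun D : Fin (n + n) → Ω =>
      rankOne ℝ (g fun j => D (Fin.castAdd n j)) (g fun j => D (Fin.natAdd n j)) x := by
  have hfirst : StronglyMeasurable fun D : Fin (n + n) → Ω => g fun j => D (Fin.castAdd n j) :=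
    hg.comp_measurable (measurable_pi_lambda _ fun j => measurable_pi_apply _)
  have hlast : StronglyMeasurable fun D : Fin (n + n) → Ω => g fun j => D (Fin.natAdd n j) :=
    hg.comp_measurable (measurable_pi_lambda _ fun j => measurable_pi_apply _)
  exact (hlast.inner stronglyMeasurable_const).smul hfirst

theorem integral_pi_rankOne_split_apply [CompleteSpace H] (μ : Measure Ω)
    [IsProbabilityMeasure μ] (hg : StronglyMeasurable g)
    (hgi : Integrable g (Measure.pi fun _ => μ)) (x : H) :
    ∫ D : Fin (n + n) → Ω, rankOne ℝ (g fun j => D (Fin.castAdd n j))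
        (g fun j => D (Fin.natAdd n j)) x ∂(Measure.pi fun _ => μ)
      = rankOne ℝ (∫ D, g D ∂(Measure.pi fun _ => μ)) (∫ D, g D ∂(Measure.pi fun _ => μ)) x := by
  have happend := measurePreserving_finAppend μ n n
  rw [← happend.map_eq, integral_map happend.measurable.aemeasurable
    (stronglyMeasurable_rankOne_split_apply hg x).aestronglyMeasurable]
  simp only [Fin.append_left, Fin.append_right, rankOne_apply]
  rw [← integral_prod_swap]
  simp only [Prod.fst_swap, Prod.snd_swap, real_inner_comm x]
  rw [← integral_inner hgi]
  exact integral_prod_smul (μ := Measure.pi fun _ : Fin n => μ)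
    (ν := Measure.pi fun _ : Fin n => μ) (fun D => inner ℝ x (g D)) g

end SplitSample

theorem ae_pi_forall {ι Ω : Type*} [Fintype ι] [MeasurableSpace Ω] {μ : Measure Ω}
    [IsProbabilityMeasure μ] {p : Ω → Prop} (hp : ∀ᵐ x ∂μ, p x) :
    ∀ᵐ D ∂(Measure.pi fun _ : ι => μ), ∀ j, p (D j) :=
  ae_all_iff.2 fun j =>
    (measurePreserving_eval (fun _ : ι => μ) j).quasiMeasurePreserving.ae hp

theorem hsNorm_average_rankOne_le {H : Type*} [NormedAddCommGroup H] [InnerProductSpace ℝ H]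
    [CompleteSpace H] {N : ℕ} {u v : Fin N → H} {c : ℝ} (h : ∀ i, ‖u i‖ * ‖v i‖ ≤ c) :
    hsNorm ((1 / (N : ℝ)) • ∑ i, rankOne ℝ (u i) (v i)) ≤ ENNReal.ofReal c :=
  hsNorm_average_le fun i => by
    rw [hsNorm_rankOne, ← ofReal_norm, ← ofReal_norm, ← ENNReal.ofReal_mul (norm_nonneg _)]
    exact ENNReal.ofReal_le_ofReal (h i)

variable {X H : Type*} [NormedAddCommGroup H] [InnerProductSpace ℝ H] [CompleteSpace H]
  [RKHS ℝ H X ℝ]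

theorem norm_ridge_top_mul_norm_ridge_top_le {m n : ℕ} (hm : 0 < m) (hn : 0 < n) {l B : ℝ}
    (hl : 0 < l) {D : Fin m → X × ℝ} {D' : Fin n → X × ℝ} (hD : ∀ j, |(D j).2| ≤ B)
    (hD' : ∀ j, |(D' j).2| ≤ B) :
    ‖ridge (⊤ : Submodule ℝ H) l D‖ * ‖ridge (⊤ : Submodule ℝ H) l D'‖ ≤ B ^ 2 / l := by
  have hnorm := norm_ridge_top_sq_le (H := H) hm hl hD
  have hnorm' := norm_ridge_top_sq_le (H := H) hn hl hD'
  linarith [two_mul_le_add_sq ‖ridge (⊤ : Submodule ℝ H) l D‖ ‖ridge (⊤ : Submodule ℝ H) l D'‖]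

variable [MeasurableSpace X] {κ l B : ℝ} {N n : ℕ}

theorem stronglyMeasurable_empTaskCov_apply [TopologicalSpace.SeparableSpace H]
    (hK : KernelAssumptions H κ) (hn : 0 < n) (hl : 0 < l) (x : H) :
    StronglyMeasurable fun D : Fin N → Fin (n + n) → X × ℝ => empTaskCov H l D x := by
  have hsplit : ∀ i, StronglyMeasurable fun D : Fin N → Fin (n + n) → X × ℝ =>
      rankOne ℝ (ridge (⊤ : Submodule ℝ H) l fun j : Fin n => D i (Fin.castAdd n j))
        (ridge (⊤ : Submodule ℝ H) l fun j : Fin n => D i (Fin.natAdd n j)) x := fun i =>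
    (stronglyMeasurable_rankOne_split_apply (stronglyMeasurable_ridge hK hn hl) x).comp_measurable
      (measurable_pi_apply i)
  simp only [empTaskCov, smul_apply, sum_apply]
  exact (Finset.stronglyMeasurable_fun_sum _ fun i _ => hsplit i).const_smul _

variable {μ : Fin N → Measure (X × ℝ)} [∀ i, IsProbabilityMeasure (μ i)]

theorem ae_hsNorm_empTaskCov_le (hn : 0 < n) (hl : 0 < l) (hB : ∀ i, ∀ᵐ p ∂μ i, |p.2| ≤ B) :
    ∀ᵐ D ∂sourceLaw n μ, hsNorm (empTaskCov H l D) ≤ ENNReal.ofReal (B ^ 2 / l) := by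
  have hlabels : ∀ᵐ D ∂sourceLaw n μ, ∀ i j, |(D i j).2| ≤ B := ae_all_iff.2 fun i =>
    (measurePreserving_eval (fun i => Measure.pi fun _ : Fin (n + n) => μ i)
      i).quasiMeasurePreserving.ae (ae_pi_forall (hB i))
  filter_upwards [hlabels] with D hD
  exact hsNorm_average_rankOne_le fun i =>
    norm_ridge_top_mul_norm_ridge_top_le hn hn hl (fun j => hD i _) fun j => hD i _

theorem SourceCondition.hsNorm_taskCov_le (hκ : 0 ≤ κ) (hK : KernelAssumptions H κ)
    [TopologicalSpace.SeparableSpace H] {r R : ℝ} (hr0 : 0 ≤ r) (hr1 : r ≤ 1) {f : Fin N → H}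
    (hs : ∀ i, SourceCondition (μ i) r R (f i)) :
    hsNorm (taskCov f) ≤ ENNReal.ofReal ((max 1 (κ ^ 2) * R) ^ 2) :=
  hsNorm_average_rankOne_le fun i => by
    have hf := (hs i).norm_le hκ hK hr0 hr1
    rw [← sq]
    gcongr

variable [TopologicalSpace.SeparableSpace H]

theorem lintegral_hsNorm_empTaskCov_sub_sq_le (hκ : 0 ≤ κ) (hK : KernelAssumptions H κ)
    (hn : 0 < n) (hl : 0 < l) (hμ : ∀ i, Integrable Prod.snd (μ i))
    (hB : ∀ i, ∀ᵐ p ∂μ i, |p.2| ≤ B) :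
    ∫⁻ D, hsNorm (empTaskCov H l D - taskCov fun i => meanRidge H n l (μ i)) ^ 2 ∂sourceLaw n μ
      ≤ ENNReal.ofReal ((B ^ 2 / l) ^ 2 / N) := by
  set g : (Fin n → X × ℝ) → H := fun D => ridge (⊤ : Submodule ℝ H) l D
  have hg : StronglyMeasurable g := stronglyMeasurable_ridge hK hn hl
  set A : (Fin (n + n) → X × ℝ) → H →L[ℝ] H := fun D =>
    rankOne ℝ (g fun j => D (Fin.castAdd n j)) (g fun j => D (Fin.natAdd n j))
  have hbound : ∀ i, ∀ᵐ D ∂(Measure.pi fun _ : Fin (n + n) => μ i),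
      hsNorm (A D) ≤ ENNReal.ofReal (B ^ 2 / l) := fun i => by
    filter_upwards [ae_pi_forall (hB i)] with D hD
    rw [hsNorm_rankOne, ← ofReal_norm, ← ofReal_norm, ← ENNReal.ofReal_mul (norm_nonneg _)]
    exact ENNReal.ofReal_le_ofReal
      (norm_ridge_top_mul_norm_ridge_top_le hn hn hl (fun j => hD _) fun j => hD _)
  have hmem : ∀ i x, MemLp (fun D => A D x) 2 (Measure.pi fun _ => μ i) := fun i x => by
    refine MemLp.of_bound
      (stronglyMeasurable_rankOne_split_apply hg x).aestronglyMeasurable (B ^ 2 / l * ‖x‖) ?_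
    filter_upwards [hbound i] with D hD
    exact norm_apply_le_of_hsNorm_le (by positivity) hD x
  have hmean : ∀ i x, ∫ D, A D x ∂(Measure.pi fun _ => μ i)
      = rankOne ℝ (meanRidge H n l (μ i)) (meanRidge H n l (μ i)) x := fun i x =>
    integral_pi_rankOne_split_apply (μ i) hg (integrable_ridge hκ hK hn hl (hμ i)) x
  calc ∫⁻ D, hsNorm (empTaskCov H l D - taskCov fun i => meanRidge H n l (μ i)) ^ 2 ∂sourceLaw n μ
      ≤ ENNReal.ofReal (1 / N) ^ 2 *
          ∑ i, ∫⁻ D, hsNorm (A D) ^ 2 ∂(Measure.pi fun _ => μ i) := by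
        have hmoment := lintegral_hsNorm_average_sub_sq_le (fun i => Measure.pi fun _ => μ i)
          hmem hmean
        simp only [Finset.sum_sub_distrib, smul_sub] at hmoment
        exact hmoment
    _ ≤ ENNReal.ofReal ((B ^ 2 / l) ^ 2 / N) := ofReal_one_div_sq_mul_sum_le fun i => by
        rw [ENNReal.ofReal_pow (by positivity)]
        refine (lintegral_mono_ae (g := fun _ => ENNReal.ofReal (B ^ 2 / l) ^ 2) ?_).trans
          (by simp)
        filter_upwards [hbound i] with D hD
        gcongr

theorem sourceLaw_hsNorm_empTaskCov_sub_gt_le (hκ : 0 ≤ κ) (hK : KernelAssumptions H κ)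
    (hn : 0 < n) (hl : 0 < l) (hμ : ∀ i, Integrable Prod.snd (μ i))
    (hB : ∀ i, ∀ᵐ p ∂μ i, |p.2| ≤ B) {t : ℝ} (ht : 0 < t) :
    sourceLaw n μ {D | ENNReal.ofReal t <
        hsNorm (empTaskCov H l D - taskCov fun i => meanRidge H n l (μ i))}
      ≤ ENNReal.ofReal ((B ^ 2 / l) ^ 2 / N / t ^ 2) := by
  have hmeas := aemeasurable_hsNorm_sq (ν := sourceLaw n μ)
    (A := fun D => empTaskCov H l D - taskCov fun i => meanRidge H n l (μ i)) fun x =>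
      (stronglyMeasurable_empTaskCov_apply hK hn hl x).aestronglyMeasurable.sub
        aestronglyMeasurable_const
  rw [ENNReal.ofReal_div_of_pos (by positivity)]
  calc sourceLaw n μ {D | ENNReal.ofReal t <
        hsNorm (empTaskCov H l D - taskCov fun i => meanRidge H n l (μ i))}
      ≤ sourceLaw n μ {D | ENNReal.ofReal (t ^ 2) ≤
        hsNorm (empTaskCov H l D - taskCov fun i => meanRidge H n l (μ i)) ^ 2} :=
        measure_mono fun D hD => by
          rw [Set.mem_ofPred_eq, ENNReal.ofReal_pow ht.le]
          exact pow_le_pow_left' (le_of_lt hD) 2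
    _ ≤ _ := (meas_ge_le_lintegral_div hmeas (by simpa using ht.ne') (by simp)).trans
        (ENNReal.div_le_div_right (lintegral_hsNorm_empTaskCov_sub_sq_le hκ hK hn hl hμ hB) _)

end Source

section SourceTail

/-- The constant in the deviation bound for the empirical task operator: the three terms come from
the fluctuation around the mean, from the bias, and from the almost sure bound that covers the
sample sizes `n < 2 τ`. -/
def sourceConst (κ R B a : ℝ) : ℝ :=
  √(8 * (B ^ 4 + 1) / a) + 2 * (2 * R ^ 2 * max 1 (κ ^ 2) ^ 2)
    + 2 * (B ^ 2 + (max 1 (κ ^ 2) * R) ^ 2)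

theorem sourceConst_nonneg (κ R B a : ℝ) : 0 ≤ sourceConst κ R B a := by
  unfold sourceConst; positivity

theorem sq_le_exp_neg_mul_exp {x τ : ℝ} (hx : 0 ≤ x) (hτ : 2 * τ ≤ x) :
    x ^ 2 ≤ 8 * (Real.exp (-τ) * Real.exp x) := by
  have hquad := Real.quadratic_le_exp_of_nonneg (by positivity : 0 ≤ x / 2)
  have hexp : Real.exp (x / 2) ≤ Real.exp (-τ) * Real.exp x := by
    rw [← Real.exp_add]
    exact Real.exp_le_exp.2 (by linarith)
  nlinarith

variable {X H : Type*} [MeasurableSpace X] [NormedAddCommGroup H] [InnerProductSpace ℝ H]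
  [CompleteSpace H] [TopologicalSpace.SeparableSpace H] [RKHS ℝ H X ℝ] {κ r R B a τ : ℝ}
  {N n : ℕ} {μ : Fin N → Measure (X × ℝ)} [∀ i, IsProbabilityMeasure (μ i)] {f : Fin N → H}

theorem ae_hsNorm_empTaskCov_sub_taskCov_le (hκ : 0 ≤ κ) (hK : KernelAssumptions H κ) (hn : 0 < n)
    (hr0 : 0 ≤ r) (hr1 : r ≤ 1) (hnτ : n ≤ 2 * τ)
    (hs : ∀ i, SourceCondition (μ i) r R (f i)) (hB : ∀ i, ∀ᵐ p ∂μ i, |p.2| ≤ B) :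
    ∀ᵐ D ∂sourceLaw n μ, hsNorm (empTaskCov H (√n)⁻¹ D - taskCov f)
      ≤ ENNReal.ofReal (2 * (B ^ 2 + (max 1 (κ ^ 2) * R) ^ 2) * (τ * (√n)⁻¹)) := by
  have hn1 : (1 : ℝ) ≤ n := by exact_mod_cast hn
  have hsqrt : 1 ≤ √(n : ℝ) := Real.one_le_sqrt.2 hn1
  have hsqrt_le : √(n : ℝ) ≤ 2 * (τ * (√n)⁻¹) := by
    rw [← mul_assoc, ← div_eq_mul_inv, le_div_iff₀ (by positivity), Real.mul_self_sqrt (by simp)]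
    exact hnτ
  filter_upwards [ae_hsNorm_empTaskCov_le (H := H) hn
    (inv_pos.2 (zero_lt_one.trans_le hsqrt)) hB] with D hD
  refine (hsNorm_sub_le _ _).trans <|
    (add_le_add hD (SourceCondition.hsNorm_taskCov_le hκ hK hr0 hr1 hs)).trans ?_
  rw [← ENNReal.ofReal_add (by positivity) (by positivity)]
  refine ENNReal.ofReal_le_ofReal ?_
  calc B ^ 2 / (√n)⁻¹ + (max 1 (κ ^ 2) * R) ^ 2
      ≤ (B ^ 2 + (max 1 (κ ^ 2) * R) ^ 2) * √n := by
        rw [div_inv_eq_mul, add_mul]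
        gcongr
        exact le_mul_of_one_le_right (by positivity) hsqrt
    _ ≤ (B ^ 2 + (max 1 (κ ^ 2) * R) ^ 2) * (2 * (τ * (√n)⁻¹)) := by gcongr
    _ = _ := by ring

theorem sourceLaw_fluctuation_gt_le (hκ : 0 ≤ κ) (hK : KernelAssumptions H κ) (hn : 0 < n)
    (ha : 0 < a) (hnτ : 2 * τ ≤ n) (hN : a * Real.exp n ≤ N)
    (hμ : ∀ i, Integrable Prod.snd (μ i)) (hB : ∀ i, ∀ᵐ p ∂μ i, |p.2| ≤ B) :
    sourceLaw n μ {D | ENNReal.ofReal (√(8 * (B ^ 4 + 1) / a) * (√n)⁻¹) <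
        hsNorm (empTaskCov H (√n)⁻¹ D - taskCov fun i => meanRidge H n (√n)⁻¹ (μ i))}
      ≤ ENNReal.ofReal (Real.exp (-τ)) := by
  have hn' : (0 : ℝ) < n := by exact_mod_cast hn
  have hN' : (0 : ℝ) < N := lt_of_lt_of_le (by positivity) hN
  have hK0 : 0 < 8 * (B ^ 4 + 1) / a := by positivity
  refine (sourceLaw_hsNorm_empTaskCov_sub_gt_le hκ hK hn (by positivity) hμ hB
    (by positivity)).trans (ENNReal.ofReal_le_ofReal ?_)
  have hval : (B ^ 2 / (√n)⁻¹) ^ 2 / N / (√(8 * (B ^ 4 + 1) / a) * (√n)⁻¹) ^ 2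
      = B ^ 4 * a * n ^ 2 / (8 * (B ^ 4 + 1) * N) := by
    rw [mul_pow, div_pow, inv_pow, Real.sq_sqrt hK0.le, Real.sq_sqrt hn'.le]
    field_simp
  rw [hval, div_le_iff₀ (by positivity)]
  calc B ^ 4 * a * n ^ 2 ≤ (B ^ 4 + 1) * a * (8 * (Real.exp (-τ) * Real.exp n)) := by
        gcongr
        · linarith
        · exact sq_le_exp_neg_mul_exp hn'.le hnτ
    _ = 8 * (B ^ 4 + 1) * Real.exp (-τ) * (a * Real.exp n) := by ring
    _ ≤ 8 * (B ^ 4 + 1) * Real.exp (-τ) * N := by gcongr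
    _ = Real.exp (-τ) * (8 * (B ^ 4 + 1) * N) := by ring

theorem sourceLaw_hsNorm_empTaskCov_sub_taskCov_gt_le (hκ : 0 ≤ κ) (hK : KernelAssumptions H κ)
    (hn : 0 < n) (hr0 : 0 ≤ r) (hr1 : r ≤ 1) (ha : 0 < a) (hτ : 1 ≤ τ)
    (hN : a * Real.exp n ≤ N) (hf : ∀ i, IsRegressionFunction (μ i) (f i))
    (hs : ∀ i, SourceCondition (μ i) r R (f i)) (hB : ∀ i, ∀ᵐ p ∂μ i, |p.2| ≤ B) :
    sourceLaw n μ {D | ENNReal.ofReal (sourceConst κ R B a * τ * (n : ℝ) ^ (-(r / 2)))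
        < hsNorm (empTaskCov H ((n : ℝ) ^ (-(1 / 2) : ℝ)) D - taskCov f)}
      ≤ ENNReal.ofReal (Real.exp (-τ)) := by
  have hn1 : (1 : ℝ) ≤ n := by exact_mod_cast hn
  have hl : (n : ℝ) ^ (-(1 / 2) : ℝ) = (√n)⁻¹ := by
    rw [Real.rpow_neg (by positivity), Real.sqrt_eq_rpow]
  have hlr : ((√n)⁻¹ : ℝ) ^ r = (n : ℝ) ^ (-(r / 2)) := by
    rw [← hl, ← Real.rpow_mul (by positivity)]; congr 1; ring
  have hl_le : (√n)⁻¹ ≤ (n : ℝ) ^ (-(r / 2)) := by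
    rw [← hl]
    exact Real.rpow_le_rpow_of_exponent_le hn1 (by linarith)
  have hl0 : 0 < (√(n : ℝ))⁻¹ := by positivity
  rw [hl]
  set ρ := (n : ℝ) ^ (-(r / 2))
  rcases le_total (n : ℝ) (2 * τ) with hnτ | hnτ
  · have hae := ae_hsNorm_empTaskCov_sub_taskCov_le hκ hK hn hr0 hr1 hnτ hs hB
    refine (measure_mono_null (fun D hD => ?_) (ae_iff.1 hae)).trans_le zero_le
    refine not_le.2 (lt_of_le_of_lt (ENNReal.ofReal_le_ofReal ?_) hD)
    calc 2 * (B ^ 2 + (max 1 (κ ^ 2) * R) ^ 2) * (τ * (√n)⁻¹)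
        ≤ sourceConst κ R B a * (τ * ρ) := by
          unfold sourceConst
          gcongr
          exact le_add_of_nonneg_left (by positivity)
      _ = sourceConst κ R B a * τ * ρ := by ring
  · refine (measure_mono fun D hD => ?_).trans
      (sourceLaw_fluctuation_gt_le hκ hK hn ha hnτ hN (fun i => (hf i).1) hB)
    have hbias := hsNorm_taskCov_meanRidge_sub_le hκ hK hn hl0 hr0 hr1 μ f hf hs
    rw [hlr, inv_mul_cancel₀ (inv_pos.1 hl0).ne'] at hbias
    contrapose! hD
    rw [Set.mem_ofPred_eq, not_lt] at hD ⊢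
    rw [← sub_add_sub_cancel]
    refine (hsNorm_add_le _ _).trans ((add_le_add hD hbias).trans ?_)
    rw [← ENNReal.ofReal_add (by positivity) (by positivity)]
    refine ENNReal.ofReal_le_ofReal ?_
    calc √(8 * (B ^ 4 + 1) / a) * (√n)⁻¹ + 2 * R ^ 2 * max 1 (κ ^ 2) ^ 2 * ρ * (1 + 1 / 1)
        ≤ √(8 * (B ^ 4 + 1) / a) * ρ + 2 * R ^ 2 * max 1 (κ ^ 2) ^ 2 * ρ * (1 + 1 / 1) := by
          gcongr
      _ = (√(8 * (B ^ 4 + 1) / a) + 2 * (2 * R ^ 2 * max 1 (κ ^ 2) ^ 2)) * 1 * ρ := by ring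
      _ ≤ sourceConst κ R B a * 1 * ρ := by
          gcongr
          exact le_add_of_nonneg_right (by positivity)
      _ ≤ sourceConst κ R B a * τ * ρ := by
          have := sourceConst_nonneg κ R B a
          gcongr

end SourceTail

/-! ### Inverse powers of a matrix under rank one perturbations -/

section MatrixTail

open Matrix

variable {ι : Type*} [Fintype ι]

/-- `A` is symmetric and bounded below by `c`. -/
def SymmGE (A : Matrix ι ι ℝ) (c : ℝ) : Prop :=
  Aᵀ = A ∧ ∀ g : ι → ℝ, c * (g ⬝ᵥ g) ≤ g ⬝ᵥ (A *ᵥ g)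

theorem quadratic_add_vecMulVec (A : Matrix ι ι ℝ) (x g : ι → ℝ) :
    g ⬝ᵥ ((A + vecMulVec x x) *ᵥ g) = g ⬝ᵥ (A *ᵥ g) + (x ⬝ᵥ g) ^ 2 := by
  rw [add_mulVec, dotProduct_add, vecMulVec_mulVec, dotProduct_smul, dotProduct_comm g x, sq]
  rfl

theorem SymmGE.add_vecMulVec {A : Matrix ι ι ℝ} {c : ℝ} (hA : SymmGE A c) (x : ι → ℝ) :
    SymmGE (A + vecMulVec x x) c := by
  refine ⟨by rw [transpose_add, hA.1, transpose_vecMulVec], fun g => ?_⟩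
  rw [quadratic_add_vecMulVec]
  exact (hA.2 g).trans (le_add_of_nonneg_right (sq_nonneg _))

theorem quadratic_add_sum_vecMulVec (A : Matrix ι ι ℝ) {m : ℕ} (z : Fin m → ι → ℝ) (g : ι → ℝ) :
    g ⬝ᵥ ((A + ∑ j, vecMulVec (z j) (z j)) *ᵥ g)
      = g ⬝ᵥ (A *ᵥ g) + ∑ j, (z j ⬝ᵥ g) ^ 2 := by
  induction m with
  | zero => simp
  | succ m ih =>
    rw [Fin.sum_univ_castSucc, ← add_assoc, quadratic_add_vecMulVec, ih, Fin.sum_univ_castSucc,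
      add_assoc]

theorem SymmGE.add_sum_vecMulVec {A : Matrix ι ι ℝ} {c : ℝ} (hA : SymmGE A c) {m : ℕ}
    (z : Fin m → ι → ℝ) : SymmGE (A + ∑ j, vecMulVec (z j) (z j)) c := by
  induction m with
  | zero => simpa using hA
  | succ m ih =>
    rw [Fin.sum_univ_castSucc, ← add_assoc]
    exact (ih fun j => z j.castSucc).add_vecMulVec _

variable [DecidableEq ι]

theorem exists_orthogonal_diagonalization {A : Matrix ι ι ℝ} (hA : Aᵀ = A) :
    ∃ (U : Matrix ι ι ℝ) (α : ι → ℝ), U * Uᵀ = 1 ∧ Uᵀ * U = 1 ∧ A = U * diagonal α * Uᵀ := by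
  have hH : A.IsHermitian := by rw [IsHermitian, conjTranspose_eq_transpose_of_trivial, hA]
  refine ⟨hH.eigenvectorUnitary, hH.eigenvalues, ?_, ?_, ?_⟩
  · have hU := Unitary.coe_mul_star_self hH.eigenvectorUnitary
    rwa [Unitary.coe_star, star_eq_conjTranspose, conjTranspose_eq_transpose_of_trivial] at hU
  · have hU := Unitary.coe_star_mul_self hH.eigenvectorUnitary
    rwa [star_eq_conjTranspose, conjTranspose_eq_transpose_of_trivial] at hU
  · have hspec := hH.spectral_theorem
    rwa [Unitary.conjStarAlgAut_apply, star_eq_conjTranspose,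
      conjTranspose_eq_transpose_of_trivial] at hspec

theorem quadratic_conj_diagonal (U : Matrix ι ι ℝ) (α : ι → ℝ) (x : ι → ℝ) :
    x ⬝ᵥ ((U * diagonal α * Uᵀ) *ᵥ x) = ∑ k, (Uᵀ *ᵥ x) k ^ 2 * α k := by
  rw [← mulVec_mulVec, ← mulVec_mulVec, dotProduct_mulVec, ← mulVec_transpose, dotProduct]
  refine Finset.sum_congr rfl fun k _ => ?_
  rw [mulVec_diagonal]
  ring

theorem trace_conj_diagonal {U : Matrix ι ι ℝ} (hU : Uᵀ * U = 1) (β : ι → ℝ) :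
    (U * diagonal β * Uᵀ).trace = ∑ k, β k := by
  rw [trace_mul_comm, ← Matrix.mul_assoc, hU, Matrix.one_mul, trace_diagonal]

theorem conj_diagonal_apply_self (U : Matrix ι ι ℝ) (β : ι → ℝ) (i : ι) :
    (U * diagonal β * Uᵀ) i i = ∑ k, U i k ^ 2 * β k := by
  rw [mul_apply]
  refine Finset.sum_congr rfl fun k _ => ?_
  rw [mul_diagonal, transpose_apply]
  ring

theorem conj_diagonal_mul_conj_diagonal {U : Matrix ι ι ℝ} (hU : Uᵀ * U = 1) (α β : ι → ℝ) :
    U * diagonal α * Uᵀ * (U * diagonal β * Uᵀ) = U * diagonal (fun k => α k * β k) * Uᵀ := by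
  rw [← diagonal_mul_diagonal]
  calc U * diagonal α * Uᵀ * (U * diagonal β * Uᵀ)
      = U * diagonal α * (Uᵀ * U) * diagonal β * Uᵀ := by simp only [Matrix.mul_assoc]
    _ = U * (diagonal α * diagonal β) * Uᵀ := by rw [hU, Matrix.mul_one, Matrix.mul_assoc U]

theorem conj_diagonal_pow {U : Matrix ι ι ℝ} (hU : U * Uᵀ = 1) (hU' : Uᵀ * U = 1) (β : ι → ℝ)
    (j : ℕ) : (U * diagonal β * Uᵀ) ^ j = U * diagonal (fun k => β k ^ j) * Uᵀ := by
  induction j with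
  | zero => simp [hU]
  | succ j ih => simp only [pow_succ, ih, conj_diagonal_mul_conj_diagonal hU']

namespace SymmGE

variable {A : Matrix ι ι ℝ} {c : ℝ}

theorem exists_inv_pow_eq (hA : SymmGE A c) (hc : 0 < c) :
    ∃ (U : Matrix ι ι ℝ) (β : ι → ℝ), Uᵀ * U = 1 ∧ U * Uᵀ = 1 ∧ (∀ k, 0 < β k ∧ c * β k ≤ 1) ∧
      A = U * diagonal (fun k => (β k)⁻¹) * Uᵀ ∧
      ∀ j : ℕ, A⁻¹ ^ j = U * diagonal (fun k => β k ^ j) * Uᵀ := by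
  obtain ⟨U, α, hU, hU', hAU⟩ := exists_orthogonal_diagonalization hA.1
  have hcα : ∀ k, c ≤ α k := by
    intro k
    have hcol := hA.2 (U *ᵥ Pi.single k 1)
    rw [hAU, quadratic_conj_diagonal, mulVec_mulVec, hU', one_mulVec, dotProduct_mulVec,
      ← mulVec_transpose, mulVec_mulVec, hU', one_mulVec] at hcol
    simpa [Pi.single_apply] using hcol
  have hα : ∀ k, 0 < α k := fun k => hc.trans_le (hcα k)
  have hinv : A⁻¹ = U * diagonal (fun k => (α k)⁻¹) * Uᵀ := by
    refine inv_eq_right_inv ?_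
    rw [hAU, conj_diagonal_mul_conj_diagonal hU']
    simp [(hα _).ne', hU]
  refine ⟨U, fun k => (α k)⁻¹, hU', hU, fun k => ⟨inv_pos.2 (hα k), ?_⟩, ?_, fun j => ?_⟩
  · rw [← div_eq_mul_inv, div_le_one (hα k)]
    exact hcα k
  · simpa only [inv_inv] using hAU
  · rw [hinv, conj_diagonal_pow hU hU']

theorem exists_inv_eq (hA : SymmGE A c) (hc : 0 < c) :
    ∃ (U : Matrix ι ι ℝ) (β : ι → ℝ), U * Uᵀ = 1 ∧ (∀ k, 0 < β k ∧ c * β k ≤ 1) ∧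
      A⁻¹ = U * diagonal β * Uᵀ := by
  obtain ⟨U, β, -, hU, hβ, -, hpow⟩ := hA.exists_inv_pow_eq hc
  exact ⟨U, β, hU, hβ, by simpa only [pow_one] using hpow 1⟩

theorem mul_inv (hA : SymmGE A c) (hc : 0 < c) : A * A⁻¹ = 1 := by
  obtain ⟨U, β, hU', hU, hβ, hAU, hpow⟩ := hA.exists_inv_pow_eq hc
  rw [← pow_one A⁻¹, hpow, hAU, conj_diagonal_mul_conj_diagonal hU']
  simp [(hβ _).1.ne', hU]

theorem inv_transpose (hA : SymmGE A c) : (A⁻¹)ᵀ = A⁻¹ := by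
  rw [transpose_nonsing_inv, hA.1]

theorem quadratic_inv_pow_nonneg (hA : SymmGE A c) (hc : 0 < c) (x : ι → ℝ) (j : ℕ) :
    0 ≤ x ⬝ᵥ ((A⁻¹ ^ j) *ᵥ x) := by
  obtain ⟨U, β, -, -, hβ, -, hpow⟩ := hA.exists_inv_pow_eq hc
  rw [hpow, quadratic_conj_diagonal]
  exact Finset.sum_nonneg fun k _ => mul_nonneg (sq_nonneg _) (pow_nonneg (hβ k).1.le j)

theorem quadratic_inv_nonneg (hA : SymmGE A c) (hc : 0 < c) (x : ι → ℝ) :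
    0 ≤ x ⬝ᵥ (A⁻¹ *ᵥ x) := by
  simpa only [pow_one] using hA.quadratic_inv_pow_nonneg hc x 1

theorem quadratic_inv_le (hA : SymmGE A c) (hc : 0 < c) (x : ι → ℝ) :
    c * (x ⬝ᵥ (A⁻¹ *ᵥ x)) ≤ x ⬝ᵥ x := by
  obtain ⟨U, β, hU, hβ, hinv⟩ := hA.exists_inv_eq hc
  have hnorm : x ⬝ᵥ x = ∑ k, (Uᵀ *ᵥ x) k ^ 2 * 1 := by
    rw [← quadratic_conj_diagonal U (fun _ => 1) x]
    simp [hU]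
  rw [hinv, quadratic_conj_diagonal, hnorm, Finset.mul_sum]
  refine Finset.sum_le_sum fun k _ => ?_
  rw [mul_left_comm]
  exact mul_le_mul_of_nonneg_left (hβ k).2 (sq_nonneg _)

/-- Chebyshev's sum inequality for the spectral measure of `A⁻¹` at `x`, weighted by the
eigenvalue. -/
theorem quadratic_inv_pow_mul_le (hA : SymmGE A c) (hc : 0 < c) (x : ι → ℝ) (i j : ℕ) :
    (x ⬝ᵥ ((A⁻¹ ^ (i + 1)) *ᵥ x)) * (x ⬝ᵥ ((A⁻¹ ^ (j + 1)) *ᵥ x))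
      ≤ (x ⬝ᵥ (A⁻¹ *ᵥ x)) * (x ⬝ᵥ ((A⁻¹ ^ (i + j + 1)) *ᵥ x)) := by
  obtain ⟨U, β, -, -, hβ, -, hpow⟩ := hA.exists_inv_pow_eq hc
  nth_rw 3 [← pow_one A⁻¹]
  simp only [hpow, quadratic_conj_diagonal, pow_one]
  set w : ι → ℝ := fun k => (Uᵀ *ᵥ x) k ^ 2
  have hnonneg :
      0 ≤ ∑ k, ∑ l, w k * w l * β k * β l * ((β k ^ i - β l ^ i) * (β k ^ j - β l ^ j)) := by
    refine Finset.sum_nonneg fun k _ => Finset.sum_nonneg fun l _ => ?_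
    have hk := (hβ k).1.le
    have hl := (hβ l).1.le
    refine mul_nonneg (by positivity) ?_
    rcases le_total (β k) (β l) with h | h
    · exact mul_nonneg_of_nonpos_of_nonpos (sub_nonpos.2 (pow_le_pow_left₀ hk h i))
        (sub_nonpos.2 (pow_le_pow_left₀ hk h j))
    · exact mul_nonneg (sub_nonneg.2 (pow_le_pow_left₀ hl h i))
        (sub_nonneg.2 (pow_le_pow_left₀ hl h j))
  have hterm : ∀ k l, w k * w l * β k * β l * ((β k ^ i - β l ^ i) * (β k ^ j - β l ^ j))
      = (w k * β k ^ (i + j + 1)) * (w l * β l) + (w k * β k) * (w l * β l ^ (i + j + 1))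
        - (w k * β k ^ (i + 1)) * (w l * β l ^ (j + 1))
        - (w k * β k ^ (j + 1)) * (w l * β l ^ (i + 1)) := fun k l => by ring
  simp only [hterm, Finset.sum_sub_distrib, Finset.sum_add_distrib, ← Finset.sum_mul_sum]
    at hnonneg
  linarith

theorem inv_add_vecMulVec (hA : SymmGE A c) (hc : 0 < c) (x : ι → ℝ) :
    (A + vecMulVec x x)⁻¹
      = A⁻¹ - (1 + x ⬝ᵥ (A⁻¹ *ᵥ x))⁻¹ • vecMulVec (A⁻¹ *ᵥ x) (A⁻¹ *ᵥ x) := by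
  have hr := hA.quadratic_inv_nonneg hc x
  have hinv := hA.mul_inv hc
  set r := x ⬝ᵥ (A⁻¹ *ᵥ x) with hr_def
  have hA_mul : A * vecMulVec (A⁻¹ *ᵥ x) (A⁻¹ *ᵥ x) = vecMulVec x (A⁻¹ *ᵥ x) := by
    rw [mul_vecMulVec, mulVec_mulVec, hinv, one_mulVec]
  have hx_mul : vecMulVec x x * A⁻¹ = vecMulVec x (A⁻¹ *ᵥ x) := by
    rw [vecMulVec_mul, ← mulVec_transpose, hA.inv_transpose]
  have hx_mul' :
      vecMulVec x x * vecMulVec (A⁻¹ *ᵥ x) (A⁻¹ *ᵥ x) = r • vecMulVec x (A⁻¹ *ᵥ x) := by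
    ext i j
    rw [vecMulVec_mul_vecMulVec]
    simp only [vecMulVec_apply, Pi.smul_apply, smul_eq_mul, Matrix.smul_apply]
    rw [hr_def]
    ring
  have hcoeff : (1 + r)⁻¹ * r = 1 - (1 + r)⁻¹ := by field_simp; ring
  refine inv_eq_right_inv ?_
  rw [add_mul, mul_sub, mul_sub, hinv, mul_smul_comm, mul_smul_comm, hA_mul, hx_mul, hx_mul',
    smul_smul, hcoeff, sub_smul, one_smul]
  abel

end SymmGE

section RankOnePerturbation

variable {B B' : Matrix ι ι ℝ} {y : ι → ℝ} {ρ : ℝ}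

theorem trace_pow_sub_trace_pow (hB : B' = B - ρ • vecMulVec y y) (p : ℕ) :
    (B ^ p).trace - (B' ^ p).trace
      = ∑ b ∈ Finset.range p, ρ * (y ⬝ᵥ ((B ^ (p - 1 - b) * B' ^ b) *ᵥ y)) := by
  have hdiff : B - B' = ρ • vecMulVec y y := by rw [hB]; abel
  have hstep : ∀ b ∈ Finset.range p, ρ * (y ⬝ᵥ ((B ^ (p - 1 - b) * B' ^ b) *ᵥ y))
      = (B' ^ b * B ^ (p - b)).trace - (B' ^ (b + 1) * B ^ (p - (b + 1))).trace := by
    intro b hb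
    obtain ⟨a, rfl⟩ := Nat.exists_eq_add_of_lt (Finset.mem_range.1 hb)
    rw [show b + a + 1 - 1 - b = a by omega, show b + a + 1 - b = a + 1 by omega,
      show b + a + 1 - (b + 1) = a by omega, ← trace_sub, pow_succ' B, pow_succ B',
      ← Matrix.mul_assoc, ← sub_mul, ← mul_sub, hdiff, mul_smul_comm, smul_mul_assoc, trace_smul,
      mul_vecMulVec, vecMulVec_mul, trace_vecMulVec, smul_eq_mul,
      dotProduct_comm (B' ^ b *ᵥ y), ← dotProduct_mulVec, mulVec_mulVec]
  rw [Finset.sum_congr rfl hstep, Finset.sum_range_sub']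
  simp

theorem dotProduct_pow_mul_pow_succ (hB : B' = B - ρ • vecMulVec y y) (a b : ℕ) :
    y ⬝ᵥ ((B ^ a * B' ^ (b + 1)) *ᵥ y) = y ⬝ᵥ ((B ^ (a + 1) * B' ^ b) *ᵥ y)
      - ρ * ((y ⬝ᵥ ((B ^ a) *ᵥ y)) * (y ⬝ᵥ ((B' ^ b) *ᵥ y))) := by
  have hsplit : B ^ a * B' ^ (b + 1)
      = B ^ (a + 1) * B' ^ b - ρ • (B ^ a * vecMulVec y y * B' ^ b) := by
    calc B ^ a * B' ^ (b + 1) = B ^ a * (B - ρ • vecMulVec y y) * B' ^ b := by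
          rw [pow_succ', ← hB, Matrix.mul_assoc]
      _ = _ := by rw [mul_sub, sub_mul, ← pow_succ, mul_smul_comm, smul_mul_assoc]
  rw [hsplit, sub_mulVec, dotProduct_sub, smul_mulVec, dotProduct_smul, mul_vecMulVec,
    vecMulVec_mul, vecMulVec_mulVec, dotProduct_smul, ← dotProduct_mulVec]
  rfl

theorem dotProduct_pow_mul_pow_le (hB : B' = B - ρ • vecMulVec y y) (hρ : 0 ≤ ρ)
    (hy : ∀ a, 0 ≤ y ⬝ᵥ ((B ^ a) *ᵥ y)) (hy' : ∀ b, 0 ≤ y ⬝ᵥ ((B' ^ b) *ᵥ y)) (a b : ℕ) :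
    y ⬝ᵥ ((B ^ a * B' ^ b) *ᵥ y) ≤ y ⬝ᵥ ((B ^ (a + b)) *ᵥ y) := by
  induction b generalizing a with
  | zero => simp
  | succ b ih =>
    rw [dotProduct_pow_mul_pow_succ hB, add_comm b 1, ← add_assoc]
    exact (sub_le_self _ (mul_nonneg hρ (mul_nonneg (hy a) (hy' b)))).trans (ih (a + 1))

theorem le_dotProduct_pow_mul_pow (hB : B' = B - ρ • vecMulVec y y) (hρ : 0 ≤ ρ) (hρ1 : ρ ≤ 1)
    (hy : ∀ a, 0 ≤ y ⬝ᵥ ((B ^ a) *ᵥ y)) (hy' : ∀ b, 0 ≤ y ⬝ᵥ ((B' ^ b) *ᵥ y)) {r : ℝ}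
    (hr : ∀ i j, (y ⬝ᵥ ((B ^ i) *ᵥ y)) * (y ⬝ᵥ ((B ^ j) *ᵥ y))
      ≤ r * (y ⬝ᵥ ((B ^ (i + j + 1)) *ᵥ y))) (a b : ℕ) :
    (1 - r * b) * (y ⬝ᵥ ((B ^ (a + b)) *ᵥ y)) ≤ y ⬝ᵥ ((B ^ a * B' ^ b) *ᵥ y) := by
  induction b generalizing a with
  | zero => simp
  | succ b ih =>
    have hb : y ⬝ᵥ ((B' ^ b) *ᵥ y) ≤ y ⬝ᵥ ((B ^ b) *ᵥ y) := by
      simpa using dotProduct_pow_mul_pow_le hB hρ hy hy' 0 b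
    have hloss : ρ * ((y ⬝ᵥ ((B ^ a) *ᵥ y)) * (y ⬝ᵥ ((B' ^ b) *ᵥ y)))
        ≤ r * (y ⬝ᵥ ((B ^ (a + b + 1)) *ᵥ y)) :=
      (mul_le_of_le_one_left (mul_nonneg (hy a) (hy' b)) hρ1).trans
        ((mul_le_mul_of_nonneg_left hb (hy a)).trans (hr a b))
    have hprev := ih (a + 1)
    rw [dotProduct_pow_mul_pow_succ hB, ← add_assoc]
    rw [add_right_comm] at hprev
    push_cast
    linarith

end RankOnePerturbation

theorem SymmGE.trace_inv_pow_add_vecMulVec_le {A : Matrix ι ι ℝ} {c : ℝ} (hA : SymmGE A c)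
    (hc : 0 < c) (x : ι → ℝ) {p : ℕ} (hp : 1 ≤ p) (hxp : 2 * p * (x ⬝ᵥ x) ≤ c) :
    ((A + vecMulVec x x)⁻¹ ^ p).trace
      ≤ (A⁻¹ ^ p).trace - p / 4 * (x ⬝ᵥ ((A⁻¹ ^ (p + 1)) *ᵥ x)) := by
  have hp' : (1 : ℝ) ≤ p := by exact_mod_cast hp
  have hr := hA.quadratic_inv_nonneg hc x
  have hSM := hA.inv_add_vecMulVec hc x
  set r := x ⬝ᵥ (A⁻¹ *ᵥ x)
  set y := A⁻¹ *ᵥ x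
  set ρ := (1 + r)⁻¹ with hρ_def
  have hrp : 2 * p * r ≤ 1 := by
    have hcr := hA.quadratic_inv_le hc x
    exact le_of_mul_le_mul_left (by nlinarith) hc
  have hρ : 1 / 2 ≤ ρ := by
    rw [hρ_def, ← one_div]
    exact one_div_le_one_div_of_le (by positivity) (by nlinarith)
  have hρ1 : ρ ≤ 1 := inv_le_one_of_one_le₀ (by linarith)
  have hmoment : ∀ j, y ⬝ᵥ ((A⁻¹ ^ j) *ᵥ y) = x ⬝ᵥ ((A⁻¹ ^ (j + 2)) *ᵥ x) := by
    intro j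
    rw [pow_succ' _ (j + 1), pow_succ, ← mulVec_mulVec, ← mulVec_mulVec, dotProduct_mulVec x,
      ← mulVec_transpose, hA.inv_transpose]
  have hmul : ∀ i j, (y ⬝ᵥ ((A⁻¹ ^ i) *ᵥ y)) * (y ⬝ᵥ ((A⁻¹ ^ j) *ᵥ y))
      ≤ r * (y ⬝ᵥ ((A⁻¹ ^ (i + j + 1)) *ᵥ y)) := by
    intro i j
    simp only [hmoment]
    convert hA.quadratic_inv_pow_mul_le hc x (i + 1) (j + 1) using 5
    ring
  have hy := hA.quadratic_inv_pow_nonneg hc y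
  have hterm : ∀ b ∈ Finset.range p, 1 / 4 * (x ⬝ᵥ ((A⁻¹ ^ (p + 1)) *ᵥ x))
      ≤ ρ * (y ⬝ᵥ ((A⁻¹ ^ (p - 1 - b) * (A + vecMulVec x x)⁻¹ ^ b) *ᵥ y)) := by
    intro b hb
    have hbp := Finset.mem_range.1 hb
    have hlower := le_dotProduct_pow_mul_pow hSM (by linarith) hρ1 hy
      ((hA.add_vecMulVec x).quadratic_inv_pow_nonneg hc y) hmul (p - 1 - b) b
    rw [hmoment, show p - 1 - b + b + 2 = p + 1 by omega] at hlower
    have hrb : r * b ≤ 1 / 2 := by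
      have : (b : ℝ) ≤ p := by exact_mod_cast hbp.le
      nlinarith
    have hpos := hA.quadratic_inv_pow_nonneg hc x (p + 1)
    have hhalf := (mul_le_mul_of_nonneg_right (by linarith : 1 / 2 ≤ 1 - r * b) hpos).trans hlower
    nlinarith
  have hsum := Finset.card_nsmul_le_sum _ _ _ hterm
  rw [← trace_pow_sub_trace_pow hSM, Finset.card_range, nsmul_eq_mul] at hsum
  linarith

namespace SymmGE

variable {A : Matrix ι ι ℝ} {c : ℝ}

theorem trace_inv_pow_nonneg (hA : SymmGE A c) (hc : 0 < c) (p : ℕ) : 0 ≤ (A⁻¹ ^ p).trace := by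
  obtain ⟨U, β, hU, -, hβ, -, hpow⟩ := hA.exists_inv_pow_eq hc
  rw [hpow, trace_conj_diagonal hU]
  exact Finset.sum_nonneg fun k _ => pow_nonneg (hβ k).1.le _

theorem trace_inv_pow_le (hA : SymmGE A c) (hc : 0 < c) (p : ℕ) :
    (A⁻¹ ^ p).trace ≤ Fintype.card ι * (1 / c) ^ p := by
  obtain ⟨U, β, hU, -, hβ, -, hpow⟩ := hA.exists_inv_pow_eq hc
  rw [hpow, trace_conj_diagonal hU, ← nsmul_eq_mul]
  refine Finset.sum_le_card_nsmul _ _ _ fun k _ => pow_le_pow_left₀ (hβ k).1.le ?_ p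
  rw [le_div_iff₀ hc, mul_comm]
  exact (hβ k).2

theorem sum_mul_inv_pow_le (hA : SymmGE A c) (hc : 0 < c) {w : ι → ℝ}
    (hw : ∀ g : ι → ℝ, ∑ i, w i * g i ^ 2 ≤ g ⬝ᵥ (A *ᵥ g)) (p : ℕ) :
    ∑ i, w i * (A⁻¹ ^ (p + 1)) i i ≤ (A⁻¹ ^ p).trace := by
  obtain ⟨U, β, hU, -, hβ, hAU, hpow⟩ := hA.exists_inv_pow_eq hc
  have hcol : ∀ k, ∑ i, w i * U i k ^ 2 ≤ (β k)⁻¹ := by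
    intro k
    have hwk := hw (U *ᵥ Pi.single k 1)
    rw [hAU, quadratic_conj_diagonal, mulVec_mulVec, hU, one_mulVec] at hwk
    simpa [Pi.single_apply] using hwk
  rw [hpow, hpow, trace_conj_diagonal hU]
  simp only [conj_diagonal_apply_self, Finset.mul_sum]
  rw [Finset.sum_comm]
  refine Finset.sum_le_sum fun k _ => ?_
  calc ∑ i, w i * (U i k ^ 2 * β k ^ (p + 1)) = (∑ i, w i * U i k ^ 2) * β k ^ (p + 1) := by
        simp only [Finset.sum_mul, mul_assoc]
    _ ≤ (β k)⁻¹ * β k ^ (p + 1) :=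
        mul_le_mul_of_nonneg_right (hcol k) (pow_nonneg (hβ k).1.le _)
    _ = β k ^ p := by rw [pow_succ', inv_mul_cancel_left₀ (hβ k).1.ne']

theorem le_trace_inv_pow_succ (hA : SymmGE A c) (hc : 0 < c) (p : ℕ) {t : ℝ} (ht : 0 ≤ t) :
    t * (A⁻¹ ^ p).trace - Fintype.card ι * t ^ (p + 1) ≤ (A⁻¹ ^ (p + 1)).trace := by
  obtain ⟨U, β, hU, -, hβ, -, hpow⟩ := hA.exists_inv_pow_eq hc
  rw [hpow, hpow, trace_conj_diagonal hU, trace_conj_diagonal hU, Finset.mul_sum, ← nsmul_eq_mul,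
    ← Finset.card_univ, ← Finset.sum_const, ← Finset.sum_sub_distrib]
  refine Finset.sum_le_sum fun k _ => ?_
  have hk := (hβ k).1.le
  rw [pow_succ, pow_succ]
  rcases le_total t (β k) with h | h
  · have hle : t * β k ^ p ≤ β k ^ p * β k := by
      rw [mul_comm]; exact mul_le_mul_of_nonneg_left h (pow_nonneg hk p)
    have hpos : 0 ≤ t ^ p * t := by positivity
    linarith
  · have hle : β k ^ p * (t - β k) ≤ t ^ p * t :=
      mul_le_mul (pow_le_pow_left₀ hk h p) (by linarith) (by linarith) (by positivity)
    linarith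

theorem le_trace_inv_pow (hA : SymmGE A c) (hc : 0 < c) {c' : ℝ} (hc' : 0 < c') {g : ι → ℝ}
    (hg : g ⬝ᵥ (A *ᵥ g) < c' * (g ⬝ᵥ g)) (p : ℕ) : (1 / c') ^ p ≤ (A⁻¹ ^ p).trace := by
  obtain ⟨U, β, hU, hU', hβ, hAU, hpow⟩ := hA.exists_inv_pow_eq hc
  have hnorm : g ⬝ᵥ g = ∑ k, (Uᵀ *ᵥ g) k ^ 2 * 1 := by
    rw [← quadratic_conj_diagonal U (fun _ => 1) g]
    simp [hU']
  rw [hnorm, hAU, quadratic_conj_diagonal, Finset.mul_sum] at hg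
  obtain ⟨k, -, hk⟩ := Finset.exists_lt_of_sum_lt hg
  rw [mul_left_comm, mul_one] at hk
  have hβk : 1 / c' ≤ β k := by
    rw [one_div]
    exact (inv_le_comm₀ (hβ k).1 hc').1 (lt_of_mul_lt_mul_left hk (sq_nonneg _)).le
  rw [hpow, trace_conj_diagonal hU]
  exact (pow_le_pow_left₀ (by positivity) hβk p).trans
    (Finset.single_le_sum (f := fun k => β k ^ p) (fun k _ => pow_nonneg (hβ k).1.le p)
      (Finset.mem_univ k))

end SymmGE

end MatrixTail

/-! ### Lower tail of a random Gram matrix -/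

section LowerTail

open Matrix

theorem lintegral_pi_fin_succ_le {Ω : Type*} [MeasurableSpace Ω] (ν : Measure Ω) [SigmaFinite ν]
    {k : ℕ} (G : Ω → (Fin k → Ω) → ℝ≥0∞) :
    ∫⁻ ω : Fin (k + 1) → Ω, G (ω 0) (fun j => ω j.succ) ∂(Measure.pi fun _ => ν)
      ≤ ∫⁻ a, ∫⁻ ω, G a ω ∂(Measure.pi fun _ => ν) ∂ν := by
  have hmp := measurePreserving_piFinSuccAbove (fun _ : Fin (k + 1) => ν) 0
  refine le_of_eq_of_le ?_ (lintegral_prod_le fun q : Ω × (Fin k → Ω) => G q.1 q.2)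
  exact hmp.lintegral_comp_emb (MeasurableEquiv.measurableEmbedding _) fun q => G q.1 q.2

variable {ι : Type*} [Fintype ι]

theorem dotProduct_mulVec_eq_sum (M : Matrix ι ι ℝ) (y : ι → ℝ) :
    y ⬝ᵥ (M *ᵥ y) = ∑ i, ∑ j, M i j * (y i * y j) := by
  simp only [dotProduct, mulVec, Finset.mul_sum]
  exact Finset.sum_congr rfl fun i _ => Finset.sum_congr rfl fun j _ => by ring

variable [DecidableEq ι]

theorem quadratic_diagonal_const_add (c : ℝ) (w g : ι → ℝ) :
    g ⬝ᵥ (diagonal (fun i => c + w i) *ᵥ g) = c * (g ⬝ᵥ g) + ∑ i, w i * g i ^ 2 := by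
  rw [dotProduct, dotProduct, Finset.mul_sum, ← Finset.sum_add_distrib]
  refine Finset.sum_congr rfl fun i _ => ?_
  rw [mulVec_diagonal]
  ring

theorem symmGE_diagonal_const_add (c : ℝ) {w : ι → ℝ} (hw : ∀ i, 0 ≤ w i) :
    SymmGE (diagonal fun i => c + w i) c := by
  refine ⟨diagonal_transpose _, fun g => ?_⟩
  rw [quadratic_diagonal_const_add]
  exact le_add_of_nonneg_right
    (Finset.sum_nonneg fun i _ => mul_nonneg (hw i) (sq_nonneg _))

theorem SymmGE.continuous_trace_inv_pow {A : Matrix ι ι ℝ} {c : ℝ} (hA : SymmGE A c) (hc : 0 < c)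
    (m p : ℕ) : Continuous fun z : Fin m → ι → ℝ =>
      ((A + ∑ j, vecMulVec (z j) (z j))⁻¹ ^ p).trace := by
  have hsum : Continuous fun z : Fin m → ι → ℝ => A + ∑ j, vecMulVec (z j) (z j) :=
    continuous_const.add (continuous_finsetSum _ fun j _ =>
      (continuous_apply j).matrix_vecMulVec (continuous_apply j))
  have hdet : ∀ z : Fin m → ι → ℝ, (A + ∑ j, vecMulVec (z j) (z j)).det ≠ 0 := by
    intro z hz
    have hone := congrArg Matrix.det ((hA.add_sum_vecMulVec z).mul_inv hc)
    rw [det_mul, hz, zero_mul, det_one] at hone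
    exact zero_ne_one hone
  have hinv : Continuous fun z : Fin m → ι → ℝ => (A + ∑ j, vecMulVec (z j) (z j))⁻¹ := by
    simp only [inv_def, Ring.inverse_eq_inv']
    exact (hsum.matrix_det.inv₀ hdet).smul hsum.matrix_adjugate
  exact (hinv.pow p).matrix_trace

variable {Ω : Type*} [MeasurableSpace Ω]

/-- A bounded random vector `x` whose second moment matrix is diagonal with entries `1 - d i`: the
coordinates of `φ(X)` in an eigenbasis of `Σ`, scaled by `(Σ + λ)^(-1/2)`, are of this kind. -/
structure WhitenedVector (ν : Measure Ω) (x : Ω → ι → ℝ) (d : ι → ℝ) (b : ℝ) : Prop where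
  measurable : Measurable x
  dotProduct_le : ∀ ω, x ω ⬝ᵥ x ω ≤ b
  integral_mul : ∀ i j, ∫ ω, x ω i * x ω j ∂ν = if i = j then 1 - d i else 0

namespace WhitenedVector

variable {ν : Measure Ω} {x : Ω → ι → ℝ} {d : ι → ℝ} {b : ℝ}

theorem sq_le (hx : WhitenedVector ν x d b) (ω : Ω) (i : ι) : x ω i ^ 2 ≤ b := by
  refine le_trans ?_ (hx.dotProduct_le ω)
  rw [dotProduct, sq]
  exact Finset.single_le_sum (f := fun i => x ω i * x ω i) (fun i _ => mul_self_nonneg _)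
    (Finset.mem_univ i)

variable [IsProbabilityMeasure ν]

theorem integrable_mul (hx : WhitenedVector ν x d b) (i j : ι) :
    Integrable (fun ω => x ω i * x ω j) ν := by
  have hi : Measurable fun ω => x ω i := (measurable_pi_apply i).comp hx.measurable
  have hj : Measurable fun ω => x ω j := (measurable_pi_apply j).comp hx.measurable
  refine Integrable.of_bound (hi.mul hj).aestronglyMeasurable b
    (Filter.Eventually.of_forall fun ω => ?_)
  rw [Real.norm_eq_abs, abs_le]
  constructor <;> nlinarith [hx.sq_le ω i, hx.sq_le ω j, sq_nonneg (x ω i + x ω j),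
    sq_nonneg (x ω i - x ω j)]

theorem integrable_quadratic (hx : WhitenedVector ν x d b) (M : Matrix ι ι ℝ) :
    Integrable (fun ω => x ω ⬝ᵥ (M *ᵥ x ω)) ν := by
  simp only [dotProduct_mulVec_eq_sum]
  exact integrable_finsetSum _ fun i _ => integrable_finsetSum _ fun j _ =>
    (hx.integrable_mul i j).const_mul _

theorem integral_quadratic (hx : WhitenedVector ν x d b) (M : Matrix ι ι ℝ) :
    ∫ ω, x ω ⬝ᵥ (M *ᵥ x ω) ∂ν = M.trace - ∑ i, d i * M i i := by
  have hint : ∀ i j, Integrable (fun ω => M i j * (x ω i * x ω j)) ν := fun i j =>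
    (hx.integrable_mul i j).const_mul _
  simp only [dotProduct_mulVec_eq_sum]
  rw [integral_finsetSum _ fun i _ => integrable_finsetSum _ fun j _ => hint i j, trace,
    ← Finset.sum_sub_distrib]
  refine Finset.sum_congr rfl fun i _ => ?_
  rw [integral_finsetSum _ fun j _ => hint i j]
  simp only [integral_const_mul, hx.integral_mul, mul_ite, mul_zero, Finset.sum_ite_eq,
    Finset.mem_univ, if_true, diag_apply]
  ring

theorem lintegral_trace_inv_pow_add_le (hx : WhitenedVector ν x d b) {A : Matrix ι ι ℝ} {c : ℝ}
    (hA : SymmGE A c) (hc : 0 < c) {m p : ℕ} (hm : 0 < m)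
    (hAd : ∀ g : ι → ℝ, ∑ i, m * d i * g i ^ 2 ≤ g ⬝ᵥ (A *ᵥ g)) (hp : 1 ≤ p)
    (hb : 2 * p * b ≤ c) :
    ∫⁻ ω, ENNReal.ofReal ((A + vecMulVec (x ω) (x ω))⁻¹ ^ p).trace ∂ν ≤
      ENNReal.ofReal ((1 - 15 * p / (4 * m)) * (A⁻¹ ^ p).trace
        + 15 * p / (4 * m) * (2 * Fintype.card ι * (16 / m) ^ p)) := by
  have hm' : (0 : ℝ) < m := by exact_mod_cast hm
  have hle : ∀ ω, ((A + vecMulVec (x ω) (x ω))⁻¹ ^ p).trace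
      ≤ (A⁻¹ ^ p).trace - p / 4 * (x ω ⬝ᵥ ((A⁻¹ ^ (p + 1)) *ᵥ x ω)) := fun ω =>
    hA.trace_inv_pow_add_vecMulVec_le hc (x ω) hp
      ((mul_le_mul_of_nonneg_left (hx.dotProduct_le ω) (by positivity)).trans hb)
  have hint := (hx.integrable_quadratic (A⁻¹ ^ (p + 1))).const_mul (p / 4 : ℝ)
  have hint' : Integrable (fun ω => (A⁻¹ ^ p).trace
      - p / 4 * (x ω ⬝ᵥ ((A⁻¹ ^ (p + 1)) *ᵥ x ω))) ν := (integrable_const _).sub hint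
  refine (lintegral_mono fun ω => ENNReal.ofReal_le_ofReal (hle ω)).trans ?_
  rw [← ofReal_integral_eq_lintegral_ofReal hint'
    (Filter.Eventually.of_forall fun ω =>
      ((hA.add_vecMulVec (x ω)).trace_inv_pow_nonneg hc p).trans (hle ω))]
  refine ENNReal.ofReal_le_ofReal ?_
  rw [integral_sub (integrable_const _) hint, integral_const_mul, hx.integral_quadratic,
    integral_const, probReal_univ, one_smul]
  have hweights : ∑ i, d i * (A⁻¹ ^ (p + 1)) i i ≤ (A⁻¹ ^ p).trace / m := by
    have hsum := hA.sum_mul_inv_pow_le hc hAd p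
    simp only [mul_assoc, ← Finset.mul_sum] at hsum
    rwa [le_div_iff₀ hm', mul_comm]
  have htrace := hA.le_trace_inv_pow_succ hc p (t := 16 / m) (by positivity)
  have hdecrease := mul_le_mul_of_nonneg_left (sub_le_sub htrace hweights)
    (by positivity : (0 : ℝ) ≤ p / 4)
  have hslack : 0 ≤ 7 / 2 * p / m * Fintype.card ι * (16 / m : ℝ) ^ p := by positivity
  have hsplit : (1 - 15 * p / (4 * m)) * (A⁻¹ ^ p).trace
        + 15 * p / (4 * m) * (2 * Fintype.card ι * (16 / m) ^ p)
      = (A⁻¹ ^ p).trace - p / 4 * ((16 / m * (A⁻¹ ^ p).trace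
        - Fintype.card ι * (16 / m : ℝ) ^ (p + 1)) - (A⁻¹ ^ p).trace / m)
        + 7 / 2 * p / m * Fintype.card ι * (16 / m : ℝ) ^ p := by
    rw [pow_succ]
    generalize (16 / m : ℝ) ^ p = q
    field_simp
    ring
  linarith

theorem lintegral_pi_trace_inv_pow_le (hx : WhitenedVector ν x d b) {c : ℝ} (hc : 0 < c)
    {m p : ℕ} (hm : 0 < m) (hp : 1 ≤ p) (hb : 2 * p * b ≤ c) {θ : ℝ} (hθ : 0 ≤ θ)
    (hθp : θ = 1 - 15 * p / (4 * m)) (k : ℕ) {A : Matrix ι ι ℝ} (hA : SymmGE A c)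
    (hAd : ∀ g : ι → ℝ, ∑ i, m * d i * g i ^ 2 ≤ g ⬝ᵥ (A *ᵥ g)) :
    ∫⁻ ω : Fin k → Ω, ENNReal.ofReal
        ((A + ∑ j, vecMulVec (x (ω j)) (x (ω j)))⁻¹ ^ p).trace ∂(Measure.pi fun _ => ν) ≤
      ENNReal.ofReal (θ ^ k * (A⁻¹ ^ p).trace
        + (1 - θ ^ k) * (2 * Fintype.card ι * (16 / m) ^ p)) := by
  set Q : ℝ := 2 * Fintype.card ι * (16 / m) ^ p
  have hQ : 0 ≤ Q := by positivity
  have hθ1 : 15 * p / (4 * m) = 1 - θ := by rw [hθp]; ring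
  have hθle : θ ≤ 1 := by rw [hθp]; exact sub_le_self _ (by positivity)
  induction k generalizing A with
  | zero => simp
  | succ k ih =>
    have hθk : 0 ≤ (1 - θ ^ k) * Q := mul_nonneg (sub_nonneg.2 (pow_le_one₀ hθ hθle)) hQ
    simp only [Fin.sum_univ_succ, ← add_assoc]
    refine (lintegral_pi_fin_succ_le ν fun a ω' => ENNReal.ofReal
      ((A + vecMulVec (x a) (x a) + ∑ j, vecMulVec (x (ω' j)) (x (ω' j)))⁻¹ ^ p).trace).trans ?_
    calc ∫⁻ a, ∫⁻ ω', ENNReal.ofReal ((A + vecMulVec (x a) (x a)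
            + ∑ j, vecMulVec (x (ω' j)) (x (ω' j)))⁻¹ ^ p).trace ∂(Measure.pi fun _ => ν) ∂ν
        ≤ ∫⁻ a, (ENNReal.ofReal (θ ^ k)
              * ENNReal.ofReal ((A + vecMulVec (x a) (x a))⁻¹ ^ p).trace
            + ENNReal.ofReal ((1 - θ ^ k) * Q)) ∂ν := by
          refine lintegral_mono fun a => ?_
          have hAa := hA.add_vecMulVec (x a)
          rw [← ENNReal.ofReal_mul (by positivity), ← ENNReal.ofReal_add
              (mul_nonneg (by positivity) (hAa.trace_inv_pow_nonneg hc p)) hθk]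
          refine ih hAa fun g => (hAd g).trans ?_
          rw [quadratic_add_vecMulVec]
          exact le_add_of_nonneg_right (sq_nonneg _)
      _ = ENNReal.ofReal (θ ^ k)
              * ∫⁻ a, ENNReal.ofReal ((A + vecMulVec (x a) (x a))⁻¹ ^ p).trace ∂ν
            + ENNReal.ofReal ((1 - θ ^ k) * Q) := by
          rw [lintegral_add_right _ measurable_const,
            lintegral_const_mul' _ _ ENNReal.ofReal_ne_top, lintegral_const, measure_univ, mul_one]
      _ ≤ ENNReal.ofReal (θ ^ k) * ENNReal.ofReal (θ * (A⁻¹ ^ p).trace + (1 - θ) * Q)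
            + ENNReal.ofReal ((1 - θ ^ k) * Q) := by
          gcongr
          have hstep := hx.lintegral_trace_inv_pow_add_le hA hc hm hAd hp hb
          rwa [hθ1, sub_sub_cancel] at hstep
      _ = ENNReal.ofReal (θ ^ (k + 1) * (A⁻¹ ^ p).trace + (1 - θ ^ (k + 1)) * Q) := by
          have htrace := hA.trace_inv_pow_nonneg hc p
          have : 0 ≤ 1 - θ := sub_nonneg.2 hθle
          rw [← ENNReal.ofReal_mul (by positivity), ← ENNReal.ofReal_add (by positivity) hθk]
          congr 1
          ring

end WhitenedVector

theorem two_mul_exp_pow_add_le (p : ℕ) :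
    (2 * Real.exp (-(15 / 4))) ^ p + 2 * (1 / 21 : ℝ) ^ p ≤ 3 * Real.exp (-(3 * p)) := by
  have hexp3 : Real.exp 3 = Real.exp 1 ^ 3 := by
    rw [← Real.exp_nat_mul]; norm_num
  have htwo : (2 : ℝ) ≤ Real.exp (3 / 4) := by
    refine le_of_pow_le_pow_left₀ (n := 4) (by norm_num) (Real.exp_pos _).le ?_
    rw [← Real.exp_nat_mul, show ((4 : ℕ) : ℝ) * (3 / 4) = 3 by norm_num, hexp3]
    calc (2 : ℝ) ^ 4 ≤ 2.7 ^ 3 := by norm_num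
      _ ≤ Real.exp 1 ^ 3 := by gcongr; linarith [Real.exp_one_gt_d9]
  have hfirst : 2 * Real.exp (-(15 / 4)) ≤ Real.exp (-3) := by
    calc 2 * Real.exp (-(15 / 4)) ≤ Real.exp (3 / 4) * Real.exp (-(15 / 4)) := by gcongr
      _ = Real.exp (-3) := by rw [← Real.exp_add]; norm_num
  have hsecond : (1 / 21 : ℝ) ≤ Real.exp (-3) := by
    rw [Real.exp_neg, ← one_div]
    refine one_div_le_one_div_of_le (Real.exp_pos _) ?_
    rw [hexp3]
    calc Real.exp 1 ^ 3 ≤ 2.72 ^ 3 := by gcongr; linarith [Real.exp_one_lt_d9]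
      _ ≤ 21 := by norm_num
  have hpow : Real.exp (-(3 * p)) = Real.exp (-3) ^ p := by
    rw [← Real.exp_nat_mul]; congr 1; ring
  rw [hpow]
  linarith [pow_le_pow_left₀ (by positivity) hfirst p, pow_le_pow_left₀ (by norm_num) hsecond p]

theorem one_sub_div_pow_le_exp {m p : ℕ} (hm : 0 < m) (hpm : 4 * p ≤ m) :
    (1 - 15 * p / (4 * m) : ℝ) ^ m ≤ Real.exp (-(15 / 4)) ^ p := by
  have hm' : (0 : ℝ) < m := by exact_mod_cast hm
  have hpm' : (4 : ℝ) * p ≤ m := by exact_mod_cast hpm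
  have hθ : (0 : ℝ) ≤ 1 - 15 * p / (4 * m) := by
    rw [sub_nonneg, div_le_one (by positivity)]
    linarith
  refine (pow_le_pow_left₀ hθ (Real.one_sub_le_exp_neg _) m).trans_eq ?_
  rw [← Real.exp_nat_mul, ← Real.exp_nat_mul]
  congr 1
  field_simp

theorem lowerTail_moment_bound {m p : ℕ} (hm : 0 < m) (hpm : 4 * p ≤ m) {θ s c T : ℝ}
    (hθ : 0 ≤ θ) (hθp : θ = 1 - 15 * p / (4 * m)) (hs : 0 ≤ s) (hc : c = m / 672) (hT0 : 0 ≤ T)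
    (hT : T ≤ s * (1 / c) ^ p) :
    θ ^ m * T + (1 - θ ^ m) * (2 * s * (16 / m) ^ p)
      ≤ 3 * s * Real.exp (-(3 * p)) * (1 / (2 * c)) ^ p := by
  have : (0 : ℝ) < m := by exact_mod_cast hm
  have hc0 : 0 < c := by rw [hc]; positivity
  have hθm : θ ^ m ≤ Real.exp (-(15 / 4)) ^ p := hθp ▸ one_sub_div_pow_le_exp hm hpm
  have hpow : (1 / c) ^ p = (1 / (2 * c)) ^ p * 2 ^ p := by
    rw [← mul_pow]; congr 1; field_simp
  have hpow' : (16 / m : ℝ) ^ p = (1 / (2 * c)) ^ p * (1 / 21) ^ p := by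
    rw [← mul_pow, hc]; congr 1; field_simp; norm_num
  calc θ ^ m * T + (1 - θ ^ m) * (2 * s * (16 / m) ^ p)
      ≤ Real.exp (-(15 / 4)) ^ p * (s * (1 / c) ^ p) + 2 * s * (16 / m) ^ p :=
        add_le_add (mul_le_mul hθm hT hT0 (by positivity))
          (mul_le_of_le_one_left (by positivity) (by linarith [pow_nonneg hθ m]))
    _ = s * (1 / (2 * c)) ^ p * ((2 * Real.exp (-(15 / 4))) ^ p + 2 * (1 / 21) ^ p) := by
        rw [hpow, hpow', mul_pow]; ring
    _ ≤ s * (1 / (2 * c)) ^ p * (3 * Real.exp (-(3 * p))) :=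
        mul_le_mul_of_nonneg_left (two_mul_exp_pow_add_le p) (by positivity)
    _ = 3 * s * Real.exp (-(3 * p)) * (1 / (2 * c)) ^ p := by ring

/-- The `p`-th moment method: `tr (A + ∑ j, x j x jᵀ)⁻ᵖ` contracts by a fixed factor in expectation
as each vector is added, until it reaches the level of `m⁻ᵖ`. -/
theorem WhitenedVector.measure_lower_tail_le {ν : Measure Ω} [IsProbabilityMeasure ν]
    {x : Ω → ι → ℝ} {d : ι → ℝ} {b : ℝ} (hx : WhitenedVector ν x d b) (hd : ∀ i, 0 ≤ d i)
    {m p : ℕ} (hp : 1 ≤ p) (hpm : 4 * p ≤ m) (hb : 2 * p * b ≤ m / 672) :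
    (Measure.pi fun _ : Fin m => ν) {ω : Fin m → Ω | ∃ g : ι → ℝ,
        ∑ j, (x (ω j) ⬝ᵥ g) ^ 2 + ∑ i, m * d i * g i ^ 2 < m / 672 * (g ⬝ᵥ g)} ≤
      ENNReal.ofReal (3 * Fintype.card ι * Real.exp (-(3 * p))) := by
  have hm : 0 < m := by omega
  have hm' : (0 : ℝ) < m := by exact_mod_cast hm
  have hpm' : (4 : ℝ) * p ≤ m := by exact_mod_cast hpm
  obtain ⟨c, hc⟩ : ∃ c : ℝ, c = m / 672 := ⟨_, rfl⟩
  have hc0 : 0 < c := by rw [hc]; positivity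
  obtain ⟨θ, hθp⟩ : ∃ θ : ℝ, θ = 1 - 15 * p / (4 * m) := ⟨_, rfl⟩
  have hθ : 0 ≤ θ := by
    rw [hθp, sub_nonneg, div_le_one (by positivity)]
    linarith
  rw [← hc] at hb ⊢
  set A : Matrix ι ι ℝ := diagonal fun i => c + m * d i
  have hquad : ∀ g, g ⬝ᵥ (A *ᵥ g) = c * (g ⬝ᵥ g) + ∑ i, m * d i * g i ^ 2 :=
    quadratic_diagonal_const_add c _
  have hA : SymmGE A c := symmGE_diagonal_const_add c fun i => mul_nonneg hm'.le (hd i)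
  have hAd : ∀ g : ι → ℝ, ∑ i, m * d i * g i ^ 2 ≤ g ⬝ᵥ (A *ᵥ g) := fun g => by
    rw [hquad]
    exact le_add_of_nonneg_left
      (mul_nonneg hc0.le (Finset.sum_nonneg fun i _ => mul_self_nonneg _))
  set Φ : (Fin m → Ω) → ℝ := fun ω =>
    ((A + ∑ j, vecMulVec (x (ω j)) (x (ω j)))⁻¹ ^ p).trace
  have hmeas : Measurable Φ := (hA.continuous_trace_inv_pow hc0 m p).measurable.comp
    (measurable_pi_lambda _ fun j => hx.measurable.comp (measurable_pi_apply j))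
  have hsub : {ω : Fin m → Ω | ∃ g : ι → ℝ,
      ∑ j, (x (ω j) ⬝ᵥ g) ^ 2 + ∑ i, m * d i * g i ^ 2 < c * (g ⬝ᵥ g)}
      ⊆ {ω | ENNReal.ofReal ((1 / (2 * c)) ^ p) ≤ ENNReal.ofReal (Φ ω)} := by
    rintro ω ⟨g, hg⟩
    refine ENNReal.ofReal_le_ofReal ((hA.add_sum_vecMulVec fun j => x (ω j)).le_trace_inv_pow hc0
      (by positivity) (g := g) ?_ p)
    rw [quadratic_add_sum_vecMulVec, hquad]
    linarith
  have hpos : (0 : ℝ) < (1 / (2 * c)) ^ p := by positivity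
  refine (measure_mono hsub).trans ((meas_ge_le_lintegral_div hmeas.ennreal_ofReal.aemeasurable
    (ENNReal.ofReal_pos.2 hpos).ne' ENNReal.ofReal_ne_top).trans ?_)
  refine (ENNReal.div_le_div_right
    (hx.lintegral_pi_trace_inv_pow_le hc0 hm hp hb hθ hθp m hA hAd) _).trans ?_
  rw [← ENNReal.ofReal_div_of_pos hpos]
  refine ENNReal.ofReal_le_ofReal ((div_le_iff₀ hpos).2 ?_)
  exact lowerTail_moment_bound hm hpm hθ hθp (Nat.cast_nonneg _) hc
    (hA.trace_inv_pow_nonneg hc0 p) (hA.trace_inv_pow_le hc0 p)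

end LowerTail

/-! ### Exponential tail of sums of bounded centred vectors -/

section NoiseTail

theorem cosh_sqrt_average_sq_le {ι : Type*} [Fintype ι] [Nonempty ι] (a : ι → ℝ) :
    Real.cosh (√((∑ i, a i ^ 2) / Fintype.card ι)) ≤ (∑ i, Real.cosh (a i)) / Fintype.card ι := by
  have hseries : HasSum (fun k : ℕ => (∑ i, a i ^ (2 * k) / ((2 * k).factorial : ℝ))
      / Fintype.card ι) ((∑ i, Real.cosh (a i)) / Fintype.card ι) :=
    (hasSum_sum fun i _ => Real.hasSum_cosh (a i)).div_const _
  refine hasSum_le (fun k => ?_) (Real.hasSum_cosh _) hseries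
  rw [pow_mul, Real.sq_sqrt (by positivity), ← Finset.sum_div, div_right_comm]
  gcongr
  have hpow := Real.pow_arith_mean_le_arith_mean_pow Finset.univ
    (fun _ => 1 / (Fintype.card ι : ℝ)) (fun i => a i ^ 2) (fun _ _ => by positivity)
    (by rw [Finset.sum_const, Finset.card_univ, nsmul_eq_mul]; field_simp)
    (fun _ _ => sq_nonneg _) k
  simp only [← Finset.mul_sum, ← pow_mul, one_div] at hpow
  rwa [div_eq_inv_mul, div_eq_inv_mul]

theorem integrable_exp_of_abs_le_one {Ω : Type*} [MeasurableSpace Ω] {ν : Measure Ω}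
    [IsFiniteMeasure ν] {Z : Ω → ℝ} (hZ : AEStronglyMeasurable Z ν)
    (hle : ∀ᵐ ω ∂ν, |Z ω| ≤ 1) : Integrable (fun ω => Real.exp (Z ω)) ν := by
  refine Integrable.of_bound (Real.continuous_exp.comp_aestronglyMeasurable hZ) (Real.exp 1) ?_
  filter_upwards [hle] with ω hω
  rw [Real.norm_eq_abs, Real.abs_exp]
  exact Real.exp_le_exp.2 (le_of_abs_le hω)

variable {Ω : Type*} [MeasurableSpace Ω] {ν : Measure Ω} [IsProbabilityMeasure ν]

theorem integral_exp_le_one_add {Z : Ω → ℝ} (hZ : AEStronglyMeasurable Z ν)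
    (hle : ∀ᵐ ω ∂ν, |Z ω| ≤ 1) (h0 : ∫ ω, Z ω ∂ν = 0) :
    ∫ ω, Real.exp (Z ω) ∂ν ≤ 1 + ∫ ω, Z ω ^ 2 ∂ν := by
  have hint : Integrable Z ν := Integrable.of_bound hZ 1 hle
  have hintSq : Integrable (fun ω => Z ω ^ 2) ν := by
    refine Integrable.of_bound (hZ.pow 2) 1 ?_
    filter_upwards [hle] with ω hω
    rw [Real.norm_eq_abs, abs_pow]
    exact pow_le_one₀ (abs_nonneg _) hω
  have hintAffine : Integrable (fun ω => 1 + Z ω) ν := (integrable_const (1 : ℝ)).add hint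
  calc ∫ ω, Real.exp (Z ω) ∂ν ≤ ∫ ω, (1 + Z ω + Z ω ^ 2) ∂ν := by
        refine integral_mono_ae (integrable_exp_of_abs_le_one hZ hle) (hintAffine.add hintSq) ?_
        filter_upwards [hle] with ω hω
        linarith [le_of_abs_le (Real.abs_exp_sub_one_sub_id_le hω)]
    _ = 1 + ∫ ω, Z ω ^ 2 ∂ν := by
        rw [integral_add hintAffine hintSq, integral_add (integrable_const (1 : ℝ)) hint, h0]
        simp

theorem integral_pi_exp_sum_le {Z : Ω → ℝ} (hZ : AEStronglyMeasurable Z ν)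
    (hle : ∀ᵐ ω ∂ν, |Z ω| ≤ 1) (h0 : ∫ ω, Z ω ∂ν = 0) {m : ℕ} (hm : 0 < m)
    (hvar : ∫ ω, Z ω ^ 2 ∂ν ≤ 1 / m) :
    Integrable (fun ω : Fin m → Ω => Real.exp (∑ j, Z (ω j))) (Measure.pi fun _ => ν) ∧
    ∫ ω : Fin m → Ω, Real.exp (∑ j, Z (ω j)) ∂(Measure.pi fun _ => ν) ≤ Real.exp 1 := by
  simp only [Real.exp_sum]
  refine ⟨Integrable.fintype_prod fun _ => integrable_exp_of_abs_le_one hZ hle, ?_⟩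
  rw [integral_fintype_prod_eq_pow (ι := Fin m) (fun ω => Real.exp (Z ω)), Fintype.card_fin]
  have hfactor : ∫ ω, Real.exp (Z ω) ∂ν ≤ Real.exp (1 / m) := by
    linarith [integral_exp_le_one_add hZ hle h0, Real.add_one_le_exp (1 / m : ℝ)]
  refine (pow_le_pow_left₀ (integral_nonneg fun ω => (Real.exp_pos _).le) hfactor m).trans_eq ?_
  rw [← Real.exp_nat_mul]
  congr 1
  field_simp

theorem integral_pi_cosh_sum_le {Z : Ω → ℝ} (hZ : AEStronglyMeasurable Z ν)
    (hle : ∀ᵐ ω ∂ν, |Z ω| ≤ 1) (h0 : ∫ ω, Z ω ∂ν = 0) {m : ℕ} (hm : 0 < m)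
    (hvar : ∫ ω, Z ω ^ 2 ∂ν ≤ 1 / m) :
    Integrable (fun ω : Fin m → Ω => Real.cosh (∑ j, Z (ω j))) (Measure.pi fun _ => ν) ∧
    ∫ ω : Fin m → Ω, Real.cosh (∑ j, Z (ω j)) ∂(Measure.pi fun _ => ν) ≤ Real.exp 1 := by
  obtain ⟨hint, hbound⟩ := integral_pi_exp_sum_le hZ hle h0 hm hvar
  obtain ⟨hintNeg, hboundNeg⟩ := integral_pi_exp_sum_le (Z := fun ω => -Z ω) hZ.neg
    (by simpa using hle) (by rw [integral_neg, h0, neg_zero]) hm (by simpa using hvar)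
  simp only [Finset.sum_neg_distrib] at hintNeg hboundNeg
  simp only [Real.cosh_eq]
  refine ⟨(hint.add hintNeg).div_const 2, ?_⟩
  rw [integral_div, integral_add hint hintNeg]
  linarith

theorem measure_le_sqrt_average_sum_sq_le {ι : Type*} [Fintype ι] [Nonempty ι] {Z : ι → Ω → ℝ}
    (hZ : ∀ i, AEStronglyMeasurable (Z i) ν) (hle : ∀ i, ∀ᵐ ω ∂ν, |Z i ω| ≤ 1)
    (h0 : ∀ i, ∫ ω, Z i ω ∂ν = 0) {m : ℕ} (hm : 0 < m)
    (hvar : ∀ i, ∫ ω, Z i ω ^ 2 ∂ν ≤ 1 / m) {t : ℝ} (ht : 0 ≤ t) :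
    (Measure.pi fun _ : Fin m => ν)
      {ω : Fin m → Ω | t ≤ √((∑ i, (∑ j, Z i (ω j)) ^ 2) / Fintype.card ι)}
      ≤ ENNReal.ofReal (2 * Real.exp 1 * Real.exp (-t)) := by
  have hcard : (0 : ℝ) < Fintype.card ι := by exact_mod_cast Fintype.card_pos
  have hcosh := fun i => integral_pi_cosh_sum_le (hZ i) (hle i) (h0 i) hm (hvar i)
  set G : (Fin m → Ω) → ℝ := fun ω => (∑ i, Real.cosh (∑ j, Z i (ω j))) / Fintype.card ι with hG
  have hGint : Integrable G (Measure.pi fun _ => ν) :=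
    (integrable_finsetSum _ fun i _ => (hcosh i).1).div_const _
  have hGle : ∫ ω, G ω ∂(Measure.pi fun _ => ν) ≤ Real.exp 1 := by
    rw [hG, integral_div, integral_finsetSum _ fun i _ => (hcosh i).1, div_le_iff₀ hcard]
    refine (Finset.sum_le_card_nsmul _ _ _ fun i _ => (hcosh i).2).trans_eq ?_
    rw [Finset.card_univ, nsmul_eq_mul, mul_comm]
  have hG0 : ∀ ω, 0 ≤ G ω := fun ω =>
    div_nonneg (Finset.sum_nonneg fun i _ => (Real.cosh_pos _).le) hcard.le
  have hsub : {ω : Fin m → Ω | t ≤ √((∑ i, (∑ j, Z i (ω j)) ^ 2) / Fintype.card ι)}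
      ⊆ {ω | Real.cosh t ≤ G ω} := by
    intro ω hω
    refine le_trans ?_ (cosh_sqrt_average_sq_le fun i => ∑ j, Z i (ω j))
    rw [Real.cosh_le_cosh, abs_of_nonneg ht, abs_of_nonneg (Real.sqrt_nonneg _)]
    exact hω
  have hmarkov := (mul_meas_ge_le_integral_of_nonneg (Filter.Eventually.of_forall hG0) hGint
    (Real.cosh t)).trans hGle
  refine (measure_mono hsub).trans ?_
  rw [← ofReal_measureReal]
  refine ENNReal.ofReal_le_ofReal ?_
  have hexp : Real.exp t / 2 ≤ Real.cosh t := by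
    rw [Real.cosh_eq]
    linarith [Real.exp_pos (-t)]
  have hscaled := (mul_le_mul_of_nonneg_right hexp measureReal_nonneg).trans hmarkov
  rw [Real.exp_neg, ← div_eq_mul_inv, le_div_iff₀ (Real.exp_pos t)]
  linarith

theorem WhitenedVector.measure_le_sqrt_sum_sq_le {ι : Type*} [Fintype ι] [DecidableEq ι]
    [Nonempty ι] {x : Ω → ι → ℝ} {d : ι → ℝ} {b : ℝ} (hx : WhitenedVector ν x d b)
    (hd : ∀ i, 0 ≤ d i) {ξ : Ω → ℝ} (hξ : AEStronglyMeasurable ξ ν) {B : ℝ} (hB : 0 < B)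
    (hξB : ∀ᵐ ω ∂ν, |ξ ω| ≤ B) (hξx : ∀ i, ∫ ω, ξ ω * x ω i ∂ν = 0) {m : ℕ} (hm : 0 < m)
    (hb : b ≤ m) {t : ℝ} (ht : 0 ≤ t) :
    (Measure.pi fun _ : Fin m => ν) {ω : Fin m → Ω |
        t * B * √(m * Fintype.card ι) ≤ √(∑ i, (∑ j, ξ (ω j) * x (ω j) i) ^ 2)}
      ≤ ENNReal.ofReal (2 * Real.exp 1 * Real.exp (-t)) := by
  have hm' : (0 : ℝ) < m := by exact_mod_cast hm
  have hcard : (0 : ℝ) < Fintype.card ι := by exact_mod_cast Fintype.card_pos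
  set θ : ℝ := (B * √m)⁻¹ with hθ
  have hθ0 : 0 < θ := inv_pos.2 (mul_pos hB (Real.sqrt_pos.2 hm'))
  have hθsq : θ ^ 2 * B ^ 2 = 1 / m := by
    rw [hθ, inv_pow, mul_pow, Real.sq_sqrt hm'.le]
    field_simp
  have hxmeas : ∀ i, Measurable fun ω => x ω i := fun i =>
    (measurable_pi_apply i).comp hx.measurable
  set Z : ι → Ω → ℝ := fun i ω => θ * (ξ ω * x ω i) with hZ
  have hZle : ∀ i, ∀ᵐ ω ∂ν, |Z i ω| ≤ 1 := fun i => by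
    filter_upwards [hξB] with ω hω
    have hxle : |x ω i| ≤ √m := Real.abs_le_sqrt ((hx.sq_le ω i).trans hb)
    rw [hZ, abs_mul, abs_mul, abs_of_pos hθ0, hθ, inv_mul_le_iff₀ (by positivity), mul_one]
    gcongr
  have hZvar : ∀ i, ∫ ω, Z i ω ^ 2 ∂ν ≤ 1 / m := fun i => by
    calc ∫ ω, Z i ω ^ 2 ∂ν ≤ ∫ ω, 1 / m * (x ω i * x ω i) ∂ν := by
          refine integral_mono_of_nonneg (Filter.Eventually.of_forall fun ω => sq_nonneg _)
            ((hx.integrable_mul i i).const_mul _) ?_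
          filter_upwards [hξB] with ω hω
          have hξsq : ξ ω ^ 2 ≤ B ^ 2 := sq_le_sq' (neg_le_of_abs_le hω) (le_of_abs_le hω)
          rw [hZ, mul_pow, mul_pow, ← hθsq, ← sq, ← mul_assoc]
          gcongr
      _ = 1 / m * (1 - d i) := by rw [integral_const_mul, hx.integral_mul, if_pos rfl]
      _ ≤ 1 / m := mul_le_of_le_one_right (by positivity) (sub_le_self _ (hd i))
  refine (measure_mono fun ω hω => ?_).trans (measure_le_sqrt_average_sum_sq_le (Z := Z)
    (fun i => (hξ.mul (hxmeas i).aestronglyMeasurable).const_mul θ) hZle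
    (fun i => by rw [integral_const_mul, hξx i, mul_zero]) hm hZvar ht)
  have hscale : (∑ i, (∑ j, Z i (ω j)) ^ 2) = θ ^ 2 * ∑ i, (∑ j, ξ (ω j) * x (ω j) i) ^ 2 := by
    simp only [hZ, ← Finset.mul_sum, mul_pow]
  rw [Set.mem_ofPred_eq, hscale, Real.sqrt_div (by positivity), Real.sqrt_mul (sq_nonneg θ),
    Real.sqrt_sq hθ0.le, le_div_iff₀ (Real.sqrt_pos.2 hcard), hθ, le_inv_mul_iff₀ (by positivity)]
  refine le_of_eq_of_le ?_ hω
  rw [Real.sqrt_mul hm'.le]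
  ring

end NoiseTail

/-! ### Population and empirical norms on a finite dimensional subspace -/

section PrincipalBasis

open Matrix

variable {X H : Type*} [MeasurableSpace X] [NormedAddCommGroup H] [InnerProductSpace ℝ H]
  [RKHS ℝ H X ℝ]

/-- The quadratic form `⟨(Σ + ρ) g, g⟩` of the regularized covariance operator. -/
def regMoment (μ : Measure (X × ℝ)) (ρ : ℝ) (g : H) : ℝ :=
  ∫ p, g p.1 ^ 2 ∂μ + ρ * ‖g‖ ^ 2

/-- A basis of `W` that diagonalizes simultaneously the inner product of `H` and the second moment
form of the input distribution, with diagonal entries `1` and `σ`. -/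
structure IsPrincipalBasis {ι : Type*} [Fintype ι] [DecidableEq ι] (μ : Measure (X × ℝ))
    (W : Submodule ℝ H) (e : ι → H) (σ : ι → ℝ) : Prop where
  orthonormal : Orthonormal ℝ e
  sum_inner_smul : ∀ g ∈ W, ∑ i, (inner ℝ (e i) g : ℝ) • e i = g
  integral_mul : ∀ i j, ∫ p, e i p.1 * e j p.1 ∂μ = if i = j then σ i else 0

/-- The values of `(Σ + ρ)^(-1/2) e i`, for a principal basis `e`. -/
def whiten {ι : Type*} (e : ι → H) (σ : ι → ℝ) (ρ : ℝ) (x : X) : ι → ℝ :=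
  fun i => e i x / √(σ i + ρ)

/-- The coordinates of `(Σ + ρ)^(1/2) g`, for a principal basis `e`. -/
def whitenedCoord {ι : Type*} (e : ι → H) (σ : ι → ℝ) (ρ : ℝ) (g : H) : ι → ℝ :=
  fun i => √(σ i + ρ) * inner ℝ (e i) g

variable {κ : ℝ} {μ : Measure (X × ℝ)}

namespace IsPrincipalBasis

variable {ι : Type*} [Fintype ι] [DecidableEq ι] {W : Submodule ℝ H} {e : ι → H} {σ : ι → ℝ}

theorem nonneg (he : IsPrincipalBasis μ W e σ) (i : ι) : 0 ≤ σ i := by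
  have hdiag := he.integral_mul i i
  rw [if_pos rfl] at hdiag
  rw [← hdiag]
  exact integral_nonneg fun p => mul_self_nonneg _

theorem norm_sq_eq_sum (he : IsPrincipalBasis μ W e σ) {g : H} (hg : g ∈ W) :
    ‖g‖ ^ 2 = ∑ i, inner ℝ (e i) g ^ 2 := by
  rw [← real_inner_self_eq_norm_sq]
  conv_lhs => rw [← he.sum_inner_smul g hg, he.orthonormal.inner_sum]
  simp [sq]

variable {ρ : ℝ}

theorem sq_whitenedCoord (he : IsPrincipalBasis μ W e σ) (hρ : 0 < ρ) (g : H) (i : ι) :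
    whitenedCoord e σ ρ g i ^ 2 = (σ i + ρ) * inner ℝ (e i) g ^ 2 := by
  rw [whitenedCoord, mul_pow, Real.sq_sqrt (add_nonneg (he.nonneg i) hρ.le)]

theorem sum_mul_sq_whitenedCoord (he : IsPrincipalBasis μ W e σ) (hρ : 0 < ρ) {g : H}
    (hg : g ∈ W) : ∑ i, ρ / (σ i + ρ) * whitenedCoord e σ ρ g i ^ 2 = ρ * ‖g‖ ^ 2 := by
  rw [he.norm_sq_eq_sum hg, Finset.mul_sum]
  refine Finset.sum_congr rfl fun i _ => ?_
  rw [he.sq_whitenedCoord hρ, ← mul_assoc,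
    div_mul_cancel₀ _ (add_pos_of_nonneg_of_pos (he.nonneg i) hρ).ne']

variable [CompleteSpace H]

theorem apply_eq_sum (he : IsPrincipalBasis μ W e σ) {g : H} (hg : g ∈ W) (x : X) :
    g x = ∑ i, inner ℝ (e i) g * e i x := by
  conv_lhs => rw [← inner_featureMap, ← he.sum_inner_smul g hg, inner_sum]
  simp only [inner_smul_right, inner_featureMap]

theorem whiten_dotProduct_whitenedCoord (he : IsPrincipalBasis μ W e σ) (hρ : 0 < ρ) {g : H}
    (hg : g ∈ W) (x : X) : whiten e σ ρ x ⬝ᵥ whitenedCoord e σ ρ g = g x := by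
  rw [he.apply_eq_sum hg, dotProduct]
  refine Finset.sum_congr rfl fun i _ => ?_
  have hsqrt := (Real.sqrt_pos.2 (add_pos_of_nonneg_of_pos (he.nonneg i) hρ)).ne'
  rw [whiten, whitenedCoord]
  field_simp

theorem whitenedVector (he : IsPrincipalBasis μ W e σ) (hκ : 0 ≤ κ) (hK : KernelAssumptions H κ)
    (hρ : 0 < ρ) : WhitenedVector μ (fun p => whiten e σ ρ p.1) (fun i => ρ / (σ i + ρ))
      (κ ^ 2 / ρ) := by
  have hpos : ∀ i, 0 < σ i + ρ := fun i => add_pos_of_nonneg_of_pos (he.nonneg i) hρ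
  refine ⟨(measurable_pi_lambda _ fun i => (measurable_coe hK (e i)).div_const _).comp
    measurable_fst, fun p => ?_, fun i j => ?_⟩
  · rw [le_div_iff₀ hρ, dotProduct, Finset.sum_mul]
    calc ∑ i, whiten e σ ρ p.1 i * whiten e σ ρ p.1 i * ρ
        ≤ ∑ i, ‖inner ℝ (e i) (featureMap H p.1)‖ ^ 2 := by
          refine Finset.sum_le_sum fun i _ => ?_
          rw [real_inner_comm, inner_featureMap, Real.norm_eq_abs, sq_abs, whiten, ← sq, div_pow,
            Real.sq_sqrt (hpos i).le, div_mul_eq_mul_div, div_le_iff₀ (hpos i)]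
          gcongr
          exact le_add_of_nonneg_left (he.nonneg i)
      _ ≤ ‖featureMap H p.1‖ ^ 2 := he.orthonormal.sum_inner_products_le _
      _ ≤ κ ^ 2 := by gcongr; exact norm_featureMap_le hκ hK p.1
  · simp only [whiten, div_mul_div_comm]
    rw [integral_div, he.integral_mul]
    split_ifs with hij
    · subst hij
      rw [Real.mul_self_sqrt (hpos i).le, eq_sub_iff_add_eq, ← add_div, div_self (hpos i).ne']
    · rw [zero_div]

variable [TopologicalSpace.SeparableSpace H] [IsProbabilityMeasure μ]

theorem integral_sq_eq_sum (he : IsPrincipalBasis μ W e σ) (hκ : 0 ≤ κ)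
    (hK : KernelAssumptions H κ) {g : H} (hg : g ∈ W) :
    ∫ p, g p.1 ^ 2 ∂μ = ∑ i, σ i * inner ℝ (e i) g ^ 2 := by
  have hcov : ∀ i j, inner ℝ (covariance H μ (e i)) (e j) = if i = j then σ i else 0 := fun i j =>
    (inner_covariance hκ hK _ _).trans (he.integral_mul i j)
  simp only [sq]
  rw [← inner_covariance hκ hK]
  conv_lhs => rw [← he.sum_inner_smul g hg]
  simp only [map_sum, map_smul, sum_inner, inner_sum, inner_smul_left, inner_smul_right, hcov,
    conj_trivial, mul_ite, mul_zero, Finset.sum_ite_eq', Finset.mem_univ, if_true]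
  exact Finset.sum_congr rfl fun i _ => by ring

theorem whitenedCoord_dotProduct_self (he : IsPrincipalBasis μ W e σ) (hκ : 0 ≤ κ)
    (hK : KernelAssumptions H κ) (hρ : 0 < ρ) {g : H} (hg : g ∈ W) :
    whitenedCoord e σ ρ g ⬝ᵥ whitenedCoord e σ ρ g = regMoment μ ρ g := by
  simp only [dotProduct, ← sq, he.sq_whitenedCoord hρ]
  rw [regMoment, he.integral_sq_eq_sum hκ hK hg, he.norm_sq_eq_sum hg, Finset.mul_sum,
    ← Finset.sum_add_distrib]
  exact Finset.sum_congr rfl fun i _ => add_mul _ _ _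

end IsPrincipalBasis

theorem exists_isPrincipalBasis [CompleteSpace H] [TopologicalSpace.SeparableSpace H]
    [IsProbabilityMeasure μ] (hκ : 0 ≤ κ) (hK : KernelAssumptions H κ) (W : Submodule ℝ H)
    [FiniteDimensional ℝ W] {s : ℕ} (hs : Module.finrank ℝ W = s) :
    ∃ (e : Fin s → H) (σ : Fin s → ℝ), IsPrincipalBasis μ W e σ := by
  set T : W →ₗ[ℝ] W := (W.orthogonalProjectionOnto : H →ₗ[ℝ] W) ∘ₗ (covariance H μ : H →ₗ[ℝ] H)
    ∘ₗ W.subtype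
  have hT : ∀ g h : W, inner ℝ (T g) h = inner ℝ (covariance H μ g) (h : H) := fun g h =>
    Submodule.inner_orthogonalProjectionOnto_eq_of_mem_right h _
  have hsymm : T.IsSymmetric := fun g h => by
    rw [hT, real_inner_comm (T h) g, hT, real_inner_comm]
    exact ((isPositive_covariance hκ hK).1 (h : H) g).symm
  set b := hsymm.eigenvectorBasis hs
  refine ⟨fun i => b i, hsymm.eigenvalues hs, b.orthonormal.comp_linearIsometry W.subtypeₗᵢ,
    fun g hg => by simpa using congrArg Subtype.val (b.sum_repr' ⟨g, hg⟩), fun i j => ?_⟩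
  rw [← inner_covariance hκ hK, ← hT, hsymm.apply_eigenvectorBasis hs i, inner_smul_left,
    orthonormal_iff_ite.1 b.orthonormal i j]
  simp

end PrincipalBasis

section NormDomination

variable {X H : Type*} [MeasurableSpace X] [NormedAddCommGroup H] [InnerProductSpace ℝ H]
  [RKHS ℝ H X ℝ]

/-- The empirical counterpart of `regMoment`. -/
def empRegMoment {m : ℕ} (D : Fin m → X × ℝ) (ρ : ℝ) (g : H) : ℝ :=
  (∑ j, g (D j).1 ^ 2) / m + ρ * ‖g‖ ^ 2

variable [CompleteSpace H] {κ : ℝ} {μ : Measure (X × ℝ)}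

theorem memLp_apply [IsFiniteMeasure μ] (hκ : 0 ≤ κ) (hK : KernelAssumptions H κ) (g : H)
    (q : ℝ≥0∞) : MemLp (fun p : X × ℝ => g p.1) q μ :=
  MemLp.of_bound ((measurable_coe hK g).comp measurable_fst).aestronglyMeasurable (κ * ‖g‖)
    (Filter.Eventually.of_forall fun p => abs_apply_le hκ hK g p.1)

theorem integral_apply_sq_le [IsProbabilityMeasure μ] (hκ : 0 ≤ κ) (hK : KernelAssumptions H κ)
    (g : H) : ∫ p, g p.1 ^ 2 ∂μ ≤ κ ^ 2 * ‖g‖ ^ 2 := by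
  calc ∫ p, g p.1 ^ 2 ∂μ ≤ ∫ _, (κ * ‖g‖) ^ 2 ∂μ := by
        refine integral_mono (memLp_apply hκ hK g 2).integrable_sq (integrable_const _) fun p => ?_
        have hle := abs_apply_le hκ hK g p.1
        exact sq_le_sq' (neg_le_of_abs_le hle) (le_of_abs_le hle)
    _ = κ ^ 2 * ‖g‖ ^ 2 := by simp [mul_pow]

variable [IsProbabilityMeasure μ] [TopologicalSpace.SeparableSpace H]

theorem measure_empRegMoment_lt_regMoment_le (hκ : 0 ≤ κ) (hK : KernelAssumptions H κ)
    (W : Submodule ℝ H) [FiniteDimensional ℝ W] {m p : ℕ} (hp : 1 ≤ p) (hpm : 4 * p ≤ m) {ρ : ℝ}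
    (hρ : 0 < ρ) (hκρ : 2 * p * (κ ^ 2 / ρ) ≤ m / 672) :
    (Measure.pi fun _ : Fin m => μ) {D : Fin m → X × ℝ | ∃ g ∈ W,
        672 * empRegMoment D ρ g < regMoment μ ρ g}
      ≤ ENNReal.ofReal (3 * Module.finrank ℝ W * Real.exp (-(3 * p))) := by
  have hm : (0 : ℝ) < m := by exact_mod_cast (by omega : 0 < m)
  obtain ⟨e, σ, he⟩ := exists_isPrincipalBasis (μ := μ) hκ hK W rfl
  refine (measure_mono ?_).trans (((he.whitenedVector hκ hK hρ).measure_lower_tail_le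
    (fun i => (div_pos hρ (add_pos_of_nonneg_of_pos (he.nonneg i) hρ)).le) hp hpm hκρ).trans_eq
    (by rw [Fintype.card_fin]))
  rintro D ⟨g, hg, hlt⟩
  refine ⟨whitenedCoord e σ ρ g, ?_⟩
  simp only [he.whiten_dotProduct_whitenedCoord hρ hg, mul_assoc, ← Finset.mul_sum,
    he.sum_mul_sq_whitenedCoord hρ hg, he.whitenedCoord_dotProduct_self hκ hK hρ hg]
  calc ∑ j, g (D j).1 ^ 2 + m * (ρ * ‖g‖ ^ 2) = m / 672 * (672 * empRegMoment D ρ g) := by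
        rw [empRegMoment]; field_simp
    _ < m / 672 * regMoment μ ρ g := mul_lt_mul_of_pos_left hlt (by positivity)

/-- For `κ² ≤ 224 l` the penalty alone dominates the norm; otherwise `m` exceeds a multiple of `L`,
and the moment of order `⌈L⌉` gives the tail. -/
theorem measure_empRegMoment_lt_regMoment_le_exp (hκ : 0 < κ) (hK : KernelAssumptions H κ)
    (W : Submodule ℝ H) [FiniteDimensional ℝ W] {L : ℝ} (hL : 1 ≤ L)
    (hWL : (Module.finrank ℝ W : ℝ) ≤ Real.exp L) {m : ℕ} (hm : 0 < m) {l : ℝ}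
    (hl : l = 12 * κ ^ 2 * L / m) :
    (Measure.pi fun _ : Fin m => μ) {D : Fin m → X × ℝ | ∃ g ∈ W,
        400 ^ 2 * empRegMoment D l g < regMoment μ (224 * l) g}
      ≤ ENNReal.ofReal (3 * Real.exp (-(2 * L))) := by
  have hm' : (0 : ℝ) < m := by exact_mod_cast hm
  have hl0 : 0 < l := by rw [hl]; positivity
  rcases le_or_gt (κ ^ 2) (224 * l) with hbig | hsmall
  · refine (measure_mono_null ?_ measure_empty).trans_le zero_le
    rintro D ⟨g, -, hlt⟩
    refine hlt.not_ge ?_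
    have hmoment : ∫ p, g p.1 ^ 2 ∂μ ≤ 224 * l * ‖g‖ ^ 2 :=
      (integral_apply_sq_le hκ.le hK g).trans (by gcongr)
    have hemp : 0 ≤ (∑ j, g (D j).1 ^ 2) / m := by positivity
    have hpenalty : 0 ≤ l * ‖g‖ ^ 2 := by positivity
    rw [regMoment, empRegMoment]
    linarith
  · have hLm : 2688 * L < m := by
      rw [hl, ← mul_div_assoc, div_lt_iff₀ hm'] at hsmall
      have hscaled : κ ^ 2 * (2688 * L) < κ ^ 2 * m := by linarith
      exact lt_of_mul_lt_mul_left hscaled (by positivity)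
    have hpL : L ≤ ⌈L⌉₊ := Nat.le_ceil L
    have hp2 : (⌈L⌉₊ : ℝ) ≤ 2 * L := by
      linarith [Nat.ceil_lt_add_one (by linarith : 0 ≤ L)]
    have hpm : 4 * ⌈L⌉₊ ≤ m := by
      have hcast : ((4 * ⌈L⌉₊ : ℕ) : ℝ) ≤ m := by push_cast; linarith
      exact_mod_cast hcast
    have hκρ : 2 * ⌈L⌉₊ * (κ ^ 2 / (224 * l)) ≤ (m : ℝ) / 672 := by
      have hratio : κ ^ 2 / (224 * l) = m / (2688 * L) := by
        rw [hl]; field_simp; norm_num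
      rw [hratio, mul_div_assoc', div_le_div_iff₀ (by positivity) (by norm_num)]
      linarith [mul_le_mul_of_nonneg_right hp2 hm'.le]
    refine (measure_mono ?_).trans ((measure_empRegMoment_lt_regMoment_le (μ := μ) hκ.le hK W
      (Nat.one_le_ceil_iff.2 (by linarith)) hpm (by positivity) hκρ).trans
      (ENNReal.ofReal_le_ofReal ?_))
    · rintro D ⟨g, hg, hlt⟩
      refine ⟨g, hg, lt_of_le_of_lt ?_ hlt⟩
      have hemp : 0 ≤ (∑ j, g (D j).1 ^ 2) / m := by positivity
      have hpenalty : 0 ≤ l * ‖g‖ ^ 2 := by positivity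
      rw [empRegMoment, empRegMoment]
      linarith
    · calc 3 * (Module.finrank ℝ W : ℝ) * Real.exp (-(3 * ⌈L⌉₊))
          ≤ 3 * Real.exp L * Real.exp (-(3 * L)) := by gcongr
        _ = 3 * Real.exp (-(2 * L)) := by rw [mul_assoc, ← Real.exp_add]; congr 2; ring

theorem IsRegressionFunction.measure_noise_gt_le {f : H} (hf : IsRegressionFunction μ f)
    (hκ : 0 ≤ κ) (hK : KernelAssumptions H κ) (W : Submodule ℝ H) [FiniteDimensional ℝ W]
    (hW : 0 < Module.finrank ℝ W) {B : ℝ} (hB : 0 < B) (hfB : ∀ᵐ p ∂μ, |p.2 - f p.1| ≤ B) {m : ℕ}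
    (hm : 0 < m) {ρ : ℝ} (hρ : 0 < ρ) (hκρ : κ ^ 2 ≤ m * ρ) {t : ℝ} (ht : 0 ≤ t) :
    (Measure.pi fun _ : Fin m => μ) {D : Fin m → X × ℝ | ∃ g ∈ W,
        t * B * √(m * Module.finrank ℝ W) * √(regMoment μ ρ g)
          < |∑ j, ((D j).2 - f (D j).1) * g (D j).1|}
      ≤ ENNReal.ofReal (2 * Real.exp 1 * Real.exp (-t)) := by
  obtain ⟨e, σ, he⟩ := exists_isPrincipalBasis (μ := μ) hκ hK W rfl
  have : Nonempty (Fin (Module.finrank ℝ W)) := ⟨⟨0, hW⟩⟩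
  have hx := he.whitenedVector hκ hK hρ
  have hcentred : ∀ i, ∫ p, (p.2 - f p.1) * whiten e σ ρ p.1 i ∂μ = 0 := fun i =>
    hf.integral_residual_smul ((measurable_coe hK (e i)).div_const _).stronglyMeasurable
      (c := √(κ ^ 2 / ρ)) fun x => Real.abs_le_sqrt (hx.sq_le (x, 0) i)
  refine (measure_mono ?_).trans (hx.measure_le_sqrt_sum_sq_le
    (fun i => (div_pos hρ (add_pos_of_nonneg_of_pos (he.nonneg i) hρ)).le)
    (ξ := fun p => p.2 - f p.1)
    (measurable_snd.sub ((measurable_coe hK f).comp measurable_fst)).aestronglyMeasurable hB hfB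
    hcentred hm (by rwa [div_le_iff₀ hρ]) ht)
  rintro D ⟨g, hg, hlt⟩
  set u := whitenedCoord e σ ρ g with hu
  set S : Fin (Module.finrank ℝ W) → ℝ := fun i =>
    ∑ j, ((D j).2 - f (D j).1) * whiten e σ ρ (D j).1 i with hS
  have hsum : ∑ j, ((D j).2 - f (D j).1) * g (D j).1 = ∑ i, S i * u i := by
    simp only [← he.whiten_dotProduct_whitenedCoord hρ hg, dotProduct, Finset.mul_sum, hS,
      Finset.sum_mul, mul_assoc]
    exact Finset.sum_comm
  have hcauchy : |∑ i, S i * u i| ≤ √(∑ i, S i ^ 2) * √(regMoment μ ρ g) := by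
    rw [← he.whitenedCoord_dotProduct_self hκ hK hρ hg, ← hu, dotProduct,
      ← Real.sqrt_mul (Finset.sum_nonneg fun i _ => sq_nonneg _)]
    simp only [← sq]
    exact Real.abs_le_sqrt (Finset.sum_mul_sq_le_sq_mul_sq _ _ _)
  rw [hsum] at hlt
  rw [Set.mem_ofPred_eq, Fintype.card_fin]
  exact (lt_of_mul_lt_mul_right (hlt.trans_le hcauchy) (Real.sqrt_nonneg _)).le

end NormDomination

/-! ### Excess risk of the ridge estimator over a finite dimensional subspace -/

section EmpiricalMoment

variable {X H : Type*} [NormedAddCommGroup H] [InnerProductSpace ℝ H] [RKHS ℝ H X ℝ] {m : ℕ}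
  {ρ : ℝ}

theorem empRegMoment_nonneg (hρ : 0 ≤ ρ) (D : Fin m → X × ℝ) (g : H) : 0 ≤ empRegMoment D ρ g := by
  unfold empRegMoment
  positivity

theorem sqrt_mul_norm_le_sqrt_empRegMoment (hρ : 0 ≤ ρ) (D : Fin m → X × ℝ) (g : H) :
    √ρ * ‖g‖ ≤ √(empRegMoment D ρ g) := by
  refine Real.le_sqrt_of_sq_le ?_
  rw [mul_pow, Real.sq_sqrt hρ, empRegMoment]
  exact le_add_of_nonneg_left (by positivity)

theorem sum_abs_apply_le_sqrt_empRegMoment (hm : 0 < m) (hρ : 0 ≤ ρ) (D : Fin m → X × ℝ) (g : H) :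
    ∑ j, |g (D j).1| ≤ m * √(empRegMoment D ρ g) := by
  refine le_of_sq_le_sq ?_ (by positivity)
  calc (∑ j, |g (D j).1|) ^ 2 ≤ m * ∑ j, g (D j).1 ^ 2 := by
        simpa using sq_sum_le_card_mul_sum_sq (s := Finset.univ) (f := fun j => |g (D j).1|)
    _ = (m : ℝ) ^ 2 * ((∑ j, g (D j).1 ^ 2) / m) := by field_simp
    _ ≤ (m * √(empRegMoment D ρ g)) ^ 2 := by
        rw [mul_pow, Real.sq_sqrt (empRegMoment_nonneg hρ D g), empRegMoment]
        gcongr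
        exact le_add_of_nonneg_right (by positivity)

theorem IsRidge.empRegMoment_sub_eq {W : Submodule ℝ H} {m : ℕ} (hm : 0 < m) {l : ℝ}
    {D : Fin m → X × ℝ} {g w : H} (hg : IsRidge W l D g) (hw : w ∈ W) (f : H) :
    m * empRegMoment D l (g - w) = ∑ j, ((D j).2 - f (D j).1) * (g - w) (D j).1
      + ∑ j, (f - w) (D j).1 * (g - w) (D j).1 - m * l * inner ℝ w (g - w) := by
  have hsplit : ∑ j, ((D j).2 - g (D j).1) * (g - w) (D j).1
      = ∑ j, ((D j).2 - f (D j).1) * (g - w) (D j).1 + ∑ j, (f - w) (D j).1 * (g - w) (D j).1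
        - ∑ j, (g - w) (D j).1 ^ 2 := by
    rw [← Finset.sum_add_distrib, ← Finset.sum_sub_distrib]
    refine Finset.sum_congr rfl fun j _ => ?_
    simp only [RKHS.coe_sub, Pi.sub_apply]
    ring
  have hinner : inner ℝ g (g - w) = ‖g - w‖ ^ 2 + inner ℝ w (g - w) := by
    rw [← real_inner_self_eq_norm_sq, ← inner_add_left, sub_add_cancel]
  have hnormal := hg.normal_equation (W.sub_mem hg.1 hw)
  rw [hsplit, hinner] at hnormal
  rw [empRegMoment, mul_add, mul_div_cancel₀ _ (by positivity)]
  linarith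

end EmpiricalMoment

section TargetRisk

variable {X H : Type*} [MeasurableSpace X] [NormedAddCommGroup H] [InnerProductSpace ℝ H]
  [RKHS ℝ H X ℝ] [CompleteSpace H] {κ : ℝ} {μ : Measure (X × ℝ)} {f : H}

theorem IsRidge.sqrt_empRegMoment_sub_starProjection_le (hκ : 0 ≤ κ) (hK : KernelAssumptions H κ)
    {W : Submodule ℝ H} [W.HasOrthogonalProjection] {m : ℕ} (hm : 0 < m) {l : ℝ} (hl : 0 ≤ l)
    {D : Fin m → X × ℝ} {g : H} (hg : IsRidge W l D g) {T : ℝ} (hT : 0 ≤ T)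
    (hnoise : ∀ d ∈ W, ∑ j, ((D j).2 - f (D j).1) * d (D j).1 ≤ m * (T * √(empRegMoment D l d))) :
    √(empRegMoment D l (g - W.starProjection f))
      ≤ T + κ * ‖f - W.starProjection f‖ + √l * ‖f‖ := by
  set w := W.starProjection f
  have hwW : w ∈ W := W.starProjection_apply_mem f
  set d := g - w
  set E := √(empRegMoment D l d) with hE
  have happrox : ∑ j, (f - w) (D j).1 * d (D j).1 ≤ m * (κ * ‖f - w‖ * E) := by
    calc ∑ j, (f - w) (D j).1 * d (D j).1 ≤ ∑ j, κ * ‖f - w‖ * |d (D j).1| := by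
          refine Finset.sum_le_sum fun j _ => (le_abs_self _).trans ?_
          rw [abs_mul]
          gcongr
          exact abs_apply_le hκ hK _ _
      _ ≤ κ * ‖f - w‖ * (m * E) := by
          rw [← Finset.mul_sum]
          gcongr
          exact sum_abs_apply_le_sqrt_empRegMoment hm hl D d
      _ = m * (κ * ‖f - w‖ * E) := by ring
  have hpenalty : -(m * l * inner ℝ w d) ≤ m * (√l * ‖f‖ * E) := by
    calc -(m * l * inner ℝ w d) ≤ m * l * (‖w‖ * ‖d‖) := by
          rw [← mul_neg]
          gcongr
          exact (neg_le_abs _).trans (abs_real_inner_le_norm w d)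
      _ = m * (√l * ‖w‖ * (√l * ‖d‖)) := by
          nth_rewrite 1 [← Real.mul_self_sqrt hl]
          ring
      _ ≤ m * (√l * ‖f‖ * E) := by
          gcongr
          · exact W.norm_starProjection_apply_le f
          · exact sqrt_mul_norm_le_sqrt_empRegMoment hl D d
  have hquad : m * (E * E) ≤ m * (E * (T + κ * ‖f - w‖ + √l * ‖f‖)) := by
    rw [hE, Real.mul_self_sqrt (empRegMoment_nonneg hl D d), hg.empRegMoment_sub_eq hm hwW f]
    linarith [hnoise d (W.sub_mem hg.1 hwW)]
  rcases (Real.sqrt_nonneg (empRegMoment D l d)).eq_or_lt with hzero | hpos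
  · rw [hE, ← hzero]
    positivity
  · exact le_of_mul_le_mul_left (le_of_mul_le_mul_left hquad (by positivity)) hpos

variable [IsProbabilityMeasure μ]

theorem IsRegressionFunction.excessRisk_eq (hf : IsRegressionFunction μ f) (hκ : 0 ≤ κ)
    (hK : KernelAssumptions H κ) (hY : MemLp Prod.snd 2 μ) (g : H) :
    excessRisk μ g f = √(∫ p, (g - f) p.1 ^ 2 ∂μ) := by
  have hresidual : ∀ h : H, MemLp (fun p : X × ℝ => p.2 - h p.1) 2 μ := fun h =>
    hY.sub (memLp_apply hκ hK h 2)
  have hdiff := memLp_apply (μ := μ) hκ hK (g - f) 2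
  have hcross := hf.integral_residual_smul (h := fun x => (g - f) x)
    (measurable_coe hK (g - f)).stronglyMeasurable fun x => abs_apply_le hκ hK _ x
  have hexpand : ∀ p : X × ℝ, (p.2 - g p.1) ^ 2 - (p.2 - f p.1) ^ 2
      = (g - f) p.1 ^ 2 - 2 * ((p.2 - f p.1) * (g - f) p.1) := by
    intro p
    rw [RKHS.coe_sub, Pi.sub_apply]
    ring
  have hcross_int : Integrable (fun p : X × ℝ => (p.2 - f p.1) * (g - f) p.1) μ :=
    (hresidual f).integrable_mul hdiff
  simp only [smul_eq_mul] at hcross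
  rw [excessRisk, risk, risk,
    ← integral_sub (hresidual g).integrable_sq (hresidual f).integrable_sq]
  simp only [hexpand]
  rw [integral_sub hdiff.integrable_sq (hcross_int.const_mul 2),
    integral_const_mul, hcross, mul_zero, sub_zero]

theorem sqrt_integral_sub_apply_sq_le (hκ : 0 ≤ κ) (hK : KernelAssumptions H κ) (g q : H) :
    √(∫ p, (g - q) p.1 ^ 2 ∂μ) ≤ 2 * (√(∫ p, g p.1 ^ 2 ∂μ) + κ * ‖q‖) := by
  have hint : ∀ h : H, Integrable (fun p : X × ℝ => h p.1 ^ 2) μ := fun h =>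
    (memLp_apply hκ hK h 2).integrable_sq
  refine Real.sqrt_le_iff.2 ⟨by positivity, ?_⟩
  set a := √(∫ p, g p.1 ^ 2 ∂μ) with ha
  calc ∫ p, (g - q) p.1 ^ 2 ∂μ ≤ ∫ p, (2 * g p.1 ^ 2 + 2 * q p.1 ^ 2) ∂μ := by
        refine integral_mono (hint _) (((hint g).const_mul 2).add ((hint q).const_mul 2))
          fun p => ?_
        simp only [RKHS.coe_sub, Pi.sub_apply]
        linarith [sq_nonneg (g p.1 + q p.1)]
    _ = 2 * ∫ p, g p.1 ^ 2 ∂μ + 2 * ∫ p, q p.1 ^ 2 ∂μ := by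
        rw [integral_add ((hint g).const_mul 2) ((hint q).const_mul 2), integral_const_mul,
          integral_const_mul]
    _ ≤ 2 * a ^ 2 + 2 * (κ ^ 2 * ‖q‖ ^ 2) := by
        rw [ha, Real.sq_sqrt (integral_nonneg fun p => sq_nonneg _)]
        gcongr
        exact integral_apply_sq_le hκ hK q
    _ ≤ (2 * (a + κ * ‖q‖)) ^ 2 := by
        have hcross : 0 ≤ a * (κ * ‖q‖) := by positivity
        linarith [sq_nonneg a, sq_nonneg (κ * ‖q‖), mul_pow κ ‖q‖ 2]

theorem excessRisk_ridge_le (hκ : 0 ≤ κ) (hK : KernelAssumptions H κ) {W : Submodule ℝ H}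
    [CompleteSpace W] (hf : IsRegressionFunction μ f) (hY : MemLp Prod.snd 2 μ) {m : ℕ}
    (hm : 0 < m) {l ρ c T : ℝ} (hl : 0 < l) (hρ : 0 ≤ ρ) (hc : 0 ≤ c) (hT : 0 ≤ T)
    {D : Fin m → X × ℝ}
    (hdom : ∀ g ∈ W, regMoment μ ρ g ≤ c ^ 2 * empRegMoment D l g)
    (hnoise : ∀ g ∈ W, |∑ j, ((D j).2 - f (D j).1) * g (D j).1| ≤ T * √(regMoment μ ρ g)) :
    excessRisk μ (ridge W l D) f
      ≤ 2 * c * (c * T / m + √l * ‖f‖) + 2 * (c + 1) * (κ * ‖f - W.starProjection f‖) := by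
  have hR := isRidge_ridge hm W hl D
  set w := W.starProjection f
  set d := ridge W l D - w with hd
  have hdom_sqrt : ∀ g ∈ W, √(regMoment μ ρ g) ≤ c * √(empRegMoment D l g) := by
    intro g hg
    refine (Real.sqrt_le_sqrt (hdom g hg)).trans_eq ?_
    rw [Real.sqrt_mul (sq_nonneg c), Real.sqrt_sq hc]
  have hemp : √(empRegMoment D l d) ≤ c * T / m + κ * ‖f - w‖ + √l * ‖f‖ := by
    refine hR.sqrt_empRegMoment_sub_starProjection_le hκ hK hm hl.le (by positivity)
      fun g hg => ?_
    calc ∑ j, ((D j).2 - f (D j).1) * g (D j).1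
        ≤ T * (c * √(empRegMoment D l g)) :=
          (le_abs_self _).trans ((hnoise g hg).trans (by gcongr; exact hdom_sqrt g hg))
      _ = m * (c * T / m * √(empRegMoment D l g)) := by field_simp
  have hpop : √(∫ p, d p.1 ^ 2 ∂μ) ≤ c * √(empRegMoment D l d) := by
    refine (Real.sqrt_le_sqrt ?_).trans
      (hdom_sqrt d (W.sub_mem hR.1 (W.starProjection_apply_mem f)))
    exact le_add_of_nonneg_right (by positivity)
  calc excessRisk μ (ridge W l D) f = √(∫ p, (d - (f - w)) p.1 ^ 2 ∂μ) := by
        rw [hf.excessRisk_eq hκ hK hY, hd, sub_sub, add_sub_cancel]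
    _ ≤ 2 * (√(∫ p, d p.1 ^ 2 ∂μ) + κ * ‖f - w‖) := sqrt_integral_sub_apply_sq_le hκ hK d _
    _ ≤ 2 * (c * (c * T / m + κ * ‖f - w‖ + √l * ‖f‖) + κ * ‖f - w‖) := by
        gcongr
        exact hpop.trans (mul_le_mul_of_nonneg_left hemp hc)
    _ = 2 * c * (c * T / m + √l * ‖f‖) + 2 * (c + 1) * (κ * ‖f - w‖) := by ring

end TargetRisk

section TargetTail

theorem max_log_le_mul {s τ : ℝ} (hs : 1 ≤ s) (hτ : 1 ≤ τ) : max (Real.log s) τ ≤ τ * s := by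
  refine max_le ((Real.log_le_self (by linarith)).trans ?_) ?_ <;> nlinarith

theorem sqrt_regularization_le {κ s τ : ℝ} (hκ : 0 ≤ κ) (hs : 1 ≤ s) (hτ : 1 ≤ τ) (m : ℕ) :
    √(12 * κ ^ 2 * max (Real.log s) τ / m) ≤ 4 * κ * (τ * √(s / m)) := by
  refine Real.sqrt_le_iff.2 ⟨by positivity, ?_⟩
  have hlog : max (Real.log s) τ ≤ τ ^ 2 * s := by
    refine (max_log_le_mul hs hτ).trans ?_
    gcongr
    nlinarith
  calc 12 * κ ^ 2 * max (Real.log s) τ / m ≤ 16 * κ ^ 2 * (τ ^ 2 * s) / m := by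
        gcongr
        norm_num
    _ = (4 * κ * (τ * √(s / m))) ^ 2 := by
        rw [mul_pow, mul_pow, mul_pow, Real.sq_sqrt (by positivity)]
        ring

theorem exp_tail_sum_le {L τ : ℝ} (hτ : 2 ≤ τ) (hτL : τ ≤ L) :
    3 * Real.exp (-(2 * L)) + 2 * Real.exp 1 * Real.exp (-(2 * τ)) ≤ 3 * Real.exp (-τ) := by
  have hexp : 3 ≤ Real.exp τ := by linarith [Real.add_one_le_exp τ]
  calc 3 * Real.exp (-(2 * L)) + 2 * Real.exp 1 * Real.exp (-(2 * τ))
      ≤ 3 * Real.exp (-(2 * τ)) + 2 * 3 * Real.exp (-(2 * τ)) := by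
        gcongr
        exact (Real.exp_one_lt_d9.trans (by norm_num)).le
    _ = 3 * (3 * Real.exp (-(2 * τ))) := by ring
    _ ≤ 3 * (Real.exp τ * Real.exp (-(2 * τ))) := by gcongr
    _ = 3 * Real.exp (-τ) := by rw [← Real.exp_add]; congr 2; ring

/-- The factor of `√(s / m)` in the excess risk of the ridge estimator over a subspace of
dimension `s`, for labels bounded by `B` and a regression function of norm at most `F`. -/
def targetConst (κ B F : ℝ) : ℝ :=
  800 * (800 * (B + κ * F + 1) + 4 * κ * F)

theorem targetConst_nonneg {κ B F : ℝ} (hκ : 0 ≤ κ) (hB : 0 ≤ B) (hF : 0 ≤ F) :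
    0 ≤ targetConst κ B F := by
  unfold targetConst
  positivity

theorem estimation_error_le {κ B F s τ : ℝ} (hκ : 0 ≤ κ) (hF : 0 ≤ F) (hs : 1 ≤ s) (hτ : 1 ≤ τ)
    (m : ℕ) :
    2 * 400 * (400 * (2 * τ * (B + κ * F + 1) * √(m * s)) / m
        + √(12 * κ ^ 2 * max (Real.log s) τ / m) * F)
      ≤ targetConst κ B F * (τ * √(s / m)) := by
  have hsqrt : √(m * s) / m = √(s / m) := by
    rw [mul_comm, Real.sqrt_mul (by linarith), Real.sqrt_div (by linarith), mul_div_assoc,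
      Real.sqrt_div_self, div_eq_mul_inv]
  calc 2 * 400 * (400 * (2 * τ * (B + κ * F + 1) * √(m * s)) / m
        + √(12 * κ ^ 2 * max (Real.log s) τ / m) * F)
      = 800 * (800 * (B + κ * F + 1) * (τ * (√(m * s) / m))
        + √(12 * κ ^ 2 * max (Real.log s) τ / m) * F) := by ring
    _ ≤ 800 * (800 * (B + κ * F + 1) * (τ * √(s / m)) + 4 * κ * (τ * √(s / m)) * F) := by
        rw [hsqrt]
        gcongr
        exact sqrt_regularization_le hκ hs hτ m
    _ = targetConst κ B F * (τ * √(s / m)) := by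
        unfold targetConst
        ring

variable {X H : Type*} [MeasurableSpace X] [NormedAddCommGroup H] [InnerProductSpace ℝ H]
  [RKHS ℝ H X ℝ] [CompleteSpace H] {κ : ℝ}

theorem KernelAssumptions.pos [Nontrivial H] (hK : KernelAssumptions H κ) (hκ : 0 ≤ κ) :
    0 < κ := by
  refine hκ.lt_of_ne fun hzero => ?_
  obtain ⟨f, hf⟩ := exists_ne (0 : H)
  refine hf (DFunLike.coe_injective (funext fun x => ?_))
  have hle : ∀ g : H, |g x| ≤ 0 := fun g => by
    simpa [← hzero] using abs_apply_le hκ hK g x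
  rw [abs_nonpos_iff.1 (hle f), abs_nonpos_iff.1 (hle 0)]

variable {μ : Measure (X × ℝ)} {f : H} {B F : ℝ}

theorem ae_abs_sub_apply_le (hκ : 0 ≤ κ) (hK : KernelAssumptions H κ)
    (hB : ∀ᵐ p ∂μ, |p.2| ≤ B) (hF : ‖f‖ ≤ F) : ∀ᵐ p ∂μ, |p.2 - f p.1| ≤ B + κ * F := by
  filter_upwards [hB] with p hp
  have hfF : |f p.1| ≤ κ * F := (abs_apply_le hκ hK f p.1).trans (by gcongr)
  linarith [abs_sub p.2 (f p.1)]

variable [TopologicalSpace.SeparableSpace H] [IsProbabilityMeasure μ] {τ : ℝ} {m : ℕ}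

theorem measure_excessRisk_ridge_gt_le (hκ : 0 < κ) (hK : KernelAssumptions H κ)
    (W : Submodule ℝ H) [FiniteDimensional ℝ W] {s : ℕ} (hW : Module.finrank ℝ W = s)
    (hs : 1 ≤ s) (hf : IsRegressionFunction μ f) (hB : ∀ᵐ p ∂μ, |p.2| ≤ B) (hF : ‖f‖ ≤ F)
    (hτ : 2 ≤ τ) (hm : 0 < m) :
    (Measure.pi fun _ : Fin m => μ) {D : Fin m → X × ℝ |
        targetConst κ B F * (τ * √((s : ℝ) / m)) + 802 * (κ * ‖f - W.starProjection f‖)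
          < excessRisk μ (ridge W (12 * κ ^ 2 * max (Real.log s) τ / m) D) f}
      ≤ ENNReal.ofReal (3 * Real.exp (-τ)) := by
  subst hW
  have hs' : (1 : ℝ) ≤ Module.finrank ℝ W := by exact_mod_cast hs
  have hF0 : 0 ≤ F := (norm_nonneg _).trans hF
  have hB0 : 0 ≤ B := hB.exists.elim fun p hp => (abs_nonneg _).trans hp
  set L := max (Real.log (Module.finrank ℝ W)) τ
  have hτL : τ ≤ L := le_max_right _ _
  have hWL : (Module.finrank ℝ W : ℝ) ≤ Real.exp L :=
    (Real.log_le_iff_le_exp (by linarith)).1 (le_max_left _ _)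
  set l := 12 * κ ^ 2 * L / m with hl
  have hL : 1 ≤ L := by linarith
  have hl0 : 0 < l := by positivity
  have hlabels : MemLp Prod.snd 2 μ := MemLp.of_bound measurable_snd.aestronglyMeasurable B hB
  have hκl : κ ^ 2 ≤ m * (224 * l) := by
    have hml : (m : ℝ) * (224 * l) = 2688 * L * κ ^ 2 := by rw [hl]; field_simp; ring
    rw [hml]
    exact le_mul_of_one_le_left (sq_nonneg κ) (by linarith)
  have hdom := measure_empRegMoment_lt_regMoment_le_exp (μ := μ) hκ hK W (by linarith) hWL hm hl
  have hnoise := hf.measure_noise_gt_le hκ.le hK W hs (B := B + κ * F + 1) (by positivity)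
    ((ae_abs_sub_apply_le hκ.le hK hB hF).mono fun p hp => by linarith) hm
    (ρ := 224 * l) (by positivity) hκl (t := 2 * τ) (by linarith)
  refine (measure_mono (t := _ ∪ _) fun D hD => ?_).trans ((measure_union_le _ _).trans
    ((add_le_add hdom hnoise).trans ?_))
  · by_contra hgood
    simp only [Set.mem_union, Set.mem_ofPred_eq, not_or, not_exists, not_and, not_lt] at hgood
    refine hD.not_ge ((excessRisk_ridge_le hκ.le hK hf hlabels hm hl0 (by positivity)
      (by norm_num) (by positivity) hgood.1 hgood.2).trans ?_)
    refine add_le_add (le_trans ?_ (estimation_error_le hκ.le hF0 hs' (by linarith) m))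
      (by norm_num)
    gcongr
  · rw [← ENNReal.ofReal_add (by positivity) (by positivity)]
    exact ENNReal.ofReal_le_ofReal (exp_tail_sum_le hτ hτL)

theorem IsTopRightSingular.measure_excessRisk_ridge_span_gt_le (hκ : 0 ≤ κ)
    (hK : KernelAssumptions H κ) {N s : ℕ} {g : Fin N → H} {γ : ℝ} (hγ : 0 < γ)
    (hgap : ∀ t : ℝ, t ≠ 0 → Module.End.HasEigenvalue (taskCov g : H →ₗ[ℝ] H) t → γ ≤ t)
    (hs : Module.finrank ℝ (Submodule.span ℝ (Set.range g)) = s) (hs1 : 1 ≤ s)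
    (hfg : f ∈ Submodule.span ℝ (Set.range g)) {A : H →L[ℝ] H} {v : Fin s → H}
    (hv : IsTopRightSingular A v) {Δ : ℝ} (hΔ : 0 ≤ Δ)
    (hA : hsNorm (A - taskCov g) ≤ ENNReal.ofReal Δ) (hf : IsRegressionFunction μ f)
    (hB : ∀ᵐ p ∂μ, |p.2| ≤ B) (hF : ‖f‖ ≤ F) (hτ : 2 ≤ τ) (hm : 0 < m) :
    (Measure.pi fun _ : Fin m => μ) {D : Fin m → X × ℝ |
        targetConst κ B F * (τ * √((s : ℝ) / m)) + 802 * (κ * (2 * Δ * F / γ))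
          < excessRisk μ (ridge (Submodule.span ℝ (Set.range v))
              (12 * κ ^ 2 * max (Real.log s) τ / m) D) f}
      ≤ ENNReal.ofReal (3 * Real.exp (-τ)) := by
  have : FiniteDimensional ℝ (Submodule.span ℝ (Set.range v)) :=
    FiniteDimensional.span_of_finite ℝ (Set.finite_range v)
  have : Nontrivial H := ⟨v ⟨0, hs1⟩, 0, hv.1.ne_zero _⟩
  have hdim : Module.finrank ℝ (Submodule.span ℝ (Set.range v)) = s := by
    rw [finrank_span_eq_card hv.1.linearIndependent, Fintype.card_fin]
  refine (measure_mono fun D hD => ?_).trans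
    (measure_excessRisk_ridge_gt_le (hK.pos hκ) hK _ hdim hs1 hf hB hF hτ hm)
  have happrox := hv.norm_sub_starProjection_le hγ hgap hfg hs hΔ
    fun x => norm_apply_le_of_hsNorm_le hΔ hA x
  rw [Set.mem_ofPred_eq] at hD ⊢
  refine lt_of_le_of_lt ?_ hD
  gcongr
  exact happrox.trans (by gcongr)

end TargetTail

section Constants

/-- The constant `C` of the excess risk bound: the first summand is the estimation error on the
target task, the second one the error of learning the subspace from the source tasks. -/
def excessRiskConst (κ R B γ F a : ℝ) : ℝ :=
  targetConst κ B F + 802 * (κ * (2 * sourceConst κ R B a * F / γ))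

theorem targetConst_mul_add_le {κ R B γ F a τ w u : ℝ} (hκ : 0 ≤ κ) (hB : 0 ≤ B) (hγ : 0 ≤ γ)
    (hF : 0 ≤ F) (hτ : 0 ≤ τ) (hw : 0 ≤ w) (hu : 0 ≤ u) :
    targetConst κ B F * (τ * w) + 802 * (κ * (2 * (sourceConst κ R B a * τ * u) * F / γ))
      ≤ excessRiskConst κ R B γ F a * τ * (w + u) := by
  have htarget := targetConst_nonneg hκ hB hF
  have hsource := sourceConst_nonneg κ R B a
  have hcross : 0 ≤ targetConst κ B F * (τ * u)
      + 802 * (κ * (2 * sourceConst κ R B a * F / γ)) * (τ * w) := by positivity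
  calc targetConst κ B F * (τ * w) + 802 * (κ * (2 * (sourceConst κ R B a * τ * u) * F / γ))
      ≤ targetConst κ B F * (τ * w)
        + 802 * (κ * (2 * (sourceConst κ R B a * τ * u) * F / γ)) + _ :=
        le_add_of_nonneg_right hcross
    _ = excessRiskConst κ R B γ F a * τ * (w + u) := by
        unfold excessRiskConst
        ring

theorem KernelAssumptions.sample_size_pos {X H : Type*} [MeasurableSpace X]
    [NormedAddCommGroup H] [InnerProductSpace ℝ H] [RKHS ℝ H X ℝ] [CompleteSpace H] {κ : ℝ}
    (hK : KernelAssumptions H κ) (hκ : 0 ≤ κ) {W : Submodule ℝ H} (hW : 0 < Module.finrank ℝ W)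
    {L : ℝ} (hL : 0 < L) {m : ℕ} (hm : 12 * κ ^ 2 * L ≤ m) : 0 < m := by
  have : Nontrivial W := Module.nontrivial_of_finrank_pos hW
  have : Nontrivial H := W.subtype_injective.nontrivial
  have hκ0 := hK.pos hκ
  exact_mod_cast (by positivity : 0 < 12 * κ ^ 2 * L).trans_le hm

end Constants

end MetaKRR

end

theorem mainTheorem10_general :
    (∃ J : ℝ → ℝ → ℝ, ∀ (X : Type*) (H : Type*) [MeasurableSpace X] [NormedAddCommGroup H]
      [InnerProductSpace ℝ H] [CompleteSpace H] [TopologicalSpace.SeparableSpace H]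
      [RKHS ℝ H X ℝ] (κ R r l : ℝ) (N n : ℕ)
      (μ : Fin N → Measure (X × ℝ)) [∀ i, IsProbabilityMeasure (μ i)] (f : Fin N → H),
      0 ≤ κ → MetaKRR.KernelAssumptions H κ →
      0 ≤ r → r ≤ 1 → 0 < l → 1 ≤ n →
      (∀ i, MetaKRR.IsRegressionFunction (μ i) (f i)) →
      (∀ i, MetaKRR.SourceCondition (μ i) r R (f i)) →
      (∀ i, Integrable (fun D => MetaKRR.ridge (⊤ : Submodule ℝ H) l D)
        (Measure.pi fun _ : Fin n => μ i)) ∧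
      MetaKRR.hsNorm (MetaKRR.taskCov (fun i => MetaKRR.meanRidge H n l (μ i))
          - MetaKRR.taskCov f)
        ≤ ENNReal.ofReal (J κ R * l ^ r * (1 + 1 / (l * √(n : ℝ))))) ∧
    (∃ C : ℝ → ℝ → ℝ → ℝ → ℝ → ℝ → ℝ, ∀ (X : Type*) (H : Type*) [MeasurableSpace X]
      [NormedAddCommGroup H] [InnerProductSpace ℝ H] [CompleteSpace H]
      [TopologicalSpace.SeparableSpace H] [RKHS ℝ H X ℝ]
      (κ R B γ F a r τ : ℝ) (s N n nT : ℕ)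
      (μ : Fin N → Measure (X × ℝ)) [∀ i, IsProbabilityMeasure (μ i)]
      (μT : Measure (X × ℝ)) [IsProbabilityMeasure μT]
      (f : Fin N → H) (fT : H) (Hs : Submodule ℝ H),
      0 ≤ κ → MetaKRR.KernelAssumptions H κ →
      0 ≤ r → r ≤ 1 → 0 < a → 0 < γ → 2 ≤ τ → 1 ≤ s → 1 ≤ n →
      a * Real.exp n ≤ N → 0 < nT →
      (∀ i, MetaKRR.IsRegressionFunction (μ i) (f i)) →
      MetaKRR.IsRegressionFunction μT fT →
      Module.finrank ℝ Hs = s → Submodule.span ℝ (Set.range f) = Hs → fT ∈ Hs →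
      (∀ i, MetaKRR.SourceCondition (μ i) r R (f i)) →
      (∀ i, ∀ᵐ p ∂μ i, |p.2| ≤ B) → (∀ᵐ p ∂μT, |p.2| ≤ B) →
      (∀ t : ℝ, t ≠ 0 →
        Module.End.HasEigenvalue (MetaKRR.taskCov f : H →ₗ[ℝ] H) t → γ ≤ t) →
      ‖fT‖ ≤ F →
      MetaKRR.sourceLaw n μ
        {D | ∃ v : Fin s → H,
          MetaKRR.IsTopRightSingular (MetaKRR.empTaskCov H ((n : ℝ) ^ (-(1 / 2) : ℝ)) D) v ∧
          ENNReal.ofReal (3 * Real.exp (-τ)) <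
            (Measure.pi fun _ : Fin nT => μT)
              {DT | C κ R B γ F a * τ * (√((s : ℝ) / nT) + (n : ℝ) ^ (-(r / 2))) <
                MetaKRR.excessRisk μT
                  (MetaKRR.ridge (Submodule.span ℝ (Set.range v))
                    (12 * κ ^ 2 * max (Real.log s) τ / nT) DT) fT}}
        ≤ ENNReal.ofReal (Real.exp (-τ))) := by
  refine ⟨⟨fun κ R => 2 * R ^ 2 * max 1 (κ ^ 2) ^ 2, ?_⟩, ⟨MetaKRR.excessRiskConst, ?_⟩⟩
  · intro X H _ _ _ _ _ _ κ R r l N n μ _ f hκ hK hr0 hr1 hl hn hf hs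
    exact ⟨fun i => MetaKRR.integrable_ridge hκ hK hn hl (hf i).1,
      MetaKRR.hsNorm_taskCov_meanRidge_sub_le hκ hK hn hl hr0 hr1 μ f hf hs⟩
  · rintro X H _ _ _ _ _ _ κ R B γ F a r τ s N n nT μ _ μT _ f fT Hs hκ hK hr0 hr1 ha hγ hτ hs1
      hn hN hnT hf hfT hHs rfl hfTs hsrc hB hBT hgap hF
    refine (measure_mono ?_).trans (MetaKRR.sourceLaw_hsNorm_empTaskCov_sub_taskCov_gt_le
      hκ hK hn hr0 hr1 ha (by linarith) hN hf hsrc hB)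
    rintro D ⟨v, hv, hrisk⟩
    by_contra hD
    have hB0 : 0 ≤ B := hBT.exists.elim fun p hp => (abs_nonneg _).trans hp
    have hF0 : 0 ≤ F := (norm_nonneg _).trans hF
    have hsource := MetaKRR.sourceConst_nonneg κ R B a
    refine hrisk.not_ge ((measure_mono fun DT hDT => ?_).trans
      (hv.measure_excessRisk_ridge_span_gt_le hκ hK hγ hgap hHs hs1 hfTs (by positivity)
        (not_lt.1 hD) hfT hBT hF hτ hnT))
    exact (MetaKRR.targetConst_mul_add_le hκ hB0 hγ.le hF0 (by positivity) (by positivity)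
      (by positivity)).trans_lt hDT

theorem mainTheorem10 :
    -- bias bound
    (∃ J : ℝ → ℝ → ℝ, ∀ (X : Type*) (H : Type*) [MeasurableSpace X] [NormedAddCommGroup H]
      [InnerProductSpace ℝ H] [CompleteSpace H] [TopologicalSpace.SeparableSpace H]
      [RKHS ℝ H X ℝ] (κ R r l : ℝ) (N n : ℕ)
      (μ : Fin N → Measure (X × ℝ)) [∀ i, IsProbabilityMeasure (μ i)] (f : Fin N → H),
      0 ≤ κ → MetaKRR.KernelAssumptions H κ →
      0 ≤ r → r ≤ 1 → 0 < l → l ≤ 1 → 1 ≤ n →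
      (∀ i, MetaKRR.IsRegressionFunction (μ i) (f i)) →
      (∀ i, MetaKRR.SourceCondition (μ i) r R (f i)) →
      (∀ i, Integrable (fun D => MetaKRR.ridge (⊤ : Submodule ℝ H) l D)
        (Measure.pi fun _ : Fin n => μ i)) ∧
      MetaKRR.hsNorm (MetaKRR.taskCov (fun i => MetaKRR.meanRidge H n l (μ i))
          - MetaKRR.taskCov f)
        ≤ ENNReal.ofReal (J κ R * l ^ r * (1 + 1 / (l * √(n : ℝ))))) ∧
    -- excess risk in the regime of at least exponentially many source tasks
    (∃ C : ℝ → ℝ → ℝ → ℝ → ℝ → ℝ → ℝ, ∀ (X : Type*) (H : Type*) [MeasurableSpace X]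
      [NormedAddCommGroup H] [InnerProductSpace ℝ H] [CompleteSpace H]
      [TopologicalSpace.SeparableSpace H] [RKHS ℝ H X ℝ]
      (κ R B γ F a r τ : ℝ) (s N n nT : ℕ)
      (μ : Fin N → Measure (X × ℝ)) [∀ i, IsProbabilityMeasure (μ i)]
      (μT : Measure (X × ℝ)) [IsProbabilityMeasure μT]
      (f : Fin N → H) (fT : H) (Hs : Submodule ℝ H),
      0 ≤ κ → MetaKRR.KernelAssumptions H κ →
      0 ≤ r → r ≤ 1 → 0 < a → 0 < γ → 13 / 5 ≤ τ → 1 ≤ s → 1 ≤ n →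
      a * Real.exp n ≤ N → 12 * κ ^ 2 * max (Real.log s) τ ≤ nT →
      (∀ i, MetaKRR.IsRegressionFunction (μ i) (f i)) →
      MetaKRR.IsRegressionFunction μT fT →
      Module.finrank ℝ Hs = s → Submodule.span ℝ (Set.range f) = Hs → fT ∈ Hs →
      (∀ i, MetaKRR.SourceCondition (μ i) r R (f i)) →
      (∀ i, ∀ᵐ p ∂μ i, |p.2| ≤ B) → (∀ᵐ p ∂μT, |p.2| ≤ B) →
      (∀ t : ℝ, t ≠ 0 →
        Module.End.HasEigenvalue (MetaKRR.taskCov f : H →ₗ[ℝ] H) t → γ ≤ t) →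
      ‖fT‖ ≤ F →
      MetaKRR.sourceLaw n μ
        {D | ∃ v : Fin s → H,
          MetaKRR.IsTopRightSingular (MetaKRR.empTaskCov H ((n : ℝ) ^ (-(1 / 2) : ℝ)) D) v ∧
          ENNReal.ofReal (3 * Real.exp (-τ)) <
            (Measure.pi fun _ : Fin nT => μT)
              {DT | C κ R B γ F a * τ * (√((s : ℝ) / nT) + (n : ℝ) ^ (-(r / 2))) <
                MetaKRR.excessRisk μT
                  (MetaKRR.ridge (Submodule.span ℝ (Set.range v))
                    (12 * κ ^ 2 * max (Real.log s) τ / nT) DT) fT}}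
        ≤ ENNReal.ofReal (2 * Real.exp (-τ))) := by
  refine mainTheorem10_general.imp (fun ⟨J, hJ⟩ => ⟨J, ?_⟩) (fun ⟨C, hC⟩ => ⟨C, ?_⟩)
  · intro X H _ _ _ _ _ _ κ R r l N n μ _ f hκ hK hr0 hr1 hl _
    exact hJ X H κ R r l N n μ f hκ hK hr0 hr1 hl
  · intro X H _ _ _ _ _ _ κ R B γ F a r τ s N n nT μ _ μT _ f fT Hs hκ hK hr0 hr1 ha hγ hτ hs hn
      hN hnT hf hfT hHs hspan hfTs hsrc hB hBT hgap hF
    have hnT0 : 0 < nT := hK.sample_size_pos hκ (W := Hs) (hHs ▸ hs)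
      (lt_max_of_lt_right (by linarith)) hnT
    refine (hC X H κ R B γ F a r τ s N n nT μ μT f fT Hs hκ hK hr0 hr1 ha hγ (by linarith) hs hn hN
      hnT0 hf hfT hHs hspan hfTs hsrc hB hBT hgap hF).trans (ENNReal.ofReal_le_ofReal ?_)
    linarith [Real.exp_pos (-τ)]
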